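/- Let $k$ be an algebraically closed field of characteristic zero. A variety is an irreducible variety over $k$ (an integral separated $k$-scheme of finite type), $\mathrm{Bir}(X)$ is the group of $k$-birational self-maps of a variety $X$, and $\mathrm{Cr}_1=\mathrm{Bir}(\mathbf P^1)$. A rational action of a finite group $G$ on $X$ is an injective homomorphism $\varrho\colon G\to \mathrm{Bir}(X)$. A compression of a rational action $\varrho_1$ of $G$ on $X_1$ into a rational action $\varrho_2$ of $G$ on $X_2$ is a $G$-equivariant dominant rational map $\varphi\colon X_1\dashrightarrow X_2$ over $k$; it is nontrivial if it is not a birational isomorphism. For finite subgroups $H_i\subseteq \mathrm{Bir}(X_i)$, a compression of $H_1$ into $H_2$ is a map $\varphi\colon X_1\dashrightarrow X_2$ which is a compression of $\varrho_1$ into $\varrho_2$ for some rational actions $\varrho_1,\varrho_2$ of one finite group with images $H_1,H_2$. A finite subgroup $H\subseteq \mathrm{Bir}(X)$ is nontrivially self-compressible if some rational action of a finite group on $X$ with image $H$ has a nontrivial compression into itself. (i) Every finite subgroup of $\mathrm{Cr}_1$ is nontrivially self-compressible. (ii) Let $\varphi\colon \mathbf P^1\dashrightarrow X$ be a compression of a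 finite subgroup $H_1\subset\mathrm{Cr}_1$ into a subgroup $H_2\subset \mathrm{Bir}(X)$, where $X$ is a variety, and assume that $H_1$ is nontrivial or $\dim X>0$. Then $X$ is birationally isomorphic to $\mathbf P^1$ over $k$, and for every birational isomorphism $\beta\colon X\dashrightarrow \mathbf P^1$ over $k$ the map $\beta\circ\varphi$ is (represented by) a $k$-morphism $\mathbf P^1\to\mathbf P^1$, it is a compression of $H_1$ into $\beta H_2\beta^{-1}\subset \mathrm{Cr}_1$, and $\beta H_2\beta^{-1}$ is conjugate to $H_1$ in $\mathrm{Cr}_1$. -/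

import Mathlib

open CategoryTheory AlgebraicGeometry AlgebraicGeometry.Scheme

universe u

/-- An irreducible algebraic variety over the algebraically closed field `k`: an integral
separated scheme of finite type over `Spec k`. -/
structure Variety (k : Type u) [Field k] where
  /-- the underlying scheme -/
  scheme : Scheme.{u}
  /-- the structure morphism -/
  toSpec : scheme ⟶ Spec (.of k)
  isIntegral : IsIntegral scheme
  isSeparated : IsSeparated toSpec
  locallyOfFiniteType : LocallyOfFiniteType toSpec
  quasiCompact : QuasiCompact toSpec

namespace Variety

variable {k : Type u} [Field k]

attribute [instance] isIntegral isSeparated locallyOfFiniteType quasiCompact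

instance (X : Variety k) : X.scheme.Over (Spec (.of k)) := ⟨X.toSpec⟩

/-- The dimension of a variety. -/
noncomputable def dim (X : Variety k) : WithBot ℕ∞ := topologicalKrullDim X.scheme

/-- A dominant rational map `X ⤏ Y` defined over `k`. -/
@[ext]
structure DominantRationalMap (X Y : Variety k) where
  /-- the underlying rational map of schemes -/
  map : X.scheme ⤏ Y.scheme
  isDominant : map.IsDominant
  isOver : map.IsOver (Spec (.of k))

attribute [instance] DominantRationalMap.isDominant DominantRationalMap.isOver

/-- The category of irreducible varieties over `k` and dominant rational maps over `k`. The
composite `f ≫ g` is the rational map `g ∘ f`. Isomorphisms in this category are the birational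
isomorphisms over `k`. -/
noncomputable instance : Category (Variety k) where
  Hom X Y := DominantRationalMap X Y
  id X :=
    { map := RationalMap.id X.scheme
      isDominant := inferInstance
      isOver := inferInstance }
  comp f g :=
    { map := f.map.comp g.map
      isDominant := inferInstance
      isOver := inferInstance }
  id_comp f := DominantRationalMap.ext (RationalMap.id_comp f.map)
  comp_id f := DominantRationalMap.ext (RationalMap.comp_id f.map)
  assoc f g h := DominantRationalMap.ext (RationalMap.comp_assoc f.map g.map h.map)

/-- The group `Bir(X)` of birational self-maps of `X` over `k`. The product `a * b` is the
composite `a ∘ b`. -/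
abbrev Bir (X : Variety k) : Type u := Aut X

/-- `φ` is `G`-equivariant with respect to actions by birational self-maps. -/
def IsEquivariant {G : Type*} [Group G] {X Y : Variety k} (ρ : G →* X.Bir) (σ : G →* Y.Bir)
    (φ : X ⟶ Y) : Prop :=
  ∀ g : G, (ρ g).hom ≫ φ = φ ≫ (σ g).hom

/-- The dominant rational map `φ : X ⤏ Y` is a compression of the rational action `ρ` of `G` on `X`
into the rational action `σ` of `G` on `Y`. Rational actions are faithful. -/
structure IsCompression {G : Type*} [Group G] {X Y : Variety k} (ρ : G →* X.Bir)
    (σ : G →* Y.Bir) (φ : X ⟶ Y) : Prop where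
  faithful_left : Function.Injective ρ
  faithful_right : Function.Injective σ
  equivariant : IsEquivariant ρ σ φ

/-- A compression is nontrivial if it is not a birational isomorphism. -/
def IsNontrivial {X Y : Variety k} (φ : X ⟶ Y) : Prop := ¬ IsIso φ

/-- `φ : X ⤏ Y` is a compression of the subgroup `H₁` of `Bir(X)` into the subgroup `H₂` of
`Bir(Y)`: it is a compression for some rational actions of one finite group `G` whose images
are `H₁` and `H₂`. -/
def IsGroupCompression {X Y : Variety k} (H₁ : Subgroup X.Bir) (H₂ : Subgroup Y.Bir)
    (φ : X ⟶ Y) : Prop :=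
  ∃ (G : Type u) (_ : Group G) (_ : Finite G) (ρ : G →* X.Bir) (σ : G →* Y.Bir),
    ρ.range = H₁ ∧ σ.range = H₂ ∧ IsCompression ρ σ φ

/-- The subgroup `H` of `Bir(X)` is nontrivially self-compressible: a rational action of a finite
group with image `H` has a nontrivial compression into itself. -/
def IsNontriviallySelfCompressible {X : Variety k} (H : Subgroup X.Bir) : Prop :=
  ∃ (G : Type u) (_ : Group G) (_ : Finite G) (ρ : G →* X.Bir) (φ : X ⟶ X),
    ρ.range = H ∧ IsCompression ρ ρ φ ∧ IsNontrivial φ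

end Variety

section ProjectiveLine

attribute [local instance] MvPolynomial.gradedAlgebra

variable (k : Type u) [Field k]

/-- The projective line over `k` as a scheme, `Proj k[x₀, x₁]`. -/
noncomputable def projectiveLineScheme : Scheme.{u} :=
  Proj (MvPolynomial.homogeneousSubmodule (Fin 2) k)

/-- The structure morphism of the projective line. -/
noncomputable def projectiveLineToSpec : projectiveLineScheme k ⟶ Spec (.of k) :=
  Proj.toSpecZero (MvPolynomial.homogeneousSubmodule (Fin 2) k) ≫
    Spec.map (CommRingCat.ofHom
      (algebraMap k (MvPolynomial.homogeneousSubmodule (Fin 2) k 0)))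

theorem algebraMap_homogeneousSubmodule_zero_bijective :
    Function.Bijective (algebraMap k (MvPolynomial.homogeneousSubmodule (Fin 2) k 0)) := by
  constructor
  · intro a b h
    have := congrArg Subtype.val h
    exact MvPolynomial.C_injective (Fin 2) k this
  · rintro ⟨p, hp⟩
    rw [MvPolynomial.homogeneousSubmodule_zero] at hp
    obtain ⟨a, ha⟩ := Submodule.mem_one.mp hp
    exact ⟨a, Subtype.ext ha⟩

theorem projectiveLine_isProper : IsProper (projectiveLineToSpec k) := by
  have h1 : IsIso (Spec.map (CommRingCat.ofHom
      (algebraMap k (MvPolynomial.homogeneousSubmodule (Fin 2) k 0)))) := by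
    have : IsIso (CommRingCat.ofHom
      (algebraMap k (MvPolynomial.homogeneousSubmodule (Fin 2) k 0))) :=
      (ConcreteCategory.isIso_iff_bijective _).mpr (algebraMap_homogeneousSubmodule_zero_bijective k)
    infer_instance
  have h3 : IsScalarTower k (MvPolynomial.homogeneousSubmodule (Fin 2) k 0)
      (MvPolynomial (Fin 2) k) :=
    ⟨fun a b c => smul_mul_assoc a (b : MvPolynomial (Fin 2) k) c⟩
  have h2 : Algebra.FiniteType (MvPolynomial.homogeneousSubmodule (Fin 2) k 0)
      (MvPolynomial (Fin 2) k) :=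
    Algebra.FiniteType.of_restrictScalars_finiteType k _ _
  have h4 : IsProper (Proj.toSpecZero (MvPolynomial.homogeneousSubmodule (Fin 2) k)) :=
    inferInstance
  exact MorphismProperty.comp_mem _ _ _ h4 inferInstance

theorem projectiveLine_isReduced : IsReduced (projectiveLineScheme k) := by
  have (x : projectiveLineScheme k) :
      _root_.IsReduced ((projectiveLineScheme k).presheaf.stalk x) := by
    let x' : ProjectiveSpectrum (MvPolynomial.homogeneousSubmodule (Fin 2) k) := x
    have e := (Proj.stalkIso (MvPolynomial.homogeneousSubmodule (Fin 2) k) x).commRingCatIsoToRingEquiv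
    have h0 : IsDomain (Localization x'.asHomogeneousIdeal.toIdeal.primeCompl) :=
      IsLocalization.isDomain_localization
        (Ideal.primeCompl_le_nonZeroDivisors x'.asHomogeneousIdeal.toIdeal)
    have h : _root_.IsReduced (HomogeneousLocalization.AtPrime
        (MvPolynomial.homogeneousSubmodule (Fin 2) k) x'.asHomogeneousIdeal.toIdeal) :=
      isReduced_of_injective (algebraMap _ (Localization x'.asHomogeneousIdeal.toIdeal.primeCompl))
        (HomogeneousLocalization.val_injective _)
    exact isReduced_of_injective e.toRingHom e.injective
  exact isReduced_of_isReduced_stalk _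

theorem projectiveLine_irreducibleSpace : IrreducibleSpace (projectiveLineScheme k) := by
  let 𝒜 := MvPolynomial.homogeneousSubmodule (Fin 2) k
  let η : ProjectiveSpectrum 𝒜 :=
    { asHomogeneousIdeal := ⊥
      isPrime := by
        rw [HomogeneousIdeal.toIdeal_bot]
        exact Ideal.isPrime_bot
      not_irrelevant_le := fun h => by
        have h1 : (MvPolynomial.X 0 : MvPolynomial (Fin 2) k) ∈ HomogeneousIdeal.irrelevant 𝒜 := by
          rw [HomogeneousIdeal.mem_irrelevant_iff, GradedRing.proj_apply,
            DirectSum.decompose_of_mem_ne 𝒜 (i := 1) (MvPolynomial.isHomogeneous_X k 0)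
              one_ne_zero]
        have h2 := h h1
        exact MvPolynomial.X_ne_zero 0 h2 }
  have hη : closure {η} = Set.univ := by
    rw [← ProjectiveSpectrum.zeroLocus_vanishingIdeal_eq_closure]
    ext y
    simp only [Set.mem_univ, iff_true, ProjectiveSpectrum.mem_zeroLocus]
    intro a ha
    have : a = 0 := by
      have := (ProjectiveSpectrum.mem_vanishingIdeal _ _).mp ha η rfl
      exact this
    rw [this]
    exact zero_mem _
  have h1 : IsIrreducible (Set.univ : Set (ProjectiveSpectrum 𝒜)) :=
    hη ▸ isIrreducible_singleton.closure
  have h2 : IrreducibleSpace (ProjectiveSpectrum 𝒜) :=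
    (irreducibleSpace_def _).mpr h1
  exact h2

/-- The projective line `P¹` over `k`. -/
noncomputable def projectiveLine : Variety k :=
  have := projectiveLine_isProper k
  have := projectiveLine_isReduced k
  have := projectiveLine_irreducibleSpace k
  { scheme := projectiveLineScheme k
    toSpec := projectiveLineToSpec k
    isIntegral := isIntegral_of_irreducibleSpace_of_isReduced _
    isSeparated := inferInstance
    locallyOfFiniteType := inferInstance
    quasiCompact := inferInstance }

/-- The Cremona group of rank `1` over `k`. -/
abbrev Cremona₁ : Type u := (projectiveLine k).Bir

end ProjectiveLine

/-! Dominant rational maps `X ⤏ Y` over `k` correspond to `k`-embeddings of the function field of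
`Y` into that of `X` (`pullback_injective`, `pullback_surjective`). The function field of the
projective line is `k(t)`, so both statements become statements about `k(t)`, and the Cremona group
becomes `PGL(2, k)` (`pglEquivCremona`).

(i) A finite group of fractional linear transformations permutes some finite set `A` of `n ≥ 3`
points of the affine line. With `P = ∏ (t - a)` over `a ∈ A`, the map `t ↦ t - n P / P'` is `[x : y]
↦ [-F_y : F_x]` for the binary form `F` obtained by homogenizing `P`. This construction is covariant
under linear substitutions, so the map commutes with every transformation preserving `A`
(`moebiusHom_newton`). It is not fractional linear because `n ≥ 3` (`newton_mul_ne`), hence it is a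
nontrivial self-compression.

(ii) By Lüroth's theorem `X` is rational unless its function field is `k`. In that case `X` has
dimension at most zero and `Bir(X)` is trivial, which the hypotheses exclude. The composite with `β`
is a morphism because the projective line is proper and its local rings are valuation rings. A
compression identifies the two groups abstractly, so what remains is that isomorphic finite
subgroups of `PGL(2, k)` are conjugate (`exists_map_conj_eq`).

For the last fact, every nontrivial element of finite order has exactly two fixed points, and point
stabilizers in a finite subgroup are cyclic. Counting orbits (`finite_subgroup_classification`)
leaves cyclic groups, groups with an element of half their order, and groups of order 12, 24 or 60
with restricted element orders. The first two kinds have explicit normal forms.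

The other three are treated uniformly through the class function `tau`, trace squared over
determinant, which for small orders is governed by the order. A generating pair of a Klein
four-group `V` can be put in standard position. The values of `tau` on the coset `x V` then
determine `x` up to inversion and the conjugations fixing that pair, and they add up to 4
(`sum_tau_eq_four`). Element orders and this sum produce in each group a coset with prescribed
values, and the Klein pair together with `x` generates the group. -/

open scoped MatrixGroups

/-! ### Rational maps at the generic point -/

namespace AlgebraicGeometry.Scheme

theorem exists_specMap_comp_fromSpecStalk {X : Scheme.{u}} {R : CommRingCat.{u}} [IsLocalRing R]
    (φ : Spec R ⟶ X) {x : X} (h : φ (IsLocalRing.closedPoint R) = x) :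
    ∃ a : X.presheaf.stalk x ⟶ R, Spec.map a ≫ X.fromSpecStalk x = φ := by
  subst h
  exact ⟨stalkClosedPointTo φ, Spec_stalkClosedPointTo_fromSpecStalk φ⟩

theorem Hom.apply_genericPoint_of_isDominant {X Y : Scheme.{u}} [IrreducibleSpace X]
    [IrreducibleSpace Y] (f : X ⟶ Y) [IsDominant f] : f (genericPoint X) = genericPoint Y := by
  apply ((genericPoint_spec Y).eq _).symm
  have := (genericPoint_spec X).image f.continuous
  rwa [Set.image_univ, f.denseRange.closure_range] at this

/-- Dominance carries generic point to generic point. Hence the map out of the spectrum of the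
function field factors through the stalk at the generic point of the target, which is where pullback
of rational functions comes from. -/
theorem PartialMap.fromFunctionField_closedPoint {X Y : Scheme.{u}} [IsIntegral X] [IsIntegral Y]
    (f : X.PartialMap Y) [IsDominant f.hom] :
    f.fromFunctionField (IsLocalRing.closedPoint X.functionField) = genericPoint Y := by
  have hη : genericPoint X ∈ f.domain :=
    (genericPoint_specializes _).mem_open f.domain.2 f.dense_domain.nonempty.choose_spec
  have : Nonempty f.domain := ⟨⟨_, hη⟩⟩
  have h1 : f.domain.fromSpecStalkOfMem _ hη (IsLocalRing.closedPoint X.functionField) =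
      genericPoint f.domain.toScheme := by
    apply f.domain.ι.isOpenEmbedding.injective
    rw [genericPoint_eq_of_isOpenImmersion f.domain.ι]
    refine (Scheme.Hom.comp_apply _ _ _).symm.trans ?_
    rw [Opens.fromSpecStalkOfMem_ι]
    exact fromSpecStalk_closedPoint
  exact (Scheme.Hom.comp_apply _ _ _).trans
    ((congrArg f.hom h1).trans (Hom.apply_genericPoint_of_isDominant f.hom))

theorem RationalMap.fromFunctionField_closedPoint {X Y : Scheme.{u}} [IsIntegral X] [IsIntegral Y]
    (f : X ⤏ Y) [f.IsDominant] :
    f.fromFunctionField (IsLocalRing.closedPoint X.functionField) = genericPoint Y := by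
  rw [← f.toRationalMap_representative]
  exact PartialMap.fromFunctionField_closedPoint _

theorem RationalMap.isDominant_of_fromFunctionField_closedPoint {X Y : Scheme.{u}} [IsIntegral X]
    [IsIntegral Y] (f : X ⤏ Y)
    (h : f.fromFunctionField (IsLocalRing.closedPoint X.functionField) = genericPoint Y) :
    f.IsDominant := by
  obtain ⟨g, rfl⟩ := f.exists_rep
  rw [PartialMap.isDominant_toRationalMap_iff]
  refine ⟨?_⟩
  have h1 : genericPoint Y ∈ Set.range g.hom := by
    rw [← h]
    exact ⟨_, (Scheme.Hom.comp_apply _ _ _).symm⟩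
  rw [DenseRange, dense_iff_closure_eq, ← Set.univ_subset_iff, ← (genericPoint_spec Y).def]
  exact closure_mono (Set.singleton_subset_iff.mpr h1)

/-- Functoriality of pullback, seen at the generic point: the factorization `a` of `f` already lands
in the domain of `g`, so it can be compared with the restriction of `f` before applying `g`. -/
theorem PartialMap.fromFunctionField_comp {X Y Z : Scheme.{u}} [IsIntegral X] [IsIntegral Y]
    (f : X.PartialMap Y) [IsDominant f.hom] (g : Y.PartialMap Z)
    (a : Y.functionField ⟶ X.functionField)
    (ha : Spec.map a ≫ Y.fromSpecStalk _ = f.fromFunctionField) :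
    (f.comp g).fromFunctionField = Spec.map a ≫ g.fromFunctionField := by
  have hη : genericPoint Y ∈ g.domain :=
    (genericPoint_specializes _).mem_open g.domain.2 g.dense_domain.nonempty.choose_spec
  have hη' : genericPoint X ∈ f.domain.ι ''ᵁ f.hom ⁻¹ᵁ g.domain :=
    (genericPoint_specializes _).mem_open (f.comp g).domain.2
      (f.comp g).dense_domain.nonempty.choose_spec
  have H : (f.domain.ι ''ᵁ f.hom ⁻¹ᵁ g.domain).fromSpecStalkOfMem _ hη' ≫
      (f.domain.ι.isoImage _).inv ≫ f.hom ∣_ g.domain =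
        Spec.map a ≫ g.domain.fromSpecStalkOfMem _ hη := by
    rw [← cancel_mono g.domain.ι]
    simp only [Category.assoc, morphismRestrict_ι, Opens.fromSpecStalkOfMem_ι, ha]
    rw [fromFunctionField, fromSpecStalkOfMem, ← Category.assoc, ← Category.assoc]
    congr 1
    rw [← cancel_mono f.domain.ι]
    simp
  have H' := congr($H ≫ g.hom)
  simp only [Category.assoc] at H'
  exact H'

theorem RationalMap.fromFunctionField_comp {X Y Z : Scheme.{u}} [IsIntegral X] [IsIntegral Y]
    (f : X ⤏ Y) [f.IsDominant] (g : Y ⤏ Z) (a : Y.functionField ⟶ X.functionField)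
    (ha : Spec.map a ≫ Y.fromSpecStalk _ = f.fromFunctionField) :
    (f.comp g).fromFunctionField = Spec.map a ≫ g.fromFunctionField := by
  rw [← g.toRationalMap_representative, comp_def]
  exact PartialMap.fromFunctionField_comp _ _ a (by
    rw [ha, ← RationalMap.fromFunctionField_toRationalMap, f.toRationalMap_representative])

end AlgebraicGeometry.Scheme

/-! ### Dominant rational maps as embeddings of function fields -/

namespace Variety

variable {k : Type u} [Field k]

/-- The function field of a variety. -/
def K (X : Variety k) : Type u := X.scheme.functionField

noncomputable instance (X : Variety k) : Field X.K :=
  inferInstanceAs (Field X.scheme.functionField)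

/-- The structure morphism of the generic point. -/
noncomputable def baseHom (X : Variety k) : CommRingCat.of k ⟶ X.scheme.functionField :=
  Spec.preimage (X.scheme.fromSpecStalk _ ≫ X.toSpec)

theorem specMap_baseHom (X : Variety k) :
    Spec.map X.baseHom = X.scheme.fromSpecStalk _ ≫ X.toSpec :=
  Spec.map_preimage _

noncomputable instance (X : Variety k) : Algebra k X.K :=
  RingHom.toAlgebra (R := k) (S := X.K) X.baseHom.hom

/-- A map of function fields over `k` as a morphism of rings. -/
noncomputable def toRingCat {X Y : Variety k} (a : Y.K →ₐ[k] X.K) :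
    Y.scheme.functionField ⟶ X.scheme.functionField :=
  CommRingCat.ofHom (R := Y.scheme.functionField) (S := X.scheme.functionField) a.toRingHom

theorem toRingCat_injective {X Y : Variety k} {a b : Y.K →ₐ[k] X.K}
    (h : toRingCat a = toRingCat b) : a = b := by
  ext x
  exact congr($(h).hom x)

theorem baseHom_toRingCat {X Y : Variety k} (a : Y.K →ₐ[k] X.K) :
    Y.baseHom ≫ toRingCat a = X.baseHom := by
  ext x
  exact a.commutes x

theorem exists_pullback {X Y : Variety k} (f : X ⟶ Y) :
    ∃ a : Y.K →ₐ[k] X.K,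
      Spec.map (toRingCat a) ≫ Y.scheme.fromSpecStalk _ = f.map.fromFunctionField := by
  obtain ⟨a, ha⟩ := exists_specMap_comp_fromSpecStalk f.map.fromFunctionField
    f.map.fromFunctionField_closedPoint
  have h : Y.baseHom ≫ a = X.baseHom := by
    apply Spec.map_injective
    rw [Spec.map_comp, specMap_baseHom, reassoc_of% ha, specMap_baseHom]
    exact (RationalMap.equivFunctionField X.toSpec Y.toSpec).symm
      ⟨f.map, RationalMap.isOver_iff.mp f.isOver⟩ |>.2
  exact ⟨{ a.hom with commutes' := fun r => congr($(h).hom r) }, ha⟩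

/-- The map of function fields induced by a dominant rational map. -/
noncomputable def pullback {X Y : Variety k} (f : X ⟶ Y) : Y.K →ₐ[k] X.K :=
  (exists_pullback f).choose

theorem pullback_spec {X Y : Variety k} (f : X ⟶ Y) :
    Spec.map (toRingCat (pullback f)) ≫ Y.scheme.fromSpecStalk _ = f.map.fromFunctionField :=
  (exists_pullback f).choose_spec

theorem pullback_eq {X Y : Variety k} (f : X ⟶ Y) (a : Y.K →ₐ[k] X.K)
    (h : Spec.map (toRingCat a) ≫ Y.scheme.fromSpecStalk _ = f.map.fromFunctionField) :
    pullback f = a := by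
  apply toRingCat_injective
  apply Spec.map_injective
  rw [← cancel_mono (Y.scheme.fromSpecStalk _), h, pullback_spec]

theorem pullback_id (X : Variety k) : pullback (𝟙 X) = AlgHom.id k X.K := by
  apply pullback_eq
  have h : toRingCat (AlgHom.id k X.K) = 𝟙 X.scheme.functionField := rfl
  have h2 : (𝟙 X : X ⟶ X).map = RationalMap.id X.scheme := rfl
  rw [h, h2, RationalMap.fromFunctionField_toRationalMap, PartialMap.fromFunctionField,
    PartialMap.fromSpecStalkOfMem_toPartialMap]
  simp

theorem pullback_comp {X Y Z : Variety k} (f : X ⟶ Y) (g : Y ⟶ Z) :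
    pullback (f ≫ g) = (pullback f).comp (pullback g) := by
  apply pullback_eq
  have h : toRingCat ((pullback f).comp (pullback g)) =
    toRingCat (pullback g) ≫ toRingCat (pullback f) := rfl
  have h2 : (f ≫ g).map = f.map.comp g.map := rfl
  rw [h, h2, Spec.map_comp, Category.assoc, pullback_spec,
    RationalMap.fromFunctionField_comp _ _ _ (pullback_spec f)]

theorem pullback_injective {X Y : Variety k} :
    Function.Injective (pullback : (X ⟶ Y) → (Y.K →ₐ[k] X.K)) := by
  intro f g h
  apply DominantRationalMap.ext
  apply RationalMap.eq_of_fromFunctionField_eq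
  rw [← pullback_spec f, h, pullback_spec]

/-- A map from the generic point to a variety spreads out to a rational map, since the target is
locally of finite type over `k`. -/
theorem pullback_surjective {X Y : Variety k} :
    Function.Surjective (pullback : (X ⟶ Y) → (Y.K →ₐ[k] X.K)) := by
  intro a
  let φ : Spec X.scheme.functionField ⟶ Y.scheme :=
    Spec.map (toRingCat a) ≫ Y.scheme.fromSpecStalk _
  have hφ : φ ≫ Y.toSpec = X.scheme.fromSpecStalk _ ≫ X.toSpec := by
    rw [Category.assoc, ← specMap_baseHom, ← Spec.map_comp, baseHom_toRingCat, specMap_baseHom]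
  let r := RationalMap.equivFunctionField X.toSpec Y.toSpec ⟨φ, hφ⟩
  have hr : r.1.fromFunctionField = φ := RationalMap.fromFunctionField_ofFunctionField _ _ _ _
  let f : X ⟶ Y :=
    { map := r.1
      isDominant := by
        apply RationalMap.isDominant_of_fromFunctionField_closedPoint
        -- A homomorphism of fields is local, so the closed point goes to the closed point, that is,
        -- to the generic point of `Y`; this is dominance.
        have hloc : IsLocalHom (toRingCat a).hom :=
          ⟨fun x hx => (isUnit_iff_ne_zero (G₀ := Y.K)).mpr fun h0 =>
            hx.ne_zero (congrArg (toRingCat a).hom h0 |>.trans (map_zero _))⟩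
        rw [hr]
        exact (Scheme.Hom.comp_apply _ _ _).trans ((congrArg _ Spec_closedPoint).trans
          fromSpecStalk_closedPoint)
      isOver := RationalMap.isOver_iff.mpr r.2 }
  exact ⟨f, pullback_eq f a hr.symm⟩

end Variety

/-! ### The two affine charts of the projective line -/

section Dehomogenize

attribute [local instance] MvPolynomial.gradedAlgebra

variable (k : Type u) [Field k] (i : Fin 2)

/-- The dehomogenization `k[x₀, x₁] → k[t]` with `xᵢ ↦ 1` and `xⱼ ↦ t` for `j ≠ i`. -/
noncomputable def dehomogenize : MvPolynomial (Fin 2) k →ₐ[k] Polynomial k :=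
  MvPolynomial.aeval fun l => if l = i then 1 else Polynomial.X

/-- Among monomials of a fixed degree the exponent of one variable determines the other, so no two
terms of a form are merged when `xᵢ` is set to `1`. -/
theorem dehomogenize_injOn {n : ℕ} {p : MvPolynomial (Fin 2) k} (hp : p.IsHomogeneous n)
    (h : dehomogenize k i p = 0) : p = 0 := by
  have hj : ∀ d : Fin 2 →₀ ℕ, d.degree = d i + d (1 - i) := by
    intro d
    rw [Finsupp.degree_eq_sum, Fin.sum_univ_two]
    fin_cases i
    · rfl
    · exact add_comm _ _
  have hmon : ∀ d : Fin 2 →₀ ℕ, (∏ l, (if l = i then 1 else Polynomial.X : Polynomial k) ^ d l) =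
      Polynomial.X ^ d (1 - i) := by
    intro d
    rw [Fin.prod_univ_two]
    fin_cases i <;> simp
  ext d
  by_contra hd
  have hd' : d.degree = n := by
    rw [MvPolynomial.coeff_zero] at hd
    have := hp hd
    rw [Finsupp.degree_eq_weight_one]
    exact this
  apply hd
  have h1 := congrArg (fun q => Polynomial.coeff q (d (1 - i))) h
  simp only [dehomogenize, MvPolynomial.aeval_def,
    MvPolynomial.eval₂_eq', hmon, Polynomial.finsetSum_coeff, Polynomial.algebraMap_eq,
    Polynomial.coeff_C_mul, Polynomial.coeff_X_pow, Polynomial.coeff_zero] at h1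
  rw [Finset.sum_eq_single d] at h1
  · simpa using h1
  · intro d' hd1 hne
    have hd2 : d'.degree = n := by
      have := hp (MvPolynomial.mem_support_iff.mp hd1)
      rw [Finsupp.degree_eq_weight_one]
      exact this
    rw [if_neg, mul_zero]
    intro heq
    apply hne
    have h3 : d' i = d i := by
      have := hj d; have := hj d'; omega
    ext l
    fin_cases i <;> fin_cases l <;> simp_all
  · intro hd1
    rw [MvPolynomial.notMem_support_iff.mp hd1, zero_mul]

theorem X_mem_homogeneousSubmodule :
    (MvPolynomial.X i : MvPolynomial (Fin 2) k) ∈ MvPolynomial.homogeneousSubmodule (Fin 2) k 1 :=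
  MvPolynomial.isHomogeneous_X k i

/-- The isomorphism of the coordinate ring of a standard chart of the projective line with `k[t]`,
as a map. -/
noncomputable def chartRingHom :
    HomogeneousLocalization.Away (MvPolynomial.homogeneousSubmodule (Fin 2) k)
      (MvPolynomial.X i : MvPolynomial (Fin 2) k) →+* Polynomial k :=
  (Localization.awayLift (dehomogenize k i).toRingHom (MvPolynomial.X i)
    (by simp [dehomogenize])).comp (algebraMap _ _)

theorem chartRingHom_mk (n : ℕ) (p : MvPolynomial (Fin 2) k) (hp) :
    chartRingHom k i (HomogeneousLocalization.Away.mk (MvPolynomial.homogeneousSubmodule (Fin 2) k)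
      (X_mem_homogeneousSubmodule k i) n p hp) = dehomogenize k i p := by
  rw [chartRingHom, RingHom.comp_apply, HomogeneousLocalization.algebraMap_apply,
    HomogeneousLocalization.Away.val_mk, Localization.awayLift_mk (v := 1)]
  · simp
  · simp [dehomogenize]

theorem chartRingHom_bijective : Function.Bijective (chartRingHom k i) := by
  constructor
  · rw [injective_iff_map_eq_zero]
    intro x hx
    obtain ⟨n, p, hp, rfl⟩ := HomogeneousLocalization.Away.mk_surjective
      (MvPolynomial.homogeneousSubmodule (Fin 2) k) (X_mem_homogeneousSubmodule k i) x
    rw [chartRingHom_mk] at hx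
    have := dehomogenize_injOn k i hp hx
    subst this
    ext
    rw [HomogeneousLocalization.Away.val_mk, Localization.mk_zero,
      HomogeneousLocalization.val_zero]
  · rw [← RingHom.range_eq_top, eq_top_iff]
    have hC : ∀ c, Polynomial.C c ∈ (chartRingHom k i).range := fun c =>
      ⟨.mk _ (X_mem_homogeneousSubmodule k i) 0 (MvPolynomial.C c)
        (by simp), by
        rw [chartRingHom_mk]; simp [dehomogenize]⟩
    have hX : Polynomial.X ∈ (chartRingHom k i).range :=
      ⟨.mk _ (X_mem_homogeneousSubmodule k i) 1 (MvPolynomial.X (1 - i))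
        (by simpa using MvPolynomial.isHomogeneous_X k (1 - i)), by
        rw [chartRingHom_mk]
        fin_cases i <;> simp [dehomogenize]⟩
    intro p _
    induction p using Polynomial.induction_on' with
    | add p q hp hq => exact add_mem (hp trivial) (hq trivial)
    | monomial n a =>
      rw [← Polynomial.C_mul_X_pow_eq_monomial]
      exact mul_mem (hC a) (pow_mem hX n)

theorem chartRingHom_algebraMap (c : k) :
    chartRingHom k i (HomogeneousLocalization.fromZeroRingHom _ _
      (algebraMap k (MvPolynomial.homogeneousSubmodule (Fin 2) k 0) c)) = Polynomial.C c := by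
  rw [chartRingHom, RingHom.comp_apply, HomogeneousLocalization.algebraMap_apply]
  change Localization.awayLift _ _ _ (Localization.mk (MvPolynomial.C c) 1) = _
  rw [Localization.mk_one_eq_algebraMap, Localization.awayLift, IsLocalization.Away.lift_eq]
  simp [dehomogenize]

/-- The standard open charts of the projective line. -/
noncomputable def projectiveLineChart : Spec (.of (Polynomial k)) ⟶ (projectiveLine k).scheme :=
  Spec.map (CommRingCat.ofHom (chartRingHom k i)) ≫
    Proj.awayι (MvPolynomial.homogeneousSubmodule (Fin 2) k) (MvPolynomial.X i)
      (X_mem_homogeneousSubmodule k i) one_pos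

instance isIso_chartRingHom : IsIso (CommRingCat.ofHom (chartRingHom k i)) :=
  (ConcreteCategory.isIso_iff_bijective _).mpr (chartRingHom_bijective k i)

instance : IsOpenImmersion (projectiveLineChart k i) := by
  have h : IsOpenImmersion (Spec.map (CommRingCat.ofHom (chartRingHom k i)) ≫
      Proj.awayι (MvPolynomial.homogeneousSubmodule (Fin 2) k) (MvPolynomial.X i)
        (X_mem_homogeneousSubmodule k i) one_pos) := inferInstance
  exact h

theorem projectiveLineChart_toSpec : projectiveLineChart k i ≫ (projectiveLine k).toSpec =
    Spec.map (CommRingCat.ofHom (algebraMap k (Polynomial k))) := by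
  change (Spec.map _ ≫ Proj.awayι _ _ _ _) ≫ Proj.toSpecZero _ ≫ Spec.map _ = _
  rw [Category.assoc, Proj.awayι_toSpecZero_assoc, ← Spec.map_comp, ← Spec.map_comp]
  congr 1
  apply CommRingCat.hom_ext
  apply RingHom.ext
  intro c
  exact chartRingHom_algebraMap k i c

theorem exists_projectiveLineChart_eq (x : (projectiveLine k).scheme) :
    ∃ i, ∃ y, projectiveLineChart k i y = x := by
  have h := Proj.iSup_basicOpen_eq_top' (MvPolynomial.homogeneousSubmodule (Fin 2) k)
    (fun i : Fin 2 => (MvPolynomial.X i : MvPolynomial (Fin 2) k))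
    (fun i => ⟨1, X_mem_homogeneousSubmodule k i⟩) (by
      rw [eq_top_iff]
      intro p _
      have : IsScalarTower k (MvPolynomial.homogeneousSubmodule (Fin 2) k 0)
        (MvPolynomial (Fin 2) k) := ⟨fun a b c => smul_mul_assoc a (b : MvPolynomial (Fin 2) k) c⟩
      induction p using MvPolynomial.induction_on with
      | C a =>
        let a' : MvPolynomial.homogeneousSubmodule (Fin 2) k 0 := algebraMap k _ a
        exact Subalgebra.algebraMap_mem _ a'
      | add p q hp hq => exact add_mem (hp trivial) (hq trivial)
      | mul_X p i hp => exact mul_mem (hp trivial) (Algebra.subset_adjoin ⟨i, rfl⟩))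
  let x' : Proj (MvPolynomial.homogeneousSubmodule (Fin 2) k) := x
  have hx : x' ∈ (⊤ : (Proj (MvPolynomial.homogeneousSubmodule (Fin 2) k)).Opens) := trivial
  rw [← h, TopologicalSpace.Opens.mem_iSup] at hx
  obtain ⟨i, hi⟩ := hx
  rw [← Proj.opensRange_awayι _ _ (X_mem_homogeneousSubmodule k i) one_pos] at hi
  obtain ⟨z, hz⟩ := hi
  obtain ⟨y, hy⟩ := (Spec.map (CommRingCat.ofHom (chartRingHom k i))).surjective z
  exact ⟨i, y, (Scheme.Hom.comp_apply _ _ _).trans ((congrArg _ hy).trans hz)⟩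

end Dehomogenize

/-! ### Function field and local rings of the projective line -/

namespace AlgebraicGeometry.Scheme

theorem Hom.exists_stalk_iso {X Y : Scheme.{u}} (f : X ⟶ Y) [IsOpenImmersion f] (x : X) {y : Y}
    (h : f x = y) : ∃ a : Y.presheaf.stalk y ⟶ X.presheaf.stalk x, IsIso a ∧
      Spec.map a ≫ Y.fromSpecStalk y = X.fromSpecStalk x ≫ f := by
  subst h
  exact ⟨f.stalkMap x, inferInstance, SpecMap_stalkMap_fromSpecStalk f⟩

end AlgebraicGeometry.Scheme

namespace Variety

variable {k : Type u} [Field k]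

/-- An open immersion is an isomorphism on generic stalks, and the generic stalk of an affine
integral scheme is a fraction field. The field `L` is left free so that `RatFunc k` and
`FractionRing R` both serve. -/
theorem nonempty_algEquiv_of_isOpenImmersion (X : Variety k) {R : CommRingCat.{u}} [IsDomain R]
    [Algebra k R] (j : Spec R ⟶ X.scheme) [IsOpenImmersion j]
    (hj : j ≫ X.toSpec = Spec.map (CommRingCat.ofHom (algebraMap k R))) (L : Type*) [Field L]
    [Algebra R L] [IsFractionRing R L] [Algebra k L] [IsScalarTower k R L] :
    Nonempty (X.K ≃ₐ[k] L) := by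
  obtain ⟨a, ha, h⟩ := Hom.exists_stalk_iso j (genericPoint (Spec R))
    (genericPoint_eq_of_isOpenImmersion j)
  let F : Type u := (Spec R).functionField
  let _ : Field F := inferInstanceAs (Field (Spec R).functionField)
  let _ : Algebra R F :=
    inferInstanceAs (Algebra R (Spec R).functionField)
  have hfr : IsFractionRing R F := functionField_isFractionRing_of_affine R
  let _ : Algebra k F := ((algebraMap R F).comp (algebraMap k R)).toAlgebra
  have : IsScalarTower k R F := .of_algebraMap_eq fun _ => rfl
  have hk : X.baseHom ≫ a = CommRingCat.ofHom (algebraMap k R) ≫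
      CommRingCat.ofHom (algebraMap R F) := by
    apply Spec.map_injective
    rw [Spec.map_comp, Spec.map_comp, specMap_baseHom, reassoc_of% h, hj]
    congr 1
    exact Spec.fromSpecStalk_eq' _ _
  let e1 : X.K ≃ₐ[k] F := AlgEquiv.ofRingEquiv (f := (asIso a).commRingCatIsoToRingEquiv)
    fun r => congr($(hk).hom r)
  exact ⟨e1.trans ((IsLocalization.algEquiv (nonZeroDivisors R) F L).restrictScalars k)⟩

end Variety

theorem nonempty_algEquiv_ratFunc (k : Type u) [Field k] :
    Nonempty ((projectiveLine k).K ≃ₐ[k] RatFunc k) :=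
  (projectiveLine k).nonempty_algEquiv_of_isOpenImmersion (R := .of (Polynomial k)) (projectiveLineChart k 0)
    (projectiveLineChart_toSpec k 0) _

theorem IsLocalization.isPrincipalIdealRing {R : Type*} (S : Type*) [CommRing R] [CommRing S]
    [Algebra R S] (M : Submonoid R) [IsLocalization M S] [IsPrincipalIdealRing R] :
    IsPrincipalIdealRing S where
  principal J := by
    obtain ⟨a, ha⟩ := IsPrincipalIdealRing.principal (J.under R)
    rw [← IsLocalization.map_under M S J, ha]
    exact ⟨algebraMap R S a, by rw [Ideal.submodule_span_eq, Ideal.map_span, Set.image_singleton]⟩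

theorem IsLocalization.AtPrime.valuationRing {R : Type*} (S : Type*) [CommRing R] [IsDomain R]
    [CommRing S] [IsDomain S] [Algebra R S] (p : Ideal R) [p.IsPrime] [IsLocalization.AtPrime S p]
    [IsPrincipalIdealRing R] : ValuationRing S := by
  have : IsPrincipalIdealRing S := IsLocalization.isPrincipalIdealRing S p.primeCompl
  have : IsLocalRing S := IsLocalization.AtPrime.isLocalRing S p
  infer_instance

/-- In a chart the stalk is a localization of `k[t]` at a prime, hence a local principal ideal
domain. -/
theorem valuationRing_stalk_projectiveLine (k : Type u) [Field k]
    (x : (projectiveLine k).scheme) :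
    ValuationRing ((projectiveLine k).scheme.presheaf.stalk x) := by
  obtain ⟨i, y, rfl⟩ := exists_projectiveLineChart_eq k x
  obtain ⟨a, ha, -⟩ := Hom.exists_stalk_iso (projectiveLineChart k i) y rfl
  let R : CommRingCat.{u} := .of (Polynomial k)
  have h0 : IsDomain R := inferInstanceAs (IsDomain (Polynomial k))
  have h1 : IsPrincipalIdealRing R := inferInstanceAs (IsPrincipalIdealRing (Polynomial k))
  let y' : PrimeSpectrum R := y
  have h2 : IsDomain ((Spec.structureSheaf R).presheaf.stalk y') :=
    inferInstanceAs (IsDomain ((Spec R).presheaf.stalk y))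
  have h3 : ValuationRing ((Spec R).presheaf.stalk y) :=
    IsLocalization.AtPrime.valuationRing (R := R)
      ((Spec.structureSheaf R).presheaf.stalk y') y'.asIdeal
  exact Function.Surjective.valuationRing (asIso a).commRingCatIsoToRingEquiv.symm.toRingHom
    (asIso a).commRingCatIsoToRingEquiv.symm.surjective

/-! ### Rational maps that extend to morphisms -/

namespace AlgebraicGeometry.Scheme

theorem PartialMap.fromFunctionField_eq {X Y : Scheme.{u}} [IsIntegral X] (g : X.PartialMap Y)
    {x : X} (hx : x ∈ g.domain) :
    g.fromFunctionField = Spec.map (X.presheaf.stalkSpecializes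
      ((genericPoint_spec X).specializes trivial)) ≫ g.fromSpecStalkOfMem hx := by
  rw [fromFunctionField, fromSpecStalkOfMem, fromSpecStalkOfMem, ← Category.assoc]
  congr 1
  rw [← cancel_mono g.domain.ι]
  simp

/-- A rational map from an integral scheme whose local rings are valuation rings to a proper scheme
is defined everywhere. -/
theorem RationalMap.domain_eq_top {X Y S : Scheme.{u}} [IsIntegral X] [X.Over S] [Y.Over S]
    [IsProper (Y ↘ S)] [∀ x : X, ValuationRing (X.presheaf.stalk x)] (f : X ⤏ Y) [f.IsOver S] :
    f.domain = ⊤ := by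
  ext x
  simp only [SetLike.mem_coe, TopologicalSpace.Opens.mem_top, iff_true]
  rw [RationalMap.mem_domain]
  have hf : f.fromFunctionField ≫ (Y ↘ S) = X.fromSpecStalk _ ≫ (X ↘ S) :=
    ((RationalMap.equivFunctionField (X ↘ S) (Y ↘ S)).symm
      ⟨f, RationalMap.isOver_iff.mp ‹_›⟩).2
  have hη : genericPoint X ⤳ x := (genericPoint_spec X).specializes trivial
  -- The valuative criterion is applied to the local ring at `x`, whose fraction field is the
  -- function field of `X`; the map to be extended is `f` at the generic point.
  let sq : ValuativeCommSq (Y ↘ S) :=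
    { R := X.presheaf.stalk x
      commRing := inferInstance
      domain := inferInstanceAs (IsDomain (X.presheaf.stalk x))
      valuationRing := inferInstanceAs (ValuationRing (X.presheaf.stalk x))
      K := X.functionField
      field := inferInstanceAs (Field X.functionField)
      algebra := stalkFunctionFieldAlgebra X x
      isFractionRing := inferInstanceAs (IsFractionRing (X.presheaf.stalk x) X.functionField)
      i₁ := f.fromFunctionField
      i₂ := X.fromSpecStalk x ≫ (X ↘ S)
      commSq := ⟨by
        rw [hf]
        change _ = Spec.map (X.presheaf.stalkSpecializes hη) ≫ _
        rw [SpecMap_stalkSpecializes_fromSpecStalk_assoc]⟩ }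
  have hp := ‹IsProper (Y ↘ S)›
  rw [IsProper.eq_valuativeCriterion] at hp
  obtain ⟨⟨l, hl1, hl2⟩⟩ := hp.1.1.1.existence sq
  -- The lift on the spectrum of the local ring spreads out to a neighbourhood of `x`, and the
  -- result represents `f` because both agree at the generic point.
  refine ⟨PartialMap.ofFromSpecStalk (X ↘ S) (Y ↘ S) (x := x) l hl2,
    PartialMap.mem_domain_ofFromSpecStalk _ _ _ _, ?_⟩
  apply RationalMap.eq_of_fromFunctionField_eq
  rw [fromFunctionField_toRationalMap, PartialMap.fromFunctionField_eq _
    (PartialMap.mem_domain_ofFromSpecStalk _ _ _ _), PartialMap.fromSpecStalkOfMem_ofFromSpecStalk]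
  exact hl1

theorem PartialMap.exists_hom_of_domain_eq_top {X Y : Scheme.{u}} (g : X.PartialMap Y)
    (h : g.domain = ⊤) : ∃ f : X ⟶ Y, g = f.toPartialMap := by
  obtain ⟨U, hU, g⟩ := g
  obtain rfl : U = ⊤ := h
  exact ⟨X.topIso.inv ≫ g, PartialMap.ext _ _ rfl (by
    simp only [Hom.toPartialMap_hom, Iso.hom_inv_id_assoc]
    exact (Category.id_comp _).symm.trans (congrArg (fun i => i ≫ g)
      (congrArg Iso.hom (Scheme.isoOfEq_rfl X ⊤)).symm))⟩

end AlgebraicGeometry.Scheme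

/-- A dominant rational self-map of the projective line is a morphism. -/
theorem exists_hom_toRationalMap_eq (k : Type u) [Field k]
    (φ : projectiveLine k ⟶ projectiveLine k) :
    ∃ f : (projectiveLine k).scheme ⟶ (projectiveLine k).scheme,
      f.IsOver (Spec (.of k)) ∧ f.toRationalMap = φ.map := by
  have hproper : IsProper ((projectiveLine k).scheme ↘ Spec (.of k)) :=
    projectiveLine_isProper k
  have := valuationRing_stalk_projectiveLine k
  have hsep : (projectiveLine k).scheme.IsSeparated := by
    constructor
    rw [← CategoryTheory.Limits.terminal.comp_from (projectiveLine k).toSpec]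
    infer_instance
  obtain ⟨f, hf⟩ := PartialMap.exists_hom_of_domain_eq_top φ.map.toPartialMap
    (RationalMap.domain_eq_top (S := Spec (.of k)) φ.map)
  have h1 : f.toRationalMap = φ.map := by
    rw [Hom.toRationalMap, ← hf, RationalMap.toRationalMap_toPartialMap]
  refine ⟨f, ?_, h1⟩
  have h2 : f.toPartialMap.IsOver (Spec (.of k)) := by
    rw [← PartialMap.isOver_toRationalMap_iff_of_isSeparated]
    rw [show f.toPartialMap.toRationalMap = φ.map from h1]
    exact φ.isOver
  rw [PartialMap.isOver_iff] at h2
  constructor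
  rw [← cancel_epi (projectiveLine k).scheme.topIso.hom]
  exact (Category.assoc _ _ _).symm.trans h2

/-! ### Varieties whose function field is the ground field -/

namespace Variety

variable {k : Type u} [Field k]

/-- A variety whose function field is the ground field is a point. -/
theorem dim_le_zero_of_surjective (X : Variety k) (h : Function.Surjective (algebraMap k X.K)) :
    X.dim ≤ 0 := by
  have key : ∀ x : X.scheme, x = genericPoint X.scheme := by
    intro x
    obtain ⟨U, hU, hxU, -⟩ := exists_isAffineOpen_mem_and_subset (x := x) (U := ⊤) trivial
    have hne : Nonempty U := ⟨⟨x, hxU⟩⟩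
    let R : CommRingCat.{u} := Γ(X.scheme, U)
    let s : CommRingCat.of k ⟶ R := Spec.preimage (hU.fromSpec ≫ X.toSpec)
    let _ : Algebra k R := s.hom.toAlgebra
    have hs : hU.fromSpec ≫ X.toSpec = Spec.map (CommRingCat.ofHom (algebraMap k R)) :=
      (Spec.map_preimage _).symm
    obtain ⟨e⟩ := X.nonempty_algEquiv_of_isOpenImmersion hU.fromSpec hs (FractionRing R)
    -- The coordinate ring lies between `k` and its fraction field, which here is `k` itself; so
    -- every affine chart is a single point.
    have hsurj : Function.Surjective (algebraMap k R) := by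
      intro r
      obtain ⟨c, hc⟩ := h (e.symm (algebraMap R _ r))
      refine ⟨c, IsFractionRing.injective R (FractionRing R) ?_⟩
      rw [← IsScalarTower.algebraMap_apply, ← e.commutes, hc, e.apply_symm_apply]
    have hfield : IsField R :=
      (RingEquiv.ofBijective _ ⟨(algebraMap k R).injective, hsurj⟩).symm.toMulEquiv.isField
        (Field.toIsField k)
    have hsub : Subsingleton (PrimeSpectrum R) := by
      let _ := hfield.toField
      infer_instance
    have h1 : ∀ y ∈ U, ∃ z, hU.fromSpec z = y := by
      intro y hy
      rw [← SetLike.mem_coe, ← hU.range_fromSpec] at hy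
      exact hy
    obtain ⟨z, rfl⟩ := h1 x hxU
    obtain ⟨w, hw⟩ := h1 (genericPoint X.scheme)
      (((genericPoint_spec X.scheme).mem_open_set_iff U.isOpen).mpr ⟨_, trivial, hxU⟩)
    rw [← hw]
    exact congrArg hU.fromSpec (Subsingleton.elim (α := PrimeSpectrum R) z w)
  have : Subsingleton X.scheme := ⟨fun x y => (key x).trans (key y).symm⟩
  exact topologicalKrullDim_zero_of_discreteTopology X.scheme

end Variety

/-! ### Fractional linear substitutions in the field of rational functions -/

namespace RatFunc

variable {k : Type u} [Field k]

theorem algHom_C {L : Type*} [Field L] [Algebra k L] (γ : RatFunc k →ₐ[k] L) (a : k) :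
    γ (C a) = algebraMap k L a := by
  rw [← algebraMap_eq_C]; exact γ.commutes a

theorem algHom_ext_X {L : Type*} [Field L] [Algebra k L] {γ δ : RatFunc k →ₐ[k] L}
    (h : γ X = δ X) : γ = δ := by
  have hp (p : Polynomial k) : γ (algebraMap _ _ p) = δ (algebraMap _ _ p) := by
    have : γ.comp (IsScalarTower.toAlgHom k (Polynomial k) (RatFunc k)) =
        δ.comp (IsScalarTower.toAlgHom k (Polynomial k) (RatFunc k)) :=
      Polynomial.algHom_ext (by simpa using h)
    exact DFunLike.congr_fun this p
  ext f
  rw [← num_div_denom f, map_div₀, map_div₀, hp, hp]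

theorem exists_algHom_X_eq {f : RatFunc k} (hf : ¬ ∃ c, f = C c) :
    ∃ γ : RatFunc k →ₐ[k] RatFunc k, γ X = f :=
  ⟨(IntermediateField.val _).comp
    (algEquivOfTranscendental f (transcendental_of_ne_C f hf)).toAlgHom, by
      simp⟩

theorem C_mul_X_add_C_eq_zero {a b : k} (h : C a * X + C b = 0) : a = 0 ∧ b = 0 := by
  have h0 : algebraMap (Polynomial k) (RatFunc k) (Polynomial.C a * Polynomial.X + Polynomial.C b) = 0 := by
    simpa using h
  have h1 := (map_eq_zero_iff _ (IsFractionRing.injective (Polynomial k) (RatFunc k))).mp h0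
  refine ⟨by simpa using congrArg (·.coeff 1) h1, by simpa using congrArg (·.coeff 0) h1⟩

/-- The fractional linear function with the given matrix. -/
noncomputable def moebius (M : Matrix (Fin 2) (Fin 2) k) : RatFunc k :=
  (C (M 0 0) * X + C (M 0 1)) / (C (M 1 0) * X + C (M 1 1))

theorem denom_moebius_ne_zero (M : GL (Fin 2) k) : C (M 1 0) * X + C (M 1 1) ≠ 0 := by
  intro h
  obtain ⟨h0, h1⟩ := C_mul_X_add_C_eq_zero h
  have := M.det_ne_zero
  rw [Matrix.det_fin_two, h0, h1] at this
  simp at this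

theorem moebius_ne_C (M : GL (Fin 2) k) : ¬ ∃ c, moebius (M : Matrix (Fin 2) (Fin 2) k) = C c := by
  rintro ⟨s, hs⟩
  rw [moebius, div_eq_iff (denom_moebius_ne_zero M)] at hs
  have h : C (M 0 0 - s * M 1 0) * X + C (M 0 1 - s * M 1 1) = 0 := by
    simp only [map_sub, map_mul]
    linear_combination hs
  obtain ⟨h0, h1⟩ := C_mul_X_add_C_eq_zero h
  have := M.det_ne_zero
  rw [Matrix.det_fin_two] at this
  exact this (by linear_combination M 1 1 * h0 - M 1 0 * h1)

/-- The endomorphism of the field of rational functions substituting a fractional linear function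
for the variable. -/
noncomputable def moebiusHom (M : GL (Fin 2) k) : RatFunc k →ₐ[k] RatFunc k :=
  (exists_algHom_X_eq (moebius_ne_C M)).choose

theorem moebiusHom_X (M : GL (Fin 2) k) : moebiusHom M X = moebius (M : Matrix (Fin 2) (Fin 2) k) :=
  (exists_algHom_X_eq (moebius_ne_C M)).choose_spec

theorem algHom_moebius (γ : RatFunc k →ₐ[k] RatFunc k) (M : Matrix (Fin 2) (Fin 2) k) :
    γ (moebius M) = (C (M 0 0) * γ X + C (M 0 1)) / (C (M 1 0) * γ X + C (M 1 1)) := by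
  simp [moebius, algHom_C, algebraMap_eq_C]

theorem moebiusHom_one : moebiusHom (1 : GL (Fin 2) k) = AlgHom.id k _ :=
  algHom_ext_X (by simp [moebiusHom_X, moebius])

theorem div_linear_div {F : Type*} [Field F] (a b c d x : F) {y : F} (hy : y ≠ 0) :
    (a * (x / y) + b) / (c * (x / y) + d) = (a * x + b * y) / (c * x + d * y) := by
  rw [← mul_div_mul_right _ _ hy, add_mul, add_mul, mul_assoc, mul_assoc, div_mul_cancel₀ _ hy]

/-- The order is reversed because substitution is contravariant; pullback of maps reverses it once
more, so `cremonaOfGL` is a homomorphism. -/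
theorem moebiusHom_mul (M N : GL (Fin 2) k) :
    moebiusHom (M * N) = (moebiusHom N).comp (moebiusHom M) := by
  apply algHom_ext_X
  rw [AlgHom.comp_apply, moebiusHom_X, moebiusHom_X, algHom_moebius, moebiusHom_X, moebius, moebius]
  have h1 := denom_moebius_ne_zero (M * N)
  have h2 := denom_moebius_ne_zero N
  rw [Matrix.GeneralLinearGroup.coe_mul] at *
  simp only [Matrix.mul_apply, Fin.sum_univ_two, map_add, map_mul] at *
  exact (div_linear_div (C (M 0 0)) (C (M 0 1)) (C (M 1 0)) (C (M 1 1)) _ h2).trans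
    (congrArg₂ _ (by ring) (by ring)) |>.symm

theorem moebiusHom_eq_id_iff (M : GL (Fin 2) k) :
    moebiusHom M = AlgHom.id k _ ↔ M ∈ Subgroup.center (GL (Fin 2) k) := by
  rw [Matrix.GeneralLinearGroup.center_eq_range_scalar]
  constructor
  · intro h
    have h := DFunLike.congr_fun h X
    rw [moebiusHom_X, moebius, AlgHom.id_apply, div_eq_iff (denom_moebius_ne_zero M)] at h
    have h0 : algebraMap (Polynomial k) (RatFunc k)
        (Polynomial.C (M 0 0) * Polynomial.X + Polynomial.C (M 0 1)) =
        algebraMap (Polynomial k) (RatFunc k)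
          (Polynomial.X * (Polynomial.C (M 1 0) * Polynomial.X + Polynomial.C (M 1 1))) := by
      simpa using h
    have h1 := IsFractionRing.injective (Polynomial k) (RatFunc k) h0
    have c0 : M 0 1 = 0 := by simpa using congrArg (·.coeff 0) h1
    have c1 : M 0 0 = M 1 1 := by simpa using congrArg (·.coeff 1) h1
    have c2 : M 1 0 = 0 := by
      simpa [Polynomial.coeff_X, Polynomial.coeff_C] using (congrArg (·.coeff 2) h1).symm
    have hdet := M.det_ne_zero
    rw [Matrix.det_fin_two, c0] at hdet
    have h00 : M 0 0 ≠ 0 := fun h => hdet (by simp [h])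
    refine ⟨Units.mk0 _ h00, ?_⟩
    ext i j
    fin_cases i <;> fin_cases j <;> simp [c0, c1, c2]
  · rintro ⟨r, rfl⟩
    apply algHom_ext_X
    rw [moebiusHom_X]
    simp [moebius]

/-- The degree of `k(t)` over `k(f)` is the larger of the degrees of numerator and denominator of
`f`. Surjectivity makes it one for `f = γ X`, so both are linear. -/
theorem exists_eq_moebius {γ : RatFunc k →ₐ[k] RatFunc k} (h : Function.Surjective γ) :
    ∃ M : GL (Fin 2) k, γ X = moebius (M : Matrix (Fin 2) (Fin 2) k) := by
  have hlin {a b : k} (h' : C a * γ X + C b = 0) : a = 0 ∧ b = 0 := by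
    apply C_mul_X_add_C_eq_zero
    apply γ.injective
    simpa [algHom_C, algebraMap_eq_C] using h'
  have htop : IntermediateField.adjoin k {γ X} = ⊤ := by
    have := IntermediateField.adjoin_map k {(X : RatFunc k)} γ
    rw [Set.image_singleton, adjoin_X, ← AlgHom.fieldRange_eq_map,
      AlgHom.fieldRange_eq_top.mpr h] at this
    exact this.symm
  have h1 := finrank_eq_max_natDegree (γ X)
  rw [htop, IntermediateField.finrank_top] at h1
  obtain ⟨a, b, hab⟩ := Polynomial.exists_eq_X_add_C_of_natDegree_le_one
    (p := (γ X).num) (by rw [h1]; exact le_max_left _ _)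
  obtain ⟨c, d, hcd⟩ := Polynomial.exists_eq_X_add_C_of_natDegree_le_one
    (p := (γ X).denom) (by rw [h1]; exact le_max_right _ _)
  have hX : γ X = (C a * X + C b) / (C c * X + C d) := by
    conv_lhs => rw [← num_div_denom (γ X), hab, hcd]
    simp
  have hne : C c * X + C d ≠ 0 := by
    have := algebraMap_ne_zero (denom_ne_zero (γ X))
    rw [hcd] at this
    simpa using this
  rw [eq_div_iff hne] at hX
  -- A zero determinant would give `c · γ X = a` and `d · γ X = b`, linear relations that by `hlin`
  -- force `c = d = 0`, a zero denominator.
  have hdet : (!![a, b; c, d]).det ≠ 0 := by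
    rw [Matrix.det_fin_two_of]
    intro h0
    have e : C a * C d = C b * C c := by
      rw [← map_mul, ← map_mul]; congr 1; linear_combination h0
    have e1 : C c * γ X + C (-a) = 0 := by
      apply (mul_eq_zero.mp _).resolve_right hne
      rw [map_neg]
      linear_combination C c * hX - e
    have e2 : C d * γ X + C (-b) = 0 := by
      apply (mul_eq_zero.mp _).resolve_right hne
      rw [map_neg]
      linear_combination C d * hX + X * e
    exact hne (by simp [(hlin e1).1, (hlin e2).1])
  refine ⟨Matrix.GeneralLinearGroup.mkOfDetNeZero _ hdet, ?_⟩
  rw [moebius, eq_div_iff]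
  · simpa [Matrix.GeneralLinearGroup.mkOfDetNeZero] using hX
  · simpa [Matrix.GeneralLinearGroup.mkOfDetNeZero] using hne

end RatFunc

/-! ### Finite invariant sets of points -/

namespace Matrix.ProjGenLinGroup

variable {k : Type u} [Field k] [DecidableEq k]

theorem scalar_smul_onePoint (r : kˣ) (x : OnePoint k) :
    GeneralLinearGroup.scalar (Fin 2) r • x = x := by
  cases x with
  | infty => simp [OnePoint.smul_infty_eq_ite]
  | coe x => simp [OnePoint.smul_some_eq_ite]

instance : MulAction PGL(2, k) (OnePoint k) := mulActionOfGL scalar_smul_onePoint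

theorem mk_smul_onePoint (g : GL (Fin 2) k) (x : OnePoint k) : mk g • x = g • x := rfl

/-- A finite group of fractional linear transformations has a finite invariant set of points of the
affine line with at least three elements. -/
theorem exists_invariant_finset [Infinite k] (Γ : Subgroup PGL(2, k)) [Finite Γ] :
    ∃ A : Finset k, 3 ≤ A.card ∧ ∀ g : GL (Fin 2) k, mk g ∈ Γ → ∀ a ∈ A,
      g 1 0 * a + g 1 1 ≠ 0 ∧ (g 0 0 * a + g 0 1) / (g 1 0 * a + g 1 1) ∈ A := by
  have hfin (x : OnePoint k) : (MulAction.orbit Γ x).Finite := Set.finite_range _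
  have hB : ((fun a : k => (a : OnePoint k)) ⁻¹' MulAction.orbit Γ (OnePoint.infty)).Finite :=
    (hfin _).preimage (OnePoint.coe_injective.injOn)
  -- Starting points outside the orbit of `∞` have orbits inside the affine line. Three of them
  -- suffice to keep the Newton map from being fractional linear.
  obtain ⟨t, ht, htc⟩ := hB.infinite_compl.exists_subset_card_eq 3
  have hA : (⋃ x ∈ t, (fun a : k => (a : OnePoint k)) ⁻¹' MulAction.orbit Γ (x : OnePoint k)).Finite :=
    t.finite_toSet.biUnion fun x _ => (hfin _).preimage (OnePoint.coe_injective.injOn)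
  refine ⟨hA.toFinset, ?_, ?_⟩
  · rw [← htc]
    refine Finset.card_le_card fun x hx => ?_
    rw [Set.Finite.mem_toFinset, Set.mem_iUnion₂]
    exact ⟨x, hx, MulAction.mem_orbit_self _⟩
  · intro g hg a ha
    rw [Set.Finite.mem_toFinset, Set.mem_iUnion₂] at ha
    obtain ⟨x, hx, hax⟩ := ha
    have h1 : mk g • (a : OnePoint k) ∈ MulAction.orbit Γ (x : OnePoint k) := by
      obtain ⟨γ, hγ⟩ := hax
      refine ⟨⟨mk g, hg⟩ * γ, ?_⟩
      rw [← show γ • (x : OnePoint k) = a from hγ]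
      exact mul_smul _ _ _
    rw [mk_smul_onePoint, OnePoint.smul_some_eq_ite] at h1
    have h2 : g 1 0 * a + g 1 1 ≠ 0 := by
      intro h0
      rw [if_pos h0] at h1
      exact ht hx (MulAction.mem_orbit_symm.mp h1)
    rw [if_neg h2] at h1
    refine ⟨h2, ?_⟩
    rw [Set.Finite.mem_toFinset, Set.mem_iUnion₂]
    exact ⟨x, hx, h1⟩

end Matrix.ProjGenLinGroup

/-! ### The equivariant Newton map -/

namespace RatFunc

variable {k : Type u} [Field k]

theorem X_sub_C_ne_zero (a : k) : (X : RatFunc k) - C a ≠ 0 := by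
  intro h
  have := C_mul_X_add_C_eq_zero (a := 1) (b := -a) (by simpa [sub_eq_add_neg] using h)
  exact one_ne_zero this.1

/-- The sum of the simple fractions `1 / (X - a)`, for `a` in a finite set. -/
noncomputable def poleSum (A : Finset k) : RatFunc k := ∑ a ∈ A, (X - C a)⁻¹

theorem prod_mul_poleSum [DecidableEq k] (A : Finset k) :
    (∏ a ∈ A, (X - C a)) * poleSum A = ∑ a ∈ A, ∏ b ∈ A.erase a, (X - C b) := by
  rw [poleSum, Finset.mul_sum]
  refine Finset.sum_congr rfl fun a ha => ?_
  rw [← Finset.mul_prod_erase A _ ha, mul_right_comm, mul_inv_cancel₀ (X_sub_C_ne_zero a), one_mul]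

/-- A relation of the given shape forces many roots of a quadratic polynomial. -/
theorem eq_zero_of_mul_poleSum_eq {A : Finset k} (hA : 3 ≤ A.card) {p q : Polynomial k}
    (hp : p.natDegree ≤ 2)
    (h : algebraMap _ (RatFunc k) p * poleSum A = algebraMap _ (RatFunc k) q) : p = 0 ∧ q = 0 := by
  classical
  have h1 : p * ∑ a ∈ A, ∏ b ∈ A.erase a, (Polynomial.X - Polynomial.C b) =
      (∏ a ∈ A, (Polynomial.X - Polynomial.C a)) * q := by
    apply IsFractionRing.injective (Polynomial k) (RatFunc k)
    have := prod_mul_poleSum A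
    simp only [map_mul, map_sum, map_prod, map_sub, algebraMap_X, algebraMap_C]
    rw [← this, ← h]; ring
  -- At a point of `A` the right side vanishes, while in the sum only the summand omitting that
  -- point survives and it is nonzero. So `p` has at least three roots and degree at most two.
  have hroot : ∀ a ∈ A, p.eval a = 0 := by
    intro a ha
    have h2 := congrArg (Polynomial.eval a) h1
    rw [Polynomial.eval_mul, Polynomial.eval_mul, Polynomial.eval_prod,
      Finset.prod_eq_zero ha (by simp), zero_mul, Polynomial.eval_finsetSum] at h2
    refine (mul_eq_zero.mp h2).resolve_right ?_
    rw [Finset.sum_eq_single_of_mem a ha]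
    · rw [Polynomial.eval_prod]
      refine Finset.prod_ne_zero_iff.mpr fun b hb => ?_
      simpa [sub_eq_zero] using (Finset.ne_of_mem_erase hb).symm
    · intro c _ hca
      rw [Polynomial.eval_prod]
      exact Finset.prod_eq_zero (Finset.mem_erase.mpr ⟨hca.symm, ha⟩) (by simp)
  have hp0 : p = 0 := by
    by_contra hne
    have h3 : A.card ≤ p.natDegree :=
      (Finset.card_le_card fun a ha => Multiset.mem_toFinset.mpr
        ((Polynomial.mem_roots hne).mpr (hroot a ha))).trans
        ((Multiset.toFinset_card_le _).trans p.card_roots')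
    omega
  refine ⟨hp0, ?_⟩
  rw [hp0, zero_mul, eq_comm, mul_eq_zero] at h1
  exact h1.resolve_left (Finset.prod_ne_zero_iff.mpr fun a _ => Polynomial.X_sub_C_ne_zero a)

theorem poleSum_ne_zero {A : Finset k} (hA : 3 ≤ A.card) : poleSum A ≠ 0 := by
  intro h
  have := eq_zero_of_mul_poleSum_eq hA (p := 1) (q := 0) (by simp) (by simp [h])
  exact one_ne_zero this.1

variable [CharZero k]

/-- The Newton type map `t ↦ t - n / ∑ (t - a)⁻¹` attached to a finite set of `n` points. -/
noncomputable def newton (A : Finset k) : RatFunc k := X - C (A.card : k) / poleSum A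

/-- Multiplying by `poleSum A` clears its denominator and leaves a quadratic times `poleSum A` equal
to `n (c X + d)`, so `eq_zero_of_mul_poleSum_eq` applies; characteristic zero allows division by
`n`. Both constant and fractional linear values of `newton A` are thereby excluded. -/
theorem newton_mul_ne {A : Finset k} (hA : 3 ≤ A.card) {a b c d : k}
    (h : newton A * (C c * X + C d) = C a * X + C b) : c = 0 ∧ d = 0 := by
  have hn : (A.card : k) ≠ 0 := Nat.cast_ne_zero.mpr (by omega)
  have hw := poleSum_ne_zero hA
  have h1 : algebraMap _ (RatFunc k) (Polynomial.C c * Polynomial.X ^ 2 +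
      Polynomial.C (d - a) * Polynomial.X + Polynomial.C (-b)) * poleSum A =
      algebraMap _ (RatFunc k) (Polynomial.C (A.card * c) * Polynomial.X +
        Polynomial.C (A.card * d)) := by
    have h2 : newton A * poleSum A = X * poleSum A - C (A.card : k) := by
      rw [newton, sub_mul, div_mul_cancel₀ _ hw]
    simp only [map_add, map_mul, map_pow, map_sub, map_neg, algebraMap_X, algebraMap_C]
    linear_combination poleSum A * h - (C c * X + C d) * h2
  have h3 := (eq_zero_of_mul_poleSum_eq hA (Polynomial.natDegree_quadratic_le) h1).2
  have c0 := congrArg (Polynomial.coeff · 0) h3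
  have c1 := congrArg (Polynomial.coeff · 1) h3
  simp [-map_natCast, -map_mul, Polynomial.coeff_C] at c0 c1
  have hne : A ≠ ∅ := by rintro rfl; simp at hA
  exact ⟨c1.resolve_left hne, c0.resolve_left hne⟩

/-- With `J = c X + d` the denominator of `g`, one has `g(X) - g(a) = det g · (X - a) / (J(X)
J(a))`. Invert, use `J(a) / (X - a) = J(X) / (X - a) - c`, and sum over `A`, which `g` permutes. The
defect `n c` is what the constant `n` in `newton` compensates. -/
theorem moebiusHom_poleSum {A : Finset k} (g : GL (Fin 2) k)
    (hg : ∀ a ∈ A, g 1 0 * a + g 1 1 ≠ 0 ∧ (g 0 0 * a + g 0 1) / (g 1 0 * a + g 1 1) ∈ A) :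
    C (g 0 0 * g 1 1 - g 0 1 * g 1 0) * moebiusHom g (poleSum A) =
      (C (g 1 0) * X + C (g 1 1)) * ((C (g 1 0) * X + C (g 1 1)) * poleSum A -
        C (A.card : k) * C (g 1 0)) := by
  classical
  have hdet : g 0 0 * g 1 1 - g 0 1 * g 1 0 ≠ 0 := by
    have := g.det_ne_zero; rwa [Matrix.det_fin_two] at this
  have hinj : Set.InjOn (fun a => (g 0 0 * a + g 0 1) / (g 1 0 * a + g 1 1)) A := by
    intro a ha b hb hab
    have h1 := (hg a ha).1
    have h2 := (hg b hb).1
    simp only [] at hab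
    rw [div_eq_div_iff h1 h2] at hab
    have : (g 0 0 * g 1 1 - g 0 1 * g 1 0) * (a - b) = 0 := by linear_combination hab
    exact sub_eq_zero.mp ((mul_eq_zero.mp this).resolve_left hdet)
  have himg : A.image (fun a => (g 0 0 * a + g 0 1) / (g 1 0 * a + g 1 1)) = A :=
    Finset.eq_of_subset_of_card_le (Finset.image_subset_iff.mpr fun a ha => (hg a ha).2)
      (Finset.card_image_of_injOn hinj).ge
  have hJ := denom_moebius_ne_zero g
  have h1 : moebiusHom g (poleSum A) = ∑ a ∈ A, (moebius (g : Matrix (Fin 2) (Fin 2) k) -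
      C ((g 0 0 * a + g 0 1) / (g 1 0 * a + g 1 1)))⁻¹ := by
    conv_lhs => rw [poleSum, ← himg, Finset.sum_image hinj]
    simp [moebiusHom_X, algHom_C, algebraMap_eq_C]
  have hcard : C (A.card : k) * C (g 1 0) = ∑ a ∈ A, C (g 1 0) := by simp
  rw [h1, hcard, poleSum, Finset.mul_sum, Finset.mul_sum, ← Finset.sum_sub_distrib, Finset.mul_sum]
  refine Finset.sum_congr rfl fun a ha => ?_
  have hJa : C (g 1 0) * C a + C (g 1 1) ≠ 0 := by
    rw [← map_mul, ← map_add]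
    exact (map_ne_zero _).mpr (hg a ha).1
  have hX := X_sub_C_ne_zero a
  have hD : C (g 0 0) * C (g 1 1) - C (g 0 1) * C (g 1 0) ≠ (0 : RatFunc k) := by
    rw [← map_mul, ← map_mul, ← map_sub]
    exact (map_ne_zero _).mpr hdet
  have h3 : moebius (g : Matrix (Fin 2) (Fin 2) k) - C ((g 0 0 * a + g 0 1) / (g 1 0 * a + g 1 1)) =
      ((C (g 0 0) * C (g 1 1) - C (g 0 1) * C (g 1 0)) * (X - C a)) /
        ((C (g 1 0) * X + C (g 1 1)) * (C (g 1 0) * C a + C (g 1 1))) := by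
    rw [moebius, map_div₀, map_add, map_add, map_mul, map_mul, div_sub_div _ _ hJ hJa]
    congr 1; ring
  rw [h3, inv_div, map_sub, map_mul, map_mul, mul_div_assoc', mul_div_mul_left _ _ hD,
    div_eq_iff hX]
  have h4 : (X - C a)⁻¹ * (X - C a) = 1 := inv_mul_cancel₀ hX
  linear_combination (-(C (g 1 0) * X + C (g 1 1)) ^ 2) * h4

/-- The Newton type map of an invariant set commutes with the fractional linear transformation. -/
theorem moebiusHom_newton {A : Finset k} (hA : 3 ≤ A.card) (g : GL (Fin 2) k)
    (hg : ∀ a ∈ A, g 1 0 * a + g 1 1 ≠ 0 ∧ (g 0 0 * a + g 0 1) / (g 1 0 * a + g 1 1) ∈ A) :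
    moebiusHom g (newton A) =
      (C (g 0 0) * newton A + C (g 0 1)) / (C (g 1 0) * newton A + C (g 1 1)) := by
  have hdet : g 0 0 * g 1 1 - g 0 1 * g 1 0 ≠ 0 := by
    have := g.det_ne_zero; rwa [Matrix.det_fin_two] at this
  have hD : C (g 0 0 * g 1 1 - g 0 1 * g 1 0) ≠ (0 : RatFunc k) := (map_ne_zero _).mpr hdet
  have hw := poleSum_ne_zero hA
  have hJ := denom_moebius_ne_zero g
  have hE := moebiusHom_poleSum g hg
  have hγ : moebiusHom g (poleSum A) ≠ 0 := (map_ne_zero _).mpr hw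
  have hE0 : (C (g 1 0) * X + C (g 1 1)) * poleSum A - C (A.card : k) * C (g 1 0) ≠ 0 := by
    intro h
    rw [h, mul_zero] at hE
    exact mul_ne_zero hD hγ hE
  have e1 : C (g 1 0) * newton A + C (g 1 1) =
      ((C (g 1 0) * X + C (g 1 1)) * poleSum A - C (A.card : k) * C (g 1 0)) / poleSum A := by
    rw [newton, eq_div_iff hw]
    linear_combination (-C (g 1 0)) * (div_mul_cancel₀ (C (A.card : k)) hw)
  have e2 : C (g 0 0) * newton A + C (g 0 1) =
      ((C (g 0 0) * X + C (g 0 1)) * poleSum A - C (A.card : k) * C (g 0 0)) / poleSum A := by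
    rw [newton, eq_div_iff hw]
    linear_combination (-C (g 0 0)) * (div_mul_cancel₀ (C (A.card : k)) hw)
  have e3 : moebiusHom g (poleSum A) = ((C (g 1 0) * X + C (g 1 1)) *
      ((C (g 1 0) * X + C (g 1 1)) * poleSum A - C (A.card : k) * C (g 1 0))) /
      C (g 0 0 * g 1 1 - g 0 1 * g 1 0) := by
    rw [eq_div_iff hD, ← hE, mul_comm]
  rw [e1, e2, div_div_div_cancel_right₀ hw, newton, map_sub, map_div₀, e3, moebiusHom_X, algHom_C,
    algebraMap_eq_C, moebius, div_div_eq_mul_div, div_sub_div _ _ hJ (mul_ne_zero hJ hE0),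
    div_eq_div_iff (mul_ne_zero hJ (mul_ne_zero hJ hE0)) hE0]
  simp only [map_sub, map_mul]
  ring

end RatFunc

/-! ### The Cremona group of rank one as the projective linear group -/

namespace Variety

variable {k : Type u} [Field k]

theorem isIso_of_bijective_pullback {X Y : Variety k} (φ : X ⟶ Y)
    (h : Function.Bijective (pullback φ)) : IsIso φ := by
  let e : Y.K ≃ₐ[k] X.K := AlgEquiv.ofBijective (pullback φ) h
  obtain ⟨ψ, hψ⟩ := pullback_surjective (X := Y) (Y := X) e.symm.toAlgHom
  refine ⟨ψ, pullback_injective ?_, pullback_injective ?_⟩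
  · rw [pullback_comp, pullback_id, hψ]
    ext x
    exact e.apply_symm_apply x
  · rw [pullback_comp, pullback_id, hψ]
    ext x
    exact e.symm_apply_apply x

theorem bijective_pullback {X Y : Variety k} (φ : X ⟶ Y) [IsIso φ] :
    Function.Bijective (pullback φ) := by
  refine ⟨(pullback φ).injective, fun x => ⟨pullback (inv φ) x, ?_⟩⟩
  rw [← AlgHom.comp_apply, ← pullback_comp, IsIso.hom_inv_id, pullback_id, AlgHom.id_apply]

theorem nonempty_iso_of_algEquiv {X Y : Variety k} (e : Y.K ≃ₐ[k] X.K) : Nonempty (X ≅ Y) := by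
  obtain ⟨φ, hφ⟩ := pullback_surjective e.toAlgHom
  have := isIso_of_bijective_pullback φ (hφ ▸ e.bijective)
  exact ⟨asIso φ⟩

end Variety

section

variable (k : Type u) [Field k]

/-- A coordinate on the projective line. -/
noncomputable def projectiveLineCoord : (projectiveLine k).K ≃ₐ[k] RatFunc k :=
  (nonempty_algEquiv_ratFunc k).some

variable {k}

/-- The action of a dominant rational self-map of the projective line on rational functions. -/
noncomputable def projectiveLinePullback (φ : projectiveLine k ⟶ projectiveLine k) :
    RatFunc k →ₐ[k] RatFunc k :=
  (projectiveLineCoord k).toAlgHom.comp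
    ((Variety.pullback φ).comp (projectiveLineCoord k).symm.toAlgHom)

theorem projectiveLinePullback_injective :
    Function.Injective (projectiveLinePullback (k := k)) := by
  intro φ ψ h
  apply Variety.pullback_injective
  ext x
  have := DFunLike.congr_fun h (projectiveLineCoord k x)
  simpa [projectiveLinePullback] using this

theorem projectiveLinePullback_surjective :
    Function.Surjective (projectiveLinePullback (k := k)) := by
  intro γ
  obtain ⟨φ, hφ⟩ := Variety.pullback_surjective (X := projectiveLine k) (Y := projectiveLine k)
    ((projectiveLineCoord k).symm.toAlgHom.comp (γ.comp (projectiveLineCoord k).toAlgHom))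
  refine ⟨φ, ?_⟩
  ext x
  simp [projectiveLinePullback, hφ]

theorem projectiveLinePullback_id :
    projectiveLinePullback (𝟙 (projectiveLine k)) = AlgHom.id k _ := by
  ext x
  simp [projectiveLinePullback, Variety.pullback_id]

theorem projectiveLinePullback_comp (φ ψ : projectiveLine k ⟶ projectiveLine k) :
    projectiveLinePullback (φ ≫ ψ) =
      (projectiveLinePullback φ).comp (projectiveLinePullback ψ) := by
  ext x
  simp [projectiveLinePullback, Variety.pullback_comp]

theorem surjective_projectiveLinePullback (φ : projectiveLine k ⟶ projectiveLine k) [IsIso φ] :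
    Function.Surjective (projectiveLinePullback φ) :=
  (projectiveLineCoord k).surjective.comp
    ((Variety.bijective_pullback φ).2.comp (projectiveLineCoord k).symm.surjective)

/-- The fractional linear self-map of the projective line given by an invertible matrix. -/
noncomputable def projectiveLineMoebius (M : GL (Fin 2) k) : projectiveLine k ⟶ projectiveLine k :=
  (projectiveLinePullback_surjective (RatFunc.moebiusHom M)).choose

theorem projectiveLinePullback_moebius (M : GL (Fin 2) k) :
    projectiveLinePullback (projectiveLineMoebius M) = RatFunc.moebiusHom M :=
  (projectiveLinePullback_surjective (RatFunc.moebiusHom M)).choose_spec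

theorem projectiveLineMoebius_one : projectiveLineMoebius (1 : GL (Fin 2) k) = 𝟙 _ := by
  apply projectiveLinePullback_injective
  rw [projectiveLinePullback_moebius, projectiveLinePullback_id, RatFunc.moebiusHom_one]

theorem projectiveLineMoebius_mul (M N : GL (Fin 2) k) :
    projectiveLineMoebius (M * N) = projectiveLineMoebius N ≫ projectiveLineMoebius M := by
  apply projectiveLinePullback_injective
  rw [projectiveLinePullback_comp]
  simp only [projectiveLinePullback_moebius, RatFunc.moebiusHom_mul]

variable (k) in
/-- The birational self-map of the projective line given by an invertible matrix. -/
noncomputable def cremonaOfGL : GL (Fin 2) k →* Cremona₁ k where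
  toFun M :=
    { hom := projectiveLineMoebius M
      inv := projectiveLineMoebius M⁻¹
      hom_inv_id := by
        rw [← projectiveLineMoebius_mul, inv_mul_cancel, projectiveLineMoebius_one]
      inv_hom_id := by
        rw [← projectiveLineMoebius_mul, mul_inv_cancel, projectiveLineMoebius_one] }
  map_one' := Aut.ext projectiveLineMoebius_one
  map_mul' M N := Aut.ext (projectiveLineMoebius_mul M N)

theorem projectiveLinePullback_cremonaOfGL (M : GL (Fin 2) k) :
    projectiveLinePullback (cremonaOfGL k M).hom = RatFunc.moebiusHom M :=
  projectiveLinePullback_moebius M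

/-- The pullback of a birational self-map is a surjective endomorphism of `k(t)`, hence fractional
linear. -/
theorem cremonaOfGL_surjective : Function.Surjective (cremonaOfGL k) := by
  intro g
  have : IsIso g.hom := Iso.isIso_hom g
  obtain ⟨M, hM⟩ := RatFunc.exists_eq_moebius (surjective_projectiveLinePullback g.hom)
  refine ⟨M, Aut.ext (projectiveLinePullback_injective (RatFunc.algHom_ext_X ?_))⟩
  rw [projectiveLinePullback_cremonaOfGL, RatFunc.moebiusHom_X, hM]

theorem ker_cremonaOfGL : (cremonaOfGL k).ker = Subgroup.center (GL (Fin 2) k) := by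
  ext M
  rw [← RatFunc.moebiusHom_eq_id_iff, MonoidHom.mem_ker, ← projectiveLinePullback_cremonaOfGL,
    ← projectiveLinePullback_id, projectiveLinePullback_injective.eq_iff]
  exact ⟨fun h => congrArg Iso.hom h, fun h => Aut.ext h⟩

variable (k) in
/-- The Cremona group of rank one is the projective general linear group. -/
noncomputable def pglEquivCremona : PGL(2, k) ≃* Cremona₁ k :=
  (QuotientGroup.quotientMulEquivOfEq ker_cremonaOfGL.symm).trans
    (QuotientGroup.quotientKerEquivOfSurjective _ cremonaOfGL_surjective)

/-! ### Self-compressions, and the target of a compression -/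

/-- Every finite subgroup of the Cremona group of rank one is nontrivially self-compressible. -/
theorem isNontriviallySelfCompressible_of_finite [CharZero k] (H : Subgroup (Cremona₁ k))
    [Finite H] : Variety.IsNontriviallySelfCompressible H := by
  classical
  have : Finite (H.comap (pglEquivCremona k).toMonoidHom) :=
    Finite.of_injective (fun x => (⟨pglEquivCremona k x.1, x.2⟩ : H)) fun x y h =>
      Subtype.ext ((pglEquivCremona k).injective (congrArg Subtype.val h))
  obtain ⟨A, hA, hinv⟩ := Matrix.ProjGenLinGroup.exists_invariant_finset
    (H.comap (pglEquivCremona k).toMonoidHom)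
  have hconst : ¬ ∃ c, RatFunc.newton A = RatFunc.C c := by
    rintro ⟨c, hc⟩
    have := RatFunc.newton_mul_ne hA (a := 0) (b := c) (c := 0) (d := 1) (by simp [hc])
    exact one_ne_zero this.2
  obtain ⟨γ, hγ⟩ := RatFunc.exists_algHom_X_eq hconst
  obtain ⟨φ, hφ⟩ := projectiveLinePullback_surjective γ
  refine ⟨H, inferInstance, inferInstance, H.subtype, φ, H.range_subtype,
    ⟨H.subtype_injective, H.subtype_injective, ?_⟩, ?_⟩
  · rintro ⟨g, hg⟩
    obtain ⟨M, rfl⟩ := cremonaOfGL_surjective g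
    apply projectiveLinePullback_injective
    apply RatFunc.algHom_ext_X
    rw [projectiveLinePullback_comp, projectiveLinePullback_comp, hφ, AlgHom.comp_apply,
      AlgHom.comp_apply, hγ]
    change projectiveLinePullback (cremonaOfGL k M).hom _ =
      γ (projectiveLinePullback (cremonaOfGL k M).hom _)
    rw [projectiveLinePullback_cremonaOfGL, RatFunc.moebiusHom_X, RatFunc.algHom_moebius, hγ]
    exact RatFunc.moebiusHom_newton hA M (hinv M hg)
  -- An isomorphism would be fractional linear, which `newton_mul_ne` rules out.
  · intro hiso
    obtain ⟨M, hM⟩ := RatFunc.exists_eq_moebius (surjective_projectiveLinePullback φ)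
    rw [hφ, hγ, RatFunc.moebius, eq_div_iff (RatFunc.denom_moebius_ne_zero M)] at hM
    obtain ⟨h0, h1⟩ := RatFunc.newton_mul_ne hA hM
    exact RatFunc.denom_moebius_ne_zero M (by simp [h0, h1])

/-- Lüroth's theorem for dominant rational maps from the projective line. -/
theorem nonempty_iso_projectiveLine_of_not_surjective {X : Variety k} (φ : projectiveLine k ⟶ X)
    (h : ¬ Function.Surjective (algebraMap k X.K)) : Nonempty (X ≅ projectiveLine k) := by
  let j : X.K →ₐ[k] RatFunc k := (projectiveLineCoord k).toAlgHom.comp (Variety.pullback φ)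
  have hj : j.fieldRange ≠ ⊥ := by
    intro hbot
    refine h fun x => ?_
    have hx : j x ∈ j.fieldRange := ⟨x, rfl⟩
    rw [hbot, IntermediateField.mem_bot] at hx
    obtain ⟨c, hc⟩ := hx
    exact ⟨c, j.injective ((j.commutes c).trans hc)⟩
  exact Variety.nonempty_iso_of_algEquiv ((projectiveLineCoord k).trans
    ((RatFunc.Luroth.algEquiv hj).trans (AlgEquiv.ofInjectiveField j).symm))

theorem Variety.bir_eq_one_of_surjective {X : Variety k} (h : Function.Surjective (algebraMap k X.K))
    (g : X.Bir) : g = 1 := by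
  apply Aut.ext
  apply Variety.pullback_injective
  ext x
  obtain ⟨c, rfl⟩ := h x
  simp

/-- The target of a compression of a finite group of birational self-maps of the projective line is
a rational curve. -/
theorem nonempty_iso_projectiveLine_of_isGroupCompression {H₁ : Subgroup (Cremona₁ k)}
    {X : Variety k} {H₂ : Subgroup X.Bir} {φ : projectiveLine k ⟶ X}
    (hφ : Variety.IsGroupCompression H₁ H₂ φ) (h : Nontrivial H₁ ∨ 0 < X.dim) :
    Nonempty (X ≅ projectiveLine k) := by
  refine nonempty_iso_projectiveLine_of_not_surjective φ fun hs => ?_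
  -- Over a point the birational group is trivial, so a faithful action there kills the acting group
  -- and with it `H₁`; alternatively the dimension is positive, which a point contradicts.
  rcases h with h | h
  · obtain ⟨G, _, _, ρ, σ, rfl, -, hc⟩ := hφ
    obtain ⟨⟨-, g, rfl⟩, hg⟩ := exists_ne (1 : ρ.range)
    have : g = 1 := hc.faithful_right (by
      rw [Variety.bir_eq_one_of_surjective hs (σ g), map_one])
    exact hg (Subtype.ext (by simp [this]))
  · exact (X.dim_le_zero_of_surjective hs).not_gt h

theorem Variety.IsGroupCompression.comp_iso {X Y Z : Variety k} {H₁ : Subgroup X.Bir}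
    {H₂ : Subgroup Y.Bir} {φ : X ⟶ Y} (h : IsGroupCompression H₁ H₂ φ) (β : Y ≅ Z) :
    IsGroupCompression H₁ (H₂.map β.conjAut.toMonoidHom) (φ ≫ β.hom) := by
  obtain ⟨G, i, f, ρ, σ, h1, rfl, hc⟩ := h
  refine ⟨G, i, f, ρ, β.conjAut.toMonoidHom.comp σ, h1, MonoidHom.range_comp _ _, hc.faithful_left,
    β.conjAut.injective.comp hc.faithful_right, fun g => ?_⟩
  have := hc.equivariant g
  simp [Iso.conjAut_apply, Iso.trans_hom, reassoc_of% this]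
  rfl

theorem Variety.IsGroupCompression.nonempty_mulEquiv {X Y : Variety k} {H₁ : Subgroup X.Bir}
    {H₂ : Subgroup Y.Bir} {φ : X ⟶ Y} (h : IsGroupCompression H₁ H₂ φ) : Nonempty (H₁ ≃* H₂) := by
  obtain ⟨G, i, f, ρ, σ, rfl, rfl, hc⟩ := h
  exact ⟨(ρ.ofInjective hc.faithful_left).symm.trans (σ.ofInjective hc.faithful_right)⟩

end

/-! ### Explicit calculus with two by two projective matrices -/

namespace Matrix.ProjGenLinGroup

variable {k : Type u} [Field k]

/-- The fractional linear transformation with the given coefficients. -/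
def mat (a b c d : k) (h : a * d - b * c ≠ 0) : PGL(2, k) :=
  mk (GeneralLinearGroup.mkOfDetNeZero !![a, b; c, d] (by rwa [det_fin_two_of]))

theorem exists_eq_mat (g : PGL(2, k)) : ∃ a b c d h, g = mat a b c d h := by
  induction g using induction_on with | mk g =>
  refine ⟨g 0 0, g 0 1, g 1 0, g 1 1, ?_, congrArg mk (Units.ext ?_)⟩
  · have := g.det_ne_zero
    rwa [det_fin_two] at this
  · exact (eta_fin_two _)

theorem mat_mul {a b c d a' b' c' d' : k} (h : a * d - b * c ≠ 0) (h' : a' * d' - b' * c' ≠ 0) :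
    mat a b c d h * mat a' b' c' d' h' =
      mat (a * a' + b * c') (a * b' + b * d') (c * a' + d * c') (c * b' + d * d')
        (by convert mul_ne_zero h h' using 1; ring) := by
  rw [mat, mat, mat, ← map_mul]
  refine congrArg mk (Units.ext ?_)
  simp [GeneralLinearGroup.mkOfDetNeZero]

theorem mat_eq_mat_iff {a b c d a' b' c' d' : k} (h : a * d - b * c ≠ 0)
    (h' : a' * d' - b' * c' ≠ 0) :
    mat a b c d h = mat a' b' c' d' h' ↔
      ∃ r, r ≠ 0 ∧ a' = r * a ∧ b' = r * b ∧ c' = r * c ∧ d' = r * d := by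
  rw [mat, mat, mk_eq_mk_iff]
  constructor
  · rintro ⟨r, hr⟩
    have key (i j : Fin 2) :=
      congrArg (fun M : GL (Fin 2) k => (M : Matrix (Fin 2) (Fin 2) k) i j) hr
    refine ⟨r, r.ne_zero, ?_⟩
    have h00 := key 0 0
    have h01 := key 0 1
    have h10 := key 1 0
    have h11 := key 1 1
    simp [GeneralLinearGroup.mkOfDetNeZero, Matrix.mul_apply, Matrix.scalar_apply] at h00 h01 h10 h11
    exact ⟨by rw [← h00, mul_comm], by rw [← h01, mul_comm], by rw [← h10, mul_comm],
      by rw [← h11, mul_comm]⟩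
  · rintro ⟨r, hr, rfl, rfl, rfl, rfl⟩
    refine ⟨Units.mk0 r hr, Units.ext ?_⟩
    ext i j
    fin_cases i <;> fin_cases j <;>
      simp [GeneralLinearGroup.mkOfDetNeZero, Matrix.mul_apply, Matrix.scalar_apply, mul_comm]

theorem mat_congr {a b c d a' b' c' d' : k} {h : a * d - b * c ≠ 0}
    {h' : a' * d' - b' * c' ≠ 0} (ha : a' = a) (hb : b' = b) (hc : c' = c) (hd : d' = d) :
    mat a b c d h = mat a' b' c' d' h' := by
  subst ha hb hc hd; rfl

theorem mat_smul {a b c d : k} (h : a * d - b * c ≠ 0) {r : k} (hr : r ≠ 0) :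
    mat a b c d h = mat (r * a) (r * b) (r * c) (r * d)
      (by convert mul_ne_zero (mul_ne_zero hr hr) h using 1; ring) :=
  (mat_eq_mat_iff _ _).mpr ⟨r, hr, rfl, rfl, rfl, rfl⟩

theorem one_eq_mat : (1 : PGL(2, k)) = mat 1 0 0 1 (by simp) := by
  rw [mat, ← mk_one]
  refine congrArg mk (Units.ext ?_)
  simp [GeneralLinearGroup.mkOfDetNeZero, one_fin_two]

theorem mat_eq_one_iff {a b c d : k} (h : a * d - b * c ≠ 0) :
    mat a b c d h = 1 ↔ a = d ∧ b = 0 ∧ c = 0 := by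
  rw [one_eq_mat, eq_comm, mat_eq_mat_iff]
  constructor
  · rintro ⟨r, hr, ha, hb, hc, hd⟩
    exact ⟨by rw [ha, hd], by simpa using hb, by simpa using hc⟩
  · rintro ⟨rfl, rfl, rfl⟩
    exact ⟨a, by rintro rfl; simp at h, by simp, by simp, by simp, by simp⟩

theorem mat_inv {a b c d : k} (h : a * d - b * c ≠ 0) :
    (mat a b c d h)⁻¹ = mat d (-b) (-c) a (by convert h using 1; ring) := by
  rw [inv_eq_iff_mul_eq_one, mat_mul, mat_eq_one_iff]
  exact ⟨by ring, by ring, by ring⟩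

/-- A matrix representing the given transformation. -/
noncomputable def rep (g : PGL(2, k)) : GL (Fin 2) k :=
  Function.surjInv (f := (mk : GL (Fin 2) k → PGL(2, k))) mk_surjective g

theorem mk_rep (g : PGL(2, k)) : mk (rep g) = g :=
  Function.surjInv_eq (f := (mk : GL (Fin 2) k → PGL(2, k))) mk_surjective g

/-- The square of the trace divided by the determinant. -/
noncomputable def tau (g : PGL(2, k)) : k :=
  (rep g : Matrix (Fin 2) (Fin 2) k).trace ^ 2 / (rep g : Matrix (Fin 2) (Fin 2) k).det

/-- Trace squared and determinant both scale by the square of a scalar factor, so the quotient does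
not see the choice of representative. -/
theorem tau_mk (g : GL (Fin 2) k) :
    tau (mk g) = (g : Matrix (Fin 2) (Fin 2) k).trace ^ 2 / (g : Matrix (Fin 2) (Fin 2) k).det := by
  obtain ⟨r, hr⟩ := mk_eq_mk_iff.mp (mk_rep (mk g))
  rw [tau]
  have h1 := congrArg (fun M : GL (Fin 2) k => (M : Matrix (Fin 2) (Fin 2) k)) hr
  generalize rep (mk g) = x at *
  have h2 : (r : k) ^ 2 ≠ 0 := pow_ne_zero _ r.ne_zero
  have ht : (g : Matrix (Fin 2) (Fin 2) k).trace = r * (x : Matrix (Fin 2) (Fin 2) k).trace := by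
    rw [← h1]
    simp [trace_fin_two, Matrix.mul_apply, Matrix.scalar_apply]
    ring
  have hd : (g : Matrix (Fin 2) (Fin 2) k).det = r ^ 2 * (x : Matrix (Fin 2) (Fin 2) k).det := by
    rw [← h1]
    simp [Matrix.det_mul, Matrix.scalar_apply, sq, mul_comm]
  rw [ht, hd, mul_pow, mul_div_mul_left _ _ h2]

theorem tau_mat {a b c d : k} (h : a * d - b * c ≠ 0) :
    tau (mat a b c d h) = (a + d) ^ 2 / (a * d - b * c) := by
  rw [mat, tau_mk]
  simp [GeneralLinearGroup.mkOfDetNeZero, trace_fin_two, det_fin_two]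

theorem tau_mul_comm (g h : PGL(2, k)) : tau (g * h) = tau (h * g) := by
  induction g using induction_on with | mk g =>
  induction h using induction_on with | mk h =>
  rw [← map_mul, ← map_mul, tau_mk, tau_mk]
  simp only [GeneralLinearGroup.coe_mul]
  rw [trace_mul_comm, det_mul_comm]

theorem tau_conj (c g : PGL(2, k)) : tau (MulAut.conj c g) = tau g := by
  rw [MulAut.conj_apply, tau_mul_comm, inv_mul_cancel_left]

theorem tau_one : tau (1 : PGL(2, k)) = 4 := by
  rw [one_eq_mat, tau_mat]; norm_num

/-- The homothety with the given ratio. -/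
def diag : kˣ →* PGL(2, k) where
  toFun a := mat a 0 0 1 (by simp)
  map_one' := by rw [one_eq_mat]; rfl
  map_mul' a b := by
    rw [mat_mul]
    apply mat_congr <;> simp

theorem diag_apply (a : kˣ) : diag a = mat (a : k) 0 0 1 (by simp) := rfl

theorem diag_injective : Function.Injective (diag : kˣ → PGL(2, k)) := by
  rw [injective_iff_map_eq_one]
  intro a h
  rw [diag_apply, mat_eq_one_iff] at h
  exact Units.ext h.1

theorem mat_eq_diag {a d : k} (h : a * d - 0 * 0 ≠ 0) (ha : a ≠ 0) (hd : d ≠ 0) :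
    mat a 0 0 d h = diag (Units.mk0 (a / d) (div_ne_zero ha hd)) := by
  rw [diag_apply, eq_comm, mat_eq_mat_iff]
  exact ⟨d, hd, by simp [mul_div_cancel₀ _ hd], by simp, by simp, by simp⟩

theorem tau_diag (a : kˣ) : tau (diag a) = (a : k) + 2 + (a : k)⁻¹ := by
  rw [diag_apply, tau_mat]
  have := a.ne_zero
  field_simp
  ring

theorem upper_pow (b : k) (n : ℕ) :
    mat 1 b 0 1 (by simp) ^ n = mat 1 (n * b) 0 1 (by simp) := by
  induction n with
  | zero => rw [pow_zero, one_eq_mat]; apply mat_congr <;> simp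
  | succ n ih => rw [pow_succ, ih, mat_mul]; apply mat_congr <;> simp; ring

theorem upper_eq_one [CharZero k] {b : k} (h : IsOfFinOrder (mat 1 b 0 1 (by simp))) :
    mat 1 b 0 1 (by simp) = 1 := by
  obtain ⟨n, hn, h⟩ := isOfFinOrder_iff_pow_eq_one.mp h
  rw [upper_pow, mat_eq_one_iff] at h
  rw [mat_eq_one_iff]
  exact ⟨rfl, (mul_eq_zero.mp h.2.1).resolve_left (Nat.cast_ne_zero.mpr hn.ne'), rfl⟩

theorem exists_conj_eq_upper [IsAlgClosed k] [CharZero k] (g : PGL(2, k)) :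
    ∃ c : PGL(2, k), ∃ a b d h, MulAut.conj c g = mat a b 0 d h := by
  obtain ⟨p, q, r, s, h, rfl⟩ := exists_eq_mat g
  by_cases hr : r = 0
  · subst hr
    exact ⟨1, p, q, s, h, by simp⟩
  · obtain ⟨z, hz⟩ := IsAlgClosed.exists_pow_nat_eq ((s - p) ^ 2 + 4 * r * q) (n := 2) (by norm_num)
    -- The root `x` is a fixed point of the transformation; conjugating by `t ↦ 1 / (t - x)` moves
    -- it to `∞`, and the matrix becomes upper triangular.
    obtain ⟨x, hx⟩ : ∃ x, r * x ^ 2 + (s - p) * x - q = 0 := by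
      refine ⟨(p - s + z) / (2 * r), ?_⟩
      field_simp
      linear_combination hz
    refine ⟨mat 0 1 1 (-x) (by simp), r * x + s, r, p - x * r, ?_, ?_⟩
    · convert h using 1
      linear_combination (-r) * hx
    · rw [MulAut.conj_apply, mat_inv, mat_mul, mat_mul, mat_eq_mat_iff]
      exact ⟨-1, by simp, by ring, by ring, by linear_combination hx, by ring⟩

/-- In triangular form, equal diagonal entries give a translation, which in characteristic zero has
finite order only if trivial. Otherwise there is a second fixed point `-b / (a - d)`, which a
translation moves to `0`. -/
theorem exists_conj_eq_diag [IsAlgClosed k] [CharZero k] {g : PGL(2, k)} (hg : IsOfFinOrder g) :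
    ∃ c : PGL(2, k), ∃ a : kˣ, MulAut.conj c g = diag a := by
  obtain ⟨c, a, b, d, h, hc⟩ := exists_conj_eq_upper g
  have h0 : a * d ≠ 0 := by simpa using h
  have ha := left_ne_zero_of_mul h0
  have hd := right_ne_zero_of_mul h0
  by_cases had : a = d
  · subst had
    have hfin : IsOfFinOrder (MulAut.conj c g) :=
      (MulAut.conj c).toMonoidHom.isOfFinOrder hg
    have : mat a b 0 a h = mat 1 (b / a) 0 1 (by simp) := by
      rw [eq_comm, mat_eq_mat_iff]
      exact ⟨a, ha, by simp, by field_simp, by simp, by simp⟩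
    rw [this] at hc
    rw [hc] at hfin
    exact ⟨c, 1, by rw [hc, upper_eq_one hfin, map_one]⟩
  · have had' : a - d ≠ 0 := sub_ne_zero.mpr had
    refine ⟨mat 1 (b / (a - d)) 0 1 (by simp) * c, Units.mk0 (a / d) (div_ne_zero ha hd), ?_⟩
    rw [map_mul, MulAut.mul_apply, hc, ← mat_eq_diag (by simpa using h0) ha hd, MulAut.conj_apply,
      mat_inv, mat_mul, mat_mul]
    apply mat_congr
    · ring
    · field_simp; ring
    · ring
    · ring

theorem orderOf_diag (a : kˣ) : orderOf (diag a) = orderOf a :=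
  orderOf_injective diag diag_injective a

theorem exists_conj_eq_diag_of_orderOf [IsAlgClosed k] [CharZero k] {g : PGL(2, k)} {n : ℕ}
    (hn : 0 < n) (hg : orderOf g = n) :
    ∃ c : PGL(2, k), ∃ a : kˣ, MulAut.conj c g = diag a ∧ orderOf a = n := by
  obtain ⟨c, a, h⟩ := exists_conj_eq_diag (orderOf_pos_iff.mp (hg ▸ hn))
  refine ⟨c, a, h, ?_⟩
  rw [← orderOf_diag, ← h, ← hg]
  exact orderOf_injective (MulAut.conj c).toMonoidHom (MulAut.conj c).injective g

/-- Here and in the next three lemmas the element is conjugate to a homothety by a primitive `n`-th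
root of unity `a`, and `tau` equals `a + 2 + a⁻¹`. For `n = 5` this depends on the root, so only its
quadratic equation is recorded. -/
theorem tau_of_orderOf_two [IsAlgClosed k] [CharZero k] {g : PGL(2, k)} (hg : orderOf g = 2) :
    tau g = 0 := by
  obtain ⟨c, a, hc, ha⟩ := exists_conj_eq_diag_of_orderOf two_pos hg
  have h0 := a.ne_zero
  have h1 : (a : k) ^ 2 = 1 := by rw [← Units.val_pow_eq_pow_val, ← ha, pow_orderOf_eq_one]; rfl
  have h2 : (a : k) ≠ 1 := fun h => by rw [Units.val_eq_one.mp h, orderOf_one] at ha; omega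
  rw [← tau_conj c, hc, tau_diag]
  have h3 : (a : k) = -1 := by
    rcases mul_eq_zero.mp (show ((a : k) - 1) * (a + 1) = 0 by linear_combination h1) with h | h
    · exact absurd (sub_eq_zero.mp h) h2
    · exact eq_neg_of_add_eq_zero_left h
  rw [h3]; norm_num

theorem tau_of_orderOf_three [IsAlgClosed k] [CharZero k] {g : PGL(2, k)} (hg : orderOf g = 3) :
    tau g = 1 := by
  obtain ⟨c, a, hc, ha⟩ := exists_conj_eq_diag_of_orderOf three_pos hg
  have h0 := a.ne_zero
  have h1 : (a : k) ^ 3 = 1 := by rw [← Units.val_pow_eq_pow_val, ← ha, pow_orderOf_eq_one]; rfl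
  have h2 : (a : k) - 1 ≠ 0 := sub_ne_zero.mpr fun h => by
    rw [Units.val_eq_one.mp h, orderOf_one] at ha; omega
  rw [← tau_conj c, hc, tau_diag]
  have h3 : (a : k) ^ 2 + a + 1 = 0 :=
    (mul_eq_zero.mp (by linear_combination h1)).resolve_left h2
  field_simp
  linear_combination h3

theorem tau_of_orderOf_four [IsAlgClosed k] [CharZero k] {g : PGL(2, k)} (hg : orderOf g = 4) :
    tau g = 2 := by
  obtain ⟨c, a, hc, ha⟩ := exists_conj_eq_diag_of_orderOf four_pos hg
  have h0 := a.ne_zero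
  have h1 : (a : k) ^ 4 = 1 := by rw [← Units.val_pow_eq_pow_val, ← ha, pow_orderOf_eq_one]; rfl
  have h2 : (a : k) ^ 2 - 1 ≠ 0 := sub_ne_zero.mpr fun h => by
    have : a ^ 2 = 1 := Units.ext (by simpa using h)
    have := orderOf_dvd_of_pow_eq_one this
    rw [ha] at this
    omega
  rw [← tau_conj c, hc, tau_diag]
  have h3 : (a : k) ^ 2 + 1 = 0 :=
    (mul_eq_zero.mp (by linear_combination h1)).resolve_left h2
  field_simp
  linear_combination h3

theorem tau_of_orderOf_five [IsAlgClosed k] [CharZero k] {g : PGL(2, k)} (hg : orderOf g = 5) :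
    tau g ^ 2 - 3 * tau g + 1 = 0 := by
  obtain ⟨c, a, hc, ha⟩ := exists_conj_eq_diag_of_orderOf (by norm_num) hg
  have h0 := a.ne_zero
  have h1 : (a : k) ^ 5 = 1 := by rw [← Units.val_pow_eq_pow_val, ← ha, pow_orderOf_eq_one]; rfl
  have h2 : (a : k) - 1 ≠ 0 := sub_ne_zero.mpr fun h => by
    rw [Units.val_eq_one.mp h, orderOf_one] at ha; omega
  rw [← tau_conj c, hc, tau_diag]
  have h3 : (a : k) ^ 4 + a ^ 3 + a ^ 2 + a + 1 = 0 :=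
    (mul_eq_zero.mp (by linear_combination h1)).resolve_left h2
  field_simp
  linear_combination h3

end Matrix.ProjGenLinGroup

/-! ### Fixed points, stabilizers and the arithmetic of orbits -/

namespace Matrix.ProjGenLinGroup

variable {k : Type u} [Field k]

/-- The ratio of the diagonal entries. -/
noncomputable def ratio (g : PGL(2, k)) : k := rep g 0 0 / rep g 1 1

theorem ratio_mat {a b c d : k} (h : a * d - b * c ≠ 0) : ratio (mat a b c d h) = a / d := by
  obtain ⟨r, hr⟩ := mk_eq_mk_iff.mp (mk_rep (mat a b c d h))
  rw [ratio]
  generalize rep (mat a b c d h) = x at *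
  have key (i j : Fin 2) := congrArg (fun M : GL (Fin 2) k => (M : Matrix (Fin 2) (Fin 2) k) i j) hr
  have h0 := key 0 0
  have h1 := key 1 1
  simp [GeneralLinearGroup.mkOfDetNeZero, Matrix.mul_apply, Matrix.scalar_apply] at h0 h1
  rw [← h0, ← h1, mul_div_mul_right _ _ r.ne_zero]

section Action

variable [DecidableEq k]

theorem mat_smul_coe {a b c d : k} (h : a * d - b * c ≠ 0) (x : k) :
    mat a b c d h • (x : OnePoint k) =
      if c * x + d = 0 then OnePoint.infty else (((a * x + b) / (c * x + d) : k) : OnePoint k) := by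
  rw [mat, mk_smul_onePoint, OnePoint.smul_some_eq_ite]
  rfl

theorem mat_smul_infty {a b c d : k} (h : a * d - b * c ≠ 0) :
    mat a b c d h • (OnePoint.infty : OnePoint k) =
      if c = 0 then OnePoint.infty else ((a / c : k) : OnePoint k) := by
  rw [mat, mk_smul_onePoint, OnePoint.smul_infty_eq_ite]
  rfl

theorem exists_eq_upper_of_smul_infty {g : PGL(2, k)}
    (hg : g • (OnePoint.infty : OnePoint k) = OnePoint.infty) :
    ∃ a b d h, g = mat a b 0 d h := by
  obtain ⟨a, b, c, d, h, rfl⟩ := exists_eq_mat g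
  rw [mat_smul_infty] at hg
  split_ifs at hg with hc
  · subst hc
    exact ⟨a, b, d, h, rfl⟩
  · exact absurd hg (OnePoint.coe_ne_infty _)

theorem exists_smul_eq_infty (x : OnePoint k) : ∃ c : PGL(2, k), c • x = OnePoint.infty := by
  cases x with
  | infty => exact ⟨1, one_smul _ _⟩
  | coe x =>
    refine ⟨mat 0 1 1 (-x) (by simp), ?_⟩
    rw [mat_smul_coe, if_pos (by ring)]

theorem diag_smul_eq_self_iff {a : kˣ} (ha : a ≠ 1) (x : OnePoint k) :
    diag a • x = x ↔ x = OnePoint.infty ∨ x = ((0 : k) : OnePoint k) := by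
  rw [diag_apply]
  cases x with
  | infty => simp [mat_smul_infty]
  | coe x =>
    have ha' : (a : k) ≠ 1 := fun h => ha (Units.val_eq_one.mp h)
    rw [mat_smul_coe, if_neg (by simp)]
    simp only [zero_mul, zero_add, add_zero, div_one, OnePoint.coe_ne_infty, false_or,
      OnePoint.coe_eq_coe]
    exact ⟨fun h => by_contra fun h0 => ha' (mul_right_cancel₀ h0 (h.trans (one_mul x).symm)), by rintro rfl; exact mul_zero _⟩

theorem exists_fixed_points [IsAlgClosed k] [CharZero k] {g : PGL(2, k)} (hg : IsOfFinOrder g)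
    (hne : g ≠ 1) : ∃ x y : OnePoint k, x ≠ y ∧ ∀ z : OnePoint k, g • z = z ↔ z = x ∨ z = y := by
  obtain ⟨c, a, hc⟩ := exists_conj_eq_diag hg
  have ha : a ≠ 1 := by
    rintro rfl
    rw [map_one] at hc
    exact hne ((MulAut.conj c).injective (hc.trans (map_one _).symm))
  refine ⟨c⁻¹ • OnePoint.infty, c⁻¹ • ((0 : k) : OnePoint k), ?_, fun z => ?_⟩
  · intro h
    exact OnePoint.infty_ne_coe _ (smul_left_cancel _ h)
  · rw [eq_inv_smul_iff, eq_inv_smul_iff, ← diag_smul_eq_self_iff ha, ← hc, MulAut.conj_apply,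
      mul_smul, mul_smul, inv_smul_smul]
    exact (smul_left_cancel_iff c).symm

/-- Once `x` is moved to `∞` the group is triangular and `ratio` is multiplicative on it. The kernel
consists of translations of finite order, so it is trivial, and a finite group embedded in the
multiplicative monoid of a field is cyclic. -/
theorem isCyclic_of_smul_eq [CharZero k] (K : Subgroup PGL(2, k)) [Finite K] (x : OnePoint k)
    (hK : ∀ g ∈ K, g • x = x) : IsCyclic K := by
  obtain ⟨c, hc⟩ := exists_smul_eq_infty x
  have hup (g : K) : ∃ a b d h, MulAut.conj c g.1 = mat a b 0 d h := by
    apply exists_eq_upper_of_smul_infty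
    rw [MulAut.conj_apply, mul_smul, mul_smul, ← hc, inv_smul_smul, hK _ g.2]
  let f : K →* k :=
    { toFun := fun g => ratio (MulAut.conj c g.1)
      map_one' := by
        rw [Subgroup.coe_one, map_one, one_eq_mat, ratio_mat, div_one]
      map_mul' := fun g g' => by
        obtain ⟨a, b, d, h, hg⟩ := hup g
        obtain ⟨a', b', d', h', hg'⟩ := hup g'
        rw [Subgroup.coe_mul, map_mul, hg, hg', mat_mul, ratio_mat, ratio_mat, ratio_mat]
        simp [mul_div_mul_comm] }
  have hker (g : K) (hg : f g = 1) : g = 1 := by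
    obtain ⟨a, b, d, h, hgm⟩ := hup g
    have h0 : a * d ≠ 0 := by simpa using h
    have hd := right_ne_zero_of_mul h0
    change ratio (MulAut.conj c g.1) = 1 at hg
    rw [hgm, ratio_mat, div_eq_one_iff_eq hd] at hg
    subst hg
    have h1 : mat a b 0 a h = mat 1 (b / a) 0 1 (by simp) := by
      rw [eq_comm, mat_eq_mat_iff]
      exact ⟨a, hd, by simp, by field_simp, by simp, by simp⟩
    have h2 : IsOfFinOrder (MulAut.conj c g.1) :=
      (MulAut.conj c).toMonoidHom.isOfFinOrder (K.subtype.isOfFinOrder (isOfFinOrder_of_finite g))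
    rw [hgm, h1] at h2
    rw [h1, upper_eq_one h2] at hgm
    exact Subtype.ext ((MulAut.conj c).injective (hgm.trans (map_one _).symm))
  refine isCyclic_of_injective_ringHom (f : K →* k) ?_
  intro g g' h
  have := hker (g * g'⁻¹) (by
    have h1 : f g'⁻¹ * f g' = 1 := by rw [← map_mul, inv_mul_cancel, map_one]
    rw [map_mul, h, mul_comm, h1])
  exact mul_inv_eq_one.mp this

end Action

/-- The numerical classification behind the list of finite groups of rotations. -/
theorem card_classification_of_sorted {N a b c d e f : ℕ} (h1 : a * d = N)
    (h2 : b * e = N) (h3 : c * f = N) (hd : 2 ≤ d) (hde : d ≤ e) (hef : e ≤ f)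
    (hs : a + b + c = N + 2) : 2 * f = N ∨ (N = 12 ∧ d = 2 ∧ e = 3 ∧ f = 3) ∨
      (N = 24 ∧ d = 2 ∧ e = 3 ∧ f = 4) ∨ (N = 60 ∧ d = 2 ∧ e = 3 ∧ f = 5) := by
  -- Here `a, b, c` play the role of orbit sizes and `d, e, f` of stabilizer orders. If all
  -- stabilizers had order at least 3, the sizes would add up to at most `N`; the bounds on `e` and
  -- `f` below use `1/2 + 1/4 + 1/4 = 1` and `1/2 + 1/3 + 1/6 = 1` in the same way.
  have hd2 : d = 2 := by
    by_contra hne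
    have e1 : a * 3 ≤ a * d := Nat.mul_le_mul_left _ (by omega)
    have e2 : b * 3 ≤ b * e := Nat.mul_le_mul_left _ (by omega)
    have e3 : c * 3 ≤ c * f := Nat.mul_le_mul_left _ (by omega)
    omega
  subst hd2
  have he : e ≤ 3 := by
    by_contra hne
    have e2 : b * 4 ≤ b * e := Nat.mul_le_mul_left _ (by omega)
    have e3 : c * 4 ≤ c * f := Nat.mul_le_mul_left _ (by omega)
    omega
  obtain rfl | rfl : e = 2 ∨ e = 3 := by omega
  · left
    have : c = 2 := by omega
    subst this
    exact h3
  · have hf : f ≤ 5 := by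
      by_contra hne
      have e3 : c * 6 ≤ c * f := Nat.mul_le_mul_left _ (by omega)
      omega
    interval_cases f <;> omega

theorem card_classification_of_three {N a b c d e f : ℕ} (h1 : a * d = N)
    (h2 : b * e = N) (h3 : c * f = N) (hd : 2 ≤ d) (he : 2 ≤ e) (hf : 2 ≤ f)
    (hs : a + b + c = N + 2) : (2 * d = N ∨ 2 * e = N ∨ 2 * f = N) ∨
      (N = 12 ∧ (d = 2 ∨ d = 3) ∧ (e = 2 ∨ e = 3) ∧ (f = 2 ∨ f = 3)) ∨
      (N = 24 ∧ (d = 2 ∨ d = 3 ∨ d = 4) ∧ (e = 2 ∨ e = 3 ∨ e = 4) ∧ (f = 2 ∨ f = 3 ∨ f = 4)) ∨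
      (N = 60 ∧ (d = 2 ∨ d = 3 ∨ d = 5) ∧ (e = 2 ∨ e = 3 ∨ e = 5) ∧ (f = 2 ∨ f = 3 ∨ f = 5)) := by
  rcases le_total d e with h | h <;> rcases le_total e f with h' | h' <;>
    rcases le_total d f with h'' | h''
  all_goals
    obtain h4 | ⟨h4, h5, h6, h7⟩ | ⟨h4, h5, h6, h7⟩ | ⟨h4, h5, h6, h7⟩ := by
      first
      | exact card_classification_of_sorted h1 h2 h3 hd h h' hs
      | exact card_classification_of_sorted h1 h3 h2 hd h'' h' (by omega)
      | exact card_classification_of_sorted h3 h1 h2 hf h'' h (by omega)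
      | exact card_classification_of_sorted h2 h1 h3 he h h'' (by omega)
      | exact card_classification_of_sorted h2 h3 h1 he h' h'' (by omega)
      | exact card_classification_of_sorted h3 h2 h1 hf h' h (by omega)
    · exact Or.inl (by omega)
    · exact Or.inr (Or.inl ⟨h4, by omega, by omega, by omega⟩)
    · exact Or.inr (Or.inr (Or.inl ⟨h4, by omega, by omega, by omega⟩))
    · exact Or.inr (Or.inr (Or.inr ⟨h4, by omega, by omega, by omega⟩))

/-- `hs` is Burnside's count with two fixed points for each of the `N - 1` nontrivial elements.
Stabilizers of order at least two allow fewer than four orbits; zero or one is impossible, two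
orbits are two fixed points, and three lead to the numerical list. -/
theorem card_classification {Ω : Type*} [Fintype Ω] (n e : Ω → ℕ) {N : ℕ} (hN : 2 ≤ N)
    (hne : ∀ ω, n ω * e ω = N) (he : ∀ ω, 2 ≤ e ω)
    (hs : ∑ ω, n ω + 2 * (N - 1) = Fintype.card Ω * N) :
    (∃ ω, e ω = N) ∨ (∃ ω, 2 * e ω = N) ∨ (N = 12 ∧ ∀ ω, e ω = 2 ∨ e ω = 3) ∨
      (N = 24 ∧ ∀ ω, e ω = 2 ∨ e ω = 3 ∨ e ω = 4) ∨
      (N = 60 ∧ ∀ ω, e ω = 2 ∨ e ω = 3 ∨ e ω = 5) := by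
  have hle (ω) : n ω * 2 ≤ N := (hne ω) ▸ Nat.mul_le_mul_left _ (he ω)
  have hpos (ω) : 1 ≤ n ω := by
    by_contra h
    have := hne ω
    rw [show n ω = 0 by omega] at this
    omega
  have hsum : (∑ ω, n ω) * 2 ≤ Fintype.card Ω * N := by
    rw [Finset.sum_mul]
    simpa using Finset.sum_le_sum fun ω (_ : ω ∈ Finset.univ) => hle ω
  have hcard : Fintype.card Ω < 4 := by
    by_contra h
    have : 4 * N ≤ Fintype.card Ω * N := Nat.mul_le_mul_right _ (by omega)
    omega
  obtain ⟨r, ⟨i⟩⟩ : ∃ r, Nonempty (Fin r ≃ Ω) := ⟨_, ⟨(Fintype.equivFin Ω).symm⟩⟩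
  rw [← i.sum_comp] at hs
  have hr : Fintype.card Ω = r := by rw [← Fintype.card_congr i, Fintype.card_fin]
  rw [hr] at hs hcard
  clear hsum
  interval_cases r
  · omega
  · rw [Fin.sum_univ_one] at hs
    have := hpos (i 0)
    omega
  · rw [Fin.sum_univ_two] at hs
    have h0 := hpos (i 0)
    have h1 := hpos (i 1)
    have := hne (i 0)
    rw [show n (i 0) = 1 by omega, one_mul] at this
    exact Or.inl ⟨_, this⟩
  · rw [Fin.sum_univ_three] at hs
    have hall {p : Ω → Prop} (h0 : p (i 0)) (h1 : p (i 1)) (h2 : p (i 2)) (ω) : p ω := by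
      obtain ⟨j, rfl⟩ := i.surjective ω
      fin_cases j <;> assumption
    rcases card_classification_of_three (hne (i 0)) (hne (i 1)) (hne (i 2)) (he _) (he _) (he _)
      (by omega) with h | ⟨h, h0, h1, h2⟩ | ⟨h, h0, h1, h2⟩ | ⟨h, h0, h1, h2⟩
    · rcases h with h | h | h <;> exact Or.inr (Or.inl ⟨_, h⟩)
    · exact Or.inr (Or.inr (Or.inl ⟨h, hall h0 h1 h2⟩))
    · exact Or.inr (Or.inr (Or.inr (Or.inl ⟨h, hall h0 h1 h2⟩)))
    · exact Or.inr (Or.inr (Or.inr (Or.inr ⟨h, hall h0 h1 h2⟩)))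

end Matrix.ProjGenLinGroup

/-! ### Rough classification of finite subgroups -/

namespace Matrix.ProjGenLinGroup

theorem card_stabilizer_classification {G X : Type*} [Group G] [Finite G] [MulAction G X] [Finite X]
    (h2 : ∀ g : G, g ≠ 1 → Nat.card (MulAction.fixedBy X g) = 2)
    (hs : ∀ x : X, MulAction.stabilizer G x ≠ ⊥) (hN : 2 ≤ Nat.card G) :
    (∃ x : X, Nat.card (MulAction.stabilizer G x) = Nat.card G) ∨
      (∃ x : X, 2 * Nat.card (MulAction.stabilizer G x) = Nat.card G) ∨
      (Nat.card G = 12 ∧ ∀ x : X, Nat.card (MulAction.stabilizer G x) = 2 ∨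
        Nat.card (MulAction.stabilizer G x) = 3) ∨
      (Nat.card G = 24 ∧ ∀ x : X, Nat.card (MulAction.stabilizer G x) = 2 ∨
        Nat.card (MulAction.stabilizer G x) = 3 ∨ Nat.card (MulAction.stabilizer G x) = 4) ∨
      (Nat.card G = 60 ∧ ∀ x : X, Nat.card (MulAction.stabilizer G x) = 2 ∨
        Nat.card (MulAction.stabilizer G x) = 3 ∨ Nat.card (MulAction.stabilizer G x) = 5) := by
  classical
  have := Fintype.ofFinite G
  have := Fintype.ofFinite X
  let Ω := MulAction.orbitRel.Quotient G X
  -- Points of one orbit have stabilizers of equal order, so information about chosen orbit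
  -- representatives extends to all points.
  have hstab (x : X) : Nat.card (MulAction.stabilizer G x) =
      Nat.card (MulAction.stabilizer G (Quotient.mk'' x : Ω).out) :=
    Nat.card_congr (MulAction.stabilizerEquivStabilizerOfOrbitRel
      ((MulAction.orbitRel G X).symm (Quotient.mk_out x))).toEquiv
  have hall {p : ℕ → Prop} (h : ∀ ω : Ω, p (Nat.card (MulAction.stabilizer G ω.out))) (x : X) :
      p (Nat.card (MulAction.stabilizer G x)) := hstab x ▸ h _
  have hburn := MulAction.sum_card_fixedBy_eq_card_orbits_mul_card_group G X
  have hfix : ∑ g : G, Fintype.card (MulAction.fixedBy X g) =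
      Fintype.card X + 2 * (Nat.card G - 1) := by
    rw [← Finset.add_sum_erase _ _ (Finset.mem_univ (1 : G))]
    congr 1
    · exact Fintype.card_congr ((Equiv.setCongr (by ext; simp)).trans (Equiv.Set.univ X))
    · rw [Finset.sum_congr rfl (g := fun _ => 2) fun g hg => by
        rw [← Nat.card_eq_fintype_card, h2 g (Finset.ne_of_mem_erase hg)]]
      rw [Finset.sum_const, Finset.card_erase_of_mem (Finset.mem_univ _), Finset.card_univ,
        Nat.card_eq_fintype_card, smul_eq_mul, mul_comm]
  have horb : Fintype.card X = ∑ ω : Ω, Nat.card (MulAction.orbit G ω.out) := by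
    rw [Fintype.card_congr (MulAction.selfEquivSigmaOrbits G X), Fintype.card_sigma]
    exact Finset.sum_congr rfl fun ω _ => Nat.card_eq_fintype_card.symm
  rw [hfix, horb, ← Nat.card_eq_fintype_card (α := G)] at hburn
  rcases card_classification (fun ω : Ω => Nat.card (MulAction.orbit G ω.out))
    (fun ω : Ω => Nat.card (MulAction.stabilizer G ω.out)) hN
    (fun ω => by
      simp only [Nat.card_eq_fintype_card]
      exact MulAction.card_orbit_mul_card_stabilizer_eq_card_group G ω.out)
    (fun ω => Subgroup.one_lt_card_iff_ne_bot _ |>.mpr (hs _)) hburn with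
    ⟨ω, h⟩ | ⟨ω, h⟩ | ⟨h, h'⟩ | ⟨h, h'⟩ | ⟨h, h'⟩
  · exact Or.inl ⟨_, h⟩
  · exact Or.inr (Or.inl ⟨_, h⟩)
  · exact Or.inr (Or.inr (Or.inl ⟨h, hall (p := fun n => n = 2 ∨ n = 3) h'⟩))
  · exact Or.inr (Or.inr (Or.inr (Or.inl ⟨h, hall (p := fun n => n = 2 ∨ n = 3 ∨ n = 4) h'⟩)))
  · exact Or.inr (Or.inr (Or.inr (Or.inr ⟨h, hall (p := fun n => n = 2 ∨ n = 3 ∨ n = 5) h'⟩)))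

variable {k : Type u} [Field k] [IsAlgClosed k] [CharZero k]

/-- Finite groups of fractional linear transformations: rough classification. -/
theorem finite_subgroup_classification (H : Subgroup PGL(2, k)) [Finite H] :
    IsCyclic H ∨ (∃ g ∈ H, 2 * orderOf g = Nat.card H) ∨
      (Nat.card H = 12 ∧ ∀ g ∈ H, g ≠ 1 → orderOf g = 2 ∨ orderOf g = 3) ∨
      (Nat.card H = 24 ∧ ∀ g ∈ H, g ≠ 1 → orderOf g = 2 ∨ orderOf g = 3 ∨ orderOf g = 4) ∨
      (Nat.card H = 60 ∧ ∀ g ∈ H, g ≠ 1 → orderOf g = 2 ∨ orderOf g = 3 ∨ orderOf g = 5) := by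
  classical
  rcases Nat.lt_or_ge (Nat.card H) 2 with hN | hN
  · left
    have : Subsingleton H := (Nat.card_eq_one_iff_unique.mp
      (by have := Nat.card_pos (α := H); omega)).1
    infer_instance
  have hfix (g : H) (hg : g ≠ 1) : ∃ x y : OnePoint k, x ≠ y ∧
      ∀ z : OnePoint k, g • z = z ↔ z = x ∨ z = y :=
    exists_fixed_points (H.subtype.isOfFinOrder (isOfFinOrder_of_finite g))
      fun h => hg (Subtype.ext h)
  -- The set of points with nontrivial stabilizer: it is finite, stable under `H`, and contains both
  -- fixed points of every nontrivial element.
  let S : SubMulAction H (OnePoint k) :=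
    { carrier := {x | ∃ h : H, h ≠ 1 ∧ h • x = x}
      smul_mem' := by
        rintro g x ⟨h, hne, hx⟩
        refine ⟨g * h * g⁻¹, fun h1 => hne (conj_eq_one_iff.mp h1), ?_⟩
        rw [mul_smul, mul_smul, inv_smul_smul, hx] }
  have hmem (g : H) (hg : g ≠ 1) (x : OnePoint k) (hx : g • x = x) : x ∈ S := ⟨g, hg, hx⟩
  have hSfin : (S : Set (OnePoint k)).Finite := by
    have : (⋃ g : {g : H // g ≠ 1}, {x : OnePoint k | g.1 • x = x}).Finite := by
      refine Set.finite_iUnion fun g => ?_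
      obtain ⟨x, y, -, h⟩ := hfix g.1 g.2
      exact (Set.toFinite {x, y}).subset fun z hz => (h z).mp hz
    refine this.subset ?_
    rintro x ⟨h, hne, hx⟩
    exact Set.mem_iUnion.mpr ⟨⟨h, hne⟩, hx⟩
  have : Finite S := hSfin
  have hcyc (x : S) : IsCyclic (MulAction.stabilizer H x) := by
    let K : Subgroup PGL(2, k) := (MulAction.stabilizer H x).map H.subtype
    let e : MulAction.stabilizer H x ≃* K :=
      (MulAction.stabilizer H x).equivMapOfInjective H.subtype H.subtype_injective
    have : Finite K := Finite.of_equiv _ e.toEquiv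
    have hK : IsCyclic K := by
      refine isCyclic_of_smul_eq K x.1 ?_
      rintro - ⟨g, hg, rfl⟩
      exact congrArg Subtype.val hg
    exact e.isCyclic.mpr hK
  have hord (g : H) (hg : g ≠ 1) : ∃ x : S, orderOf g.1 ∣ Nat.card (MulAction.stabilizer H x) := by
    obtain ⟨x, y, -, h⟩ := hfix g hg
    have hx : g • x = x := (h x).mpr (Or.inl rfl)
    refine ⟨⟨x, hmem g hg x hx⟩, ?_⟩
    rw [Subgroup.orderOf_coe]
    exact Subgroup.orderOf_dvd_natCard _ (MulAction.mem_stabilizer_iff.mpr (Subtype.ext hx))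
  have hdvd {p : ℕ → Prop} (hp : ∀ x : S, p (Nat.card (MulAction.stabilizer H x))) (g : PGL(2, k))
      (hg : g ∈ H) (hne : g ≠ 1) : ∃ n, p n ∧ orderOf g ∣ n := by
    obtain ⟨x, hx⟩ := hord ⟨g, hg⟩ fun h => hne (congrArg Subtype.val h)
    exact ⟨_, hp x, hx⟩
  have hone (g : PGL(2, k)) (hne : g ≠ 1) : orderOf g ≠ 1 := fun h => hne (orderOf_eq_one_iff.mp h)
  have d2 {n : ℕ} (h : n ∣ 2) : n = 1 ∨ n = 2 := (Nat.dvd_prime Nat.prime_two).mp h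
  have d3 {n : ℕ} (h : n ∣ 3) : n = 1 ∨ n = 3 := (Nat.dvd_prime Nat.prime_three).mp h
  have d5 {n : ℕ} (h : n ∣ 5) : n = 1 ∨ n = 5 := (Nat.dvd_prime Nat.prime_five).mp h
  have d4 {n : ℕ} (h : n ∣ 4) : n = 1 ∨ n = 2 ∨ n = 4 := by
    have := Nat.le_of_dvd (by norm_num) h
    interval_cases n <;> omega
  rcases card_stabilizer_classification (G := H) (X := S) (fun g hg => by
      obtain ⟨x, y, hxy, h⟩ := hfix g hg
      have hx : g • x = x := (h x).mpr (Or.inl rfl)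
      have hy : g • y = y := (h y).mpr (Or.inr rfl)
      rw [show MulAction.fixedBy S g = {⟨x, hmem g hg x hx⟩, ⟨y, hmem g hg y hy⟩} by
        ext z
        rw [MulAction.mem_fixedBy, Set.mem_insert_iff, Set.mem_singleton_iff, Subtype.ext_iff,
          Subtype.ext_iff, Subtype.ext_iff]
        exact h z.1]
      exact Set.ncard_pair fun h => hxy (congrArg Subtype.val h))
    (fun x => by
      obtain ⟨h, hne, hx⟩ := x.2
      intro hbot
      have : h ∈ MulAction.stabilizer H x := Subtype.ext hx
      rw [hbot] at this
      exact hne this) hN with ⟨x, h⟩ | ⟨x, h⟩ | ⟨h, h'⟩ | ⟨h, h'⟩ | ⟨h, h'⟩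
  · left
    have htop := Subgroup.eq_top_of_card_eq _ h
    have := hcyc x
    rw [htop] at this
    exact Subgroup.topEquiv.isCyclic.mp this
  -- A cyclic stabilizer of index two has a generator whose order is half that of the group.
  · right; left
    have := hcyc x
    obtain ⟨g, hg⟩ := IsCyclic.exists_ofOrder_eq_natCard (α := MulAction.stabilizer H x)
    exact ⟨g.1.1, g.1.2, by rw [Subgroup.orderOf_coe, Subgroup.orderOf_coe, hg, h]⟩
  · refine Or.inr (Or.inr (Or.inl ⟨h, fun g hg hne => ?_⟩))
    have h1 := hone g hne
    obtain ⟨n, rfl | rfl, hn⟩ := hdvd (p := fun n => n = 2 ∨ n = 3) h' g hg hne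
    · have := d2 hn; omega
    · have := d3 hn; omega
  · refine Or.inr (Or.inr (Or.inr (Or.inl ⟨h, fun g hg hne => ?_⟩)))
    have h1 := hone g hne
    obtain ⟨n, rfl | rfl | rfl, hn⟩ := hdvd (p := fun n => n = 2 ∨ n = 3 ∨ n = 4) h' g hg hne
    · have := d2 hn; omega
    · have := d3 hn; omega
    · have := d4 hn; omega
  · refine Or.inr (Or.inr (Or.inr (Or.inr ⟨h, fun g hg hne => ?_⟩)))
    have h1 := hone g hne
    obtain ⟨n, rfl | rfl | rfl, hn⟩ := hdvd (p := fun n => n = 2 ∨ n = 3 ∨ n = 5) h' g hg hne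
    · have := d2 hn; omega
    · have := d3 hn; omega
    · have := d5 hn; omega

end Matrix.ProjGenLinGroup

/-! ### Conjugation to a standard subgroup: cyclic and dihedral groups -/

namespace Subgroup

variable {P : Type*} [Group P]

/-- Some conjugate of the subgroup has the given underlying set. -/
def IsConjTo (H : Subgroup P) (S : Set P) : Prop :=
  ∃ c : P, (H.map (MulAut.conj c).toMonoidHom : Set P) = S

theorem map_conj_map_conj (H : Subgroup P) (c d : P) :
    (H.map (MulAut.conj c).toMonoidHom).map (MulAut.conj d).toMonoidHom =
      H.map (MulAut.conj (d * c)).toMonoidHom := by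
  rw [Subgroup.map_map, map_mul]
  rfl

theorem IsConjTo.of_map {H : Subgroup P} {S : Set P} {c : P}
    (h : (H.map (MulAut.conj c).toMonoidHom).IsConjTo S) : H.IsConjTo S := by
  obtain ⟨d, hd⟩ := h
  exact ⟨d * c, by rw [← map_conj_map_conj, hd]⟩

theorem IsConjTo.exists_conj {H₁ H₂ : Subgroup P} {S : Set P} (h₁ : H₁.IsConjTo S)
    (h₂ : H₂.IsConjTo S) : ∃ c : P, H₂ = H₁.map (MulAut.conj c).toMonoidHom := by
  obtain ⟨c, hc⟩ := h₁
  obtain ⟨d, hd⟩ := h₂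
  refine ⟨d⁻¹ * c, ?_⟩
  rw [← map_conj_map_conj, SetLike.coe_injective (hc.trans hd.symm), map_conj_map_conj,
    inv_mul_cancel, map_one]
  exact (Subgroup.map_id H₂).symm

theorem conj_mem_map {H : Subgroup P} {g : P} (hg : g ∈ H) (c : P) :
    MulAut.conj c g ∈ H.map (MulAut.conj c).toMonoidHom := ⟨g, hg, rfl⟩

/-- A subgroup is isomorphic to its conjugates. -/
noncomputable def equivMapConj (H : Subgroup P) (c : P) :
    H ≃* H.map (MulAut.conj c).toMonoidHom :=
  H.equivMapOfInjective _ (MulAut.conj c).injective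

instance finite_map_conj (H : Subgroup P) [Finite H] (c : P) :
    Finite (H.map (MulAut.conj c).toMonoidHom) :=
  Finite.of_equiv _ (H.equivMapConj c).toEquiv

theorem card_map_conj (H : Subgroup P) (c : P) :
    Nat.card (H.map (MulAut.conj c).toMonoidHom) = Nat.card H :=
  (Nat.card_congr (H.equivMapConj c).toEquiv).symm

end Subgroup

namespace Matrix.ProjGenLinGroup

variable {k : Type u} [Field k]

theorem pow_eq_one_iff_mem_zpowers_of_orderOf {n : ℕ} (hn : 0 < n) {a : kˣ} (ha : orderOf a = n) {b : kˣ} :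
    b ^ n = 1 ↔ b ∈ Subgroup.zpowers a := by
  have : NeZero n := ⟨hn.ne'⟩
  have h1 : IsPrimitiveRoot a n := ha ▸ IsPrimitiveRoot.orderOf a
  rw [h1.zpowers_eq, mem_rootsOfUnity]

/-- A generator becomes a homothety by a primitive root of unity, whose powers are all the roots of
unity of that order; the resulting subgroup depends on the order alone. -/
theorem isConjTo_of_isCyclic [IsAlgClosed k] [CharZero k] (H : Subgroup PGL(2, k)) [Finite H]
    (h : IsCyclic H) : H.IsConjTo {g | ∃ a : kˣ, a ^ Nat.card H = 1 ∧ g = diag a} := by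
  obtain ⟨g, hg⟩ := IsCyclic.exists_zpow_surjective (G := H)
  have hgen : Subgroup.zpowers g.1 = H := by
    refine le_antisymm (Subgroup.zpowers_le.mpr g.2) fun x hx => ?_
    obtain ⟨n, hn⟩ := hg ⟨x, hx⟩
    exact ⟨n, congrArg Subtype.val hn⟩
  have hord : orderOf g.1 = Nat.card H := by rw [← Nat.card_zpowers, hgen]
  obtain ⟨c, a, hc, ha⟩ := exists_conj_eq_diag_of_orderOf Nat.card_pos hord
  refine ⟨c, ?_⟩
  have hmap : H.map (MulAut.conj c).toMonoidHom = (Subgroup.zpowers a).map diag := by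
    rw [MonoidHom.map_zpowers, ← hc]
    exact (congrArg _ hgen.symm).trans (MonoidHom.map_zpowers _ _)
  rw [hmap]
  ext x
  simp only [Subgroup.coe_map, Set.mem_image, SetLike.mem_coe, Set.mem_ofPred_eq,
    pow_eq_one_iff_mem_zpowers_of_orderOf Nat.card_pos ha]
  exact exists_congr fun b => and_congr_right fun _ => eq_comm

/-- The inversion of the projective line. -/
def inversion : PGL(2, k) := mat 0 1 1 0 (by simp)

theorem inversion_mul_self : (inversion : PGL(2, k)) * inversion = 1 := by
  rw [inversion, mat_mul, mat_eq_one_iff]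
  simp

/-- A transformation carrying one nontrivial homothety to another preserves the pair of fixed points
`{0, ∞}`, hence fixes both or swaps them. -/
theorem diag_or_antidiag {a b : kˣ} (ha : a ≠ 1) {g : PGL(2, k)} (h : g * diag a = diag b * g) :
    (∃ x : kˣ, g = diag x) ∨ ∃ q r h, g = mat 0 q r 0 h := by
  obtain ⟨p, q, r, s, hd, rfl⟩ := exists_eq_mat g
  have ha' : (a : k) ≠ 1 := fun h => ha (Units.val_eq_one.mp h)
  rw [diag_apply, diag_apply, mat_mul, mat_mul, mat_eq_mat_iff] at h
  obtain ⟨l, hl, h1, h2, h3, h4⟩ := h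
  simp only [mul_zero, zero_mul, mul_one, one_mul, add_zero, zero_add] at h1 h2 h3 h4
  by_cases hs : s = 0
  · right
    subst hs
    have hqr : q * r ≠ 0 := by simpa using hd
    have hq := left_ne_zero_of_mul hqr
    have hr := right_ne_zero_of_mul hqr
    have hp : p = 0 := by
      by_contra hp
      have e1 : (b : k) = l := mul_right_cancel₀ hq h2
      have e2 : l * a = 1 := mul_right_cancel₀ hr (by linear_combination -h3)
      have e3 : (b : k) = 1 := mul_right_cancel₀ hp (by linear_combination h1 + p * e2)
      exact ha' (by rw [← e1, e3, one_mul] at e2; exact e2)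
    subst hp
    exact ⟨q, r, hd, rfl⟩
  · left
    have hl1 : l = 1 := mul_right_cancel₀ hs (by linear_combination -h4)
    subst hl1
    have hr : r = 0 := by
      by_contra hr
      exact ha' (mul_right_cancel₀ hr (by linear_combination -h3))
    subst hr
    have hp : p ≠ 0 := by rintro rfl; simp at hd
    have hq : q = 0 := by
      by_contra hq
      have e1 : (b : k) = 1 := mul_right_cancel₀ hq (by linear_combination h2)
      exact ha' (mul_right_cancel₀ hp (by linear_combination -h1 + p * e1))
    subst hq
    exact ⟨_, mat_eq_diag (by simpa using hd) hp hs⟩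

theorem exists_conj_antidiag_eq_inversion [IsAlgClosed k] {q r : k} (h : 0 * 0 - q * r ≠ 0) :
    ∃ x : kˣ, MulAut.conj (diag x) (mat 0 q r 0 h) = inversion := by
  have hqr : q * r ≠ 0 := by simpa using h
  have hq := left_ne_zero_of_mul hqr
  have hr := right_ne_zero_of_mul hqr
  obtain ⟨x, hx⟩ := IsAlgClosed.exists_pow_nat_eq (r / q) (n := 2) (by norm_num)
  have hx0 : x ≠ 0 := by
    rintro rfl
    exact div_ne_zero hr hq (by rw [← hx]; simp)
  refine ⟨Units.mk0 x hx0, ?_⟩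
  rw [MulAut.conj_apply, diag_apply, inversion, mat_inv, mat_mul, mat_mul, eq_comm, mat_eq_mat_iff]
  rw [eq_div_iff hq] at hx
  exact ⟨r, hr, by simp, by simp; linear_combination hx, by simp, by simp⟩

theorem not_antidiag_eq_diag {q r : k} (h : 0 * 0 - q * r ≠ 0) (a : kˣ) :
    mat 0 q r 0 h ≠ diag a := by
  rw [diag_apply, Ne, mat_eq_mat_iff]
  rintro ⟨l, -, h, -⟩
  exact a.ne_zero (h.trans (mul_zero l))

/-- The cyclic subgroup of index two is normal and may be taken diagonal, so every element of the
group is diagonal or antidiagonal. An antidiagonal one exists, and a diagonal conjugation, which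
does not disturb the cyclic part, turns it into `inversion`. -/
theorem isConjTo_dihedral [IsAlgClosed k] [CharZero k] (H : Subgroup PGL(2, k)) [Finite H]
    (hcyc : ¬ IsCyclic H) {m : ℕ} (hm : 2 * m = Nat.card H) (h : ∃ g ∈ H, orderOf g = m) :
    H.IsConjTo {g | ∃ a : kˣ, a ^ m = 1 ∧ (g = diag a ∨ g = diag a * inversion)} := by
  classical
  have hpos : 0 < m := by have := Nat.card_pos (α := H); omega
  have hm1 : m ≠ 1 := by
    rintro rfl
    have : Fact (Nat.Prime 2) := ⟨Nat.prime_two⟩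
    exact hcyc (isCyclic_of_prime_card (p := 2) (by omega))
  obtain ⟨g, hg, hgm⟩ := h
  obtain ⟨c, a, hc, ha⟩ := exists_conj_eq_diag_of_orderOf hpos hgm
  apply Subgroup.IsConjTo.of_map (c := c)
  have hcard := H.card_map_conj c
  have haH : diag a ∈ H.map (MulAut.conj c).toMonoidHom := hc ▸ Subgroup.conj_mem_map hg c
  have hcyc' : ¬ IsCyclic (H.map (MulAut.conj c).toMonoidHom) :=
    fun h => hcyc ((H.equivMapConj c).isCyclic.mpr h)
  rw [← hcard] at hm
  have hfin := H.finite_map_conj c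
  clear hcard hcyc hc hg hgm
  generalize H.map (MulAut.conj c).toMonoidHom = H at *
  have ha1 : a ≠ 1 := by rintro rfl; rw [orderOf_one] at ha; exact hm1 ha.symm
  have hC : (Subgroup.zpowers (⟨diag a, haH⟩ : H)).index = 2 := by
    have h1 := Subgroup.card_mul_index (Subgroup.zpowers (⟨diag a, haH⟩ : H))
    rw [Nat.card_zpowers, ← Subgroup.orderOf_coe, orderOf_diag, ha, ← hm, mul_comm] at h1
    exact Nat.eq_of_mul_eq_mul_right hpos h1
  have hnorm := Subgroup.normal_of_index_eq_two hC
  have hmemC (x : H) (hx : x ∈ Subgroup.zpowers (⟨diag a, haH⟩ : H)) :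
      ∃ b : kˣ, b ^ m = 1 ∧ x.1 = diag b := by
    obtain ⟨n, rfl⟩ := hx
    refine ⟨a ^ n, (pow_eq_one_iff_mem_zpowers_of_orderOf hpos ha).mpr ⟨n, rfl⟩, ?_⟩
    rw [map_zpow]
    rfl
  have hdich (x : H) : (∃ y : kˣ, x.1 = diag y) ∨ ∃ q r h, x.1 = mat 0 q r 0 h := by
    obtain ⟨b, -, hb⟩ := hmemC _ (hnorm.conj_mem _ (Subgroup.mem_zpowers _) x)
    refine diag_or_antidiag ha1 (b := b) ?_
    rw [← hb]
    simp
  -- If every element were diagonal, the group would fix `∞` and be cyclic.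
  obtain ⟨x, q, r, hqr, hx⟩ : ∃ x : H, ∃ q r h, x.1 = mat 0 q r 0 h := by
    by_contra! hno
    refine hcyc' (isCyclic_of_smul_eq H OnePoint.infty fun g hg => ?_)
    obtain ⟨y, hy⟩ := (hdich ⟨g, hg⟩).resolve_right (by push Not; exact hno ⟨g, hg⟩)
    change g = _ at hy
    rw [hy, diag_apply, mat_smul_infty, if_pos rfl]
  obtain ⟨d, hd⟩ := exists_conj_antidiag_eq_inversion hqr
  have hxC : x ∉ Subgroup.zpowers (⟨diag a, haH⟩ : H) := fun h => by
    obtain ⟨b, -, hb⟩ := hmemC x h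
    exact not_antidiag_eq_diag hqr b (hx ▸ hb)
  have hconj (b : kˣ) : MulAut.conj (diag d) (diag b) = diag b := by
    rw [MulAut.conj_apply, ← map_mul, mul_comm, map_mul, mul_inv_cancel_right]
  have hinv : (mat 0 q r 0 hqr)⁻¹ = mat 0 q r 0 hqr := by
    apply (MulAut.conj (diag d)).injective
    rw [map_inv, hd, inv_eq_iff_mul_eq_one, inversion_mul_self]
  refine ⟨diag d, ?_⟩
  ext g
  constructor
  · rintro ⟨y, hy, rfl⟩
    change ∃ b : kˣ, _ ∧ (MulAut.conj (diag d) y = _ ∨ MulAut.conj (diag d) y = _)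
    by_cases hyC : (⟨y, hy⟩ : H) ∈ Subgroup.zpowers (⟨diag a, haH⟩ : H)
    · obtain ⟨b, hb, hyb⟩ := hmemC _ hyC
      change y = _ at hyb
      exact ⟨b, hb, Or.inl (by rw [hyb, hconj])⟩
    -- Two elements outside a subgroup of index two have their product inside it; since `x` is an
    -- involution, `y` is a diagonal element times `x`.
    · obtain ⟨b, hb, hyb⟩ := hmemC (⟨y, hy⟩ * x) ((Subgroup.mul_mem_iff_of_index_two hC).mpr
        (iff_of_false hyC hxC))
      change y * x.1 = _ at hyb
      refine ⟨b, hb, Or.inr ?_⟩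
      rw [← hconj b, ← hyb, ← hd, ← map_mul, ← hx, mul_assoc,
        show x.1 * x.1 = 1 by rw [hx]; exact inv_eq_iff_mul_eq_one.mp hinv, mul_one]
  · have hdiag (b : kˣ) (hb : b ^ m = 1) : diag b ∈ H := by
      obtain ⟨n, hn⟩ := (pow_eq_one_iff_mem_zpowers_of_orderOf hpos ha).mp hb
      rw [← hn]
      change diag (a ^ n) ∈ H
      rw [map_zpow]
      exact zpow_mem haH n
    rintro ⟨b, hb, rfl | rfl⟩
    · exact ⟨diag b, hdiag b hb, hconj b⟩
    · refine ⟨diag b * mat 0 q r 0 hqr, mul_mem (hdiag b hb) (hx ▸ x.2), ?_⟩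
      change MulAut.conj (diag d) _ = _
      rw [map_mul, hconj, hd]

end Matrix.ProjGenLinGroup

/-! ### Klein four-groups -/

/-- Two commuting involutions generating a Klein four-group. -/
structure IsKleinPair {P : Type*} [Group P] (s t : P) : Prop where
  left_ne_one : s ≠ 1
  right_ne_one : t ≠ 1
  ne : s ≠ t
  left_mul_self : s * s = 1
  right_mul_self : t * t = 1
  comm : s * t = t * s

namespace IsKleinPair

variable {P : Type*} [Group P] {s t : P}

theorem map {Q : Type*} [Group Q] (h : IsKleinPair s t) (f : P →* Q) (hf : Function.Injective f) :
    IsKleinPair (f s) (f t) :=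
  ⟨fun e => h.left_ne_one (hf (e.trans (map_one f).symm)),
    fun e => h.right_ne_one (hf (e.trans (map_one f).symm)), fun e => h.ne (hf e),
    by rw [← map_mul, h.left_mul_self, map_one], by rw [← map_mul, h.right_mul_self, map_one],
    by rw [← map_mul, h.comm, map_mul]⟩

/-- The Klein four-group generated by a pair of commuting involutions. -/
def group (h : IsKleinPair s t) : Subgroup P where
  carrier := {1, s, t, s * t}
  one_mem' := Or.inl rfl
  mul_mem' := by
    have h1 := h.left_mul_self
    have h2 := h.right_mul_self
    have h3 := h.comm.symm
    have h4 (x : P) : s * (s * x) = x := by rw [← mul_assoc, h1, one_mul]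
    have h6 (x : P) : t * (s * x) = s * (t * x) := by rw [← mul_assoc, h3, mul_assoc]
    rintro a b (rfl | rfl | rfl | rfl) (rfl | rfl | rfl | rfl) <;>
      simp [h1, h2, h3, h4, h6, mul_assoc]
  inv_mem' := by
    have h1 := inv_eq_of_mul_eq_one_left h.left_mul_self
    have h2 := inv_eq_of_mul_eq_one_left h.right_mul_self
    rintro a (rfl | rfl | rfl | rfl)
    · simp
    · simp [h1]
    · simp [h2]
    · rw [mul_inv_rev, h1, h2, ← h.comm]
      simp

theorem group_le (h : IsKleinPair s t) {K : Subgroup P} (hs : s ∈ K) (ht : t ∈ K) :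
    h.group ≤ K := by
  rintro x (rfl | rfl | rfl | rfl)
  exacts [one_mem K, hs, ht, mul_mem hs ht]

theorem mul_ne_one (h : IsKleinPair s t) : s * t ≠ 1 := fun e =>
  h.ne ((eq_inv_of_mul_eq_one_left e).trans (inv_eq_of_mul_eq_one_left h.right_mul_self))

theorem mul_self (h : IsKleinPair s t) {x : P} (hx : x ∈ h.group) : x * x = 1 := by
  rcases hx with rfl | rfl | rfl | rfl
  · exact one_mul 1
  · exact h.left_mul_self
  · exact h.right_mul_self
  · rw [mul_assoc, ← mul_assoc t, ← h.comm, mul_assoc, h.right_mul_self, mul_one, h.left_mul_self]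

theorem card_group (h : IsKleinPair s t) : Nat.card h.group = 4 := by
  classical
  have h1 : (h.group : Set P) = (({1, s, t, s * t} : Finset P) : Set P) := by
    simp only [Finset.coe_insert, Finset.coe_singleton]
    rfl
  have h2 : Nat.card h.group = Set.ncard (h.group : Set P) := rfl
  rw [h2, h1, Set.ncard_coe_finset]
  have := h.left_ne_one.symm
  have := h.right_ne_one.symm
  have := h.mul_ne_one.symm
  have := h.ne
  rw [Finset.card_insert_of_notMem, Finset.card_insert_of_notMem, Finset.card_insert_of_notMem,
    Finset.card_singleton]
  · simp [h.left_ne_one]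
  · simp [h.ne, h.right_ne_one]
  · simp [*]

theorem four_dvd_card (h : IsKleinPair s t) {K : Subgroup P} (hs : s ∈ K) (ht : t ∈ K) :
    4 ∣ Nat.card K :=
  h.card_group ▸ Subgroup.card_dvd_of_le (h.group_le hs ht)

theorem of_mul_self {K : Subgroup P} (hK : ∀ x ∈ K, x * x = 1) (hs : s ∈ K) (ht : t ∈ K)
    (hs1 : s ≠ 1) (ht1 : t ≠ 1) (hne : s ≠ t) : IsKleinPair s t := by
  refine ⟨hs1, ht1, hne, hK s hs, hK t ht, ?_⟩
  have h := hK _ (mul_mem hs ht)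
  rw [← inv_eq_iff_mul_eq_one, mul_inv_rev, inv_eq_of_mul_eq_one_left (hK s hs),
    inv_eq_of_mul_eq_one_left (hK t ht)] at h
  exact h.symm

/-- Any three elements of a coset of a Klein four-group give a pair of generators. -/
theorem of_coset (h : IsKleinPair s t) {x v₀ v₁ v₂ : P} (h₀ : v₀ ∈ h.group) (h₁ : v₁ ∈ h.group)
    (h₂ : v₂ ∈ h.group) (h01 : v₀ ≠ v₁) (h02 : v₀ ≠ v₂) (h12 : v₁ ≠ v₂) :
    IsKleinPair ((x * v₀)⁻¹ * (x * v₁)) ((x * v₀)⁻¹ * (x * v₂)) := by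
  have e (v : P) : (x * v₀)⁻¹ * (x * v) = v₀⁻¹ * v := by group
  rw [e, e]
  refine of_mul_self (K := h.group) (fun x hx => h.mul_self hx) (mul_mem (inv_mem h₀) h₁)
    (mul_mem (inv_mem h₀) h₂) ?_ ?_ ?_
  · exact fun h => h01 (inv_mul_eq_one.mp h)
  · exact fun h => h02 (inv_mul_eq_one.mp h)
  · exact fun h => h12 (mul_left_cancel h)

end IsKleinPair

/-- Sylow's theorem supplies a subgroup of order four, and the hypothesis on fourth powers makes it
of exponent two rather than cyclic. -/
theorem Subgroup.exists_isKleinPair {P : Type*} [Group P] (H : Subgroup P) [Finite H]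
    (h4 : 4 ∣ Nat.card H) (hH : ∀ g ∈ H, g ^ 4 = 1 → g * g = 1) :
    ∃ s ∈ H, ∃ t ∈ H, IsKleinPair s t := by
  have : Fact (Nat.Prime 2) := ⟨Nat.prime_two⟩
  obtain ⟨K, hK⟩ := Sylow.exists_subgroup_card_pow_prime (G := H) 2 (n := 2) h4
  have hsq (x : H) (hx : x ∈ K) : x * x = 1 := by
    refine Subtype.ext (hH x.1 x.2 ?_)
    have : (⟨x, hx⟩ : K) ^ 4 = 1 := by
      have := pow_card_eq_one' (x := (⟨x, hx⟩ : K))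
      rwa [hK] at this
    exact congrArg (fun y : K => ((y : H) : P)) this
  have hK' : (K : Set H).ncard = 4 := hK
  obtain ⟨s, hs, hs1⟩ : ∃ s ∈ (K : Set H), s ≠ 1 := Set.exists_ne_of_one_lt_ncard (by omega) 1
  obtain ⟨t, ht, ht1⟩ : ∃ t ∈ (K : Set H), t ∉ ({1, s} : Set H) :=
    Set.exists_mem_notMem_of_ncard_lt_ncard
      (lt_of_le_of_lt (Set.ncard_insert_le _ _) (by rw [Set.ncard_singleton, hK']; norm_num))
  rw [Set.mem_insert_iff, Set.mem_singleton_iff, not_or] at ht1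
  exact ⟨s, s.2, t, t.2, (IsKleinPair.of_mul_self hsq hs ht hs1 ht1.1 (Ne.symm ht1.2)).map
    H.subtype H.subtype_injective⟩

/-! ### The invariant `tau` on a coset of a Klein four-group -/

namespace Matrix.ProjGenLinGroup

variable {k : Type u} [Field k]

theorem diag_neg_one : diag (-1 : kˣ) = mat (-1 : k) 0 0 1 (by simp) := rfl

theorem diag_neg_one_mul_self : diag (-1 : kˣ) * diag (-1) = 1 := by
  rw [← map_mul, neg_mul_neg, one_mul, map_one]

theorem tau_mat_mul_diag_neg_one {p q r s : k} (h : p * s - q * r ≠ 0) :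
    tau (mat p q r s h * diag (-1)) = -(p - s) ^ 2 / (p * s - q * r) := by
  have h' : -(p * s - q * r) ≠ 0 := neg_ne_zero.mpr h
  rw [diag_neg_one, mat_mul, tau_mat, neg_div, ← div_neg]
  congr 1 <;> ring

theorem tau_mat_mul_inversion {p q r s : k} (h : p * s - q * r ≠ 0) :
    tau (mat p q r s h * inversion) = -(q + r) ^ 2 / (p * s - q * r) := by
  rw [inversion, mat_mul, tau_mat, neg_div, ← div_neg]
  congr 1 <;> ring

theorem tau_mat_mul_diag_mul_inversion {p q r s : k} (h : p * s - q * r ≠ 0) :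
    tau (mat p q r s h * (diag (-1) * inversion)) = (r - q) ^ 2 / (p * s - q * r) := by
  rw [diag_neg_one, inversion, mat_mul, mat_mul, tau_mat]
  congr 1 <;> ring

variable [CharZero k]

theorem neg_one_ne_one_units : (-1 : kˣ) ≠ 1 := fun h => by
  have := congrArg Units.val h
  norm_num at this

theorem isKleinPair_diag_mul_inversion {a : kˣ} :
    IsKleinPair (diag (-1 : kˣ)) (diag a * inversion) := by
  have hne (b : kˣ) : diag a * inversion ≠ diag b := by
    rw [diag_apply, inversion, mat_mul]
    exact fun h => not_antidiag_eq_diag (q := (a : k)) (r := 1) (by simp) b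
      ((mat_congr (by simp) (by simp) (by simp) (by simp)).trans h)
  refine ⟨?_, ?_, (hne _).symm, diag_neg_one_mul_self, ?_, ?_⟩
  · rw [← map_one diag]
    exact diag_injective.ne neg_one_ne_one_units
  · rw [← map_one diag]
    exact hne 1
  · rw [diag_apply, inversion, mat_mul, mat_mul, mat_eq_one_iff]
    simp
  · rw [diag_apply, diag_apply, inversion, mat_mul, mat_mul, mat_mul, mat_eq_mat_iff]
    exact ⟨-1, by simp, by simp, by simp, by simp, by simp⟩

theorem isKleinPair_diag_inversion : IsKleinPair (diag (-1 : kˣ)) inversion := by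
  have := isKleinPair_diag_mul_inversion (a := (1 : kˣ))
  rwa [map_one, one_mul] at this

/-- After `s` becomes `diag (-1)`, its commuting partner is diagonal or antidiagonal. A diagonal
involution would equal `s`, so it is antidiagonal, and a diagonal conjugation carries it to
`inversion` while fixing `diag (-1)`. -/
theorem _root_.IsKleinPair.exists_conj [IsAlgClosed k] {s t : PGL(2, k)} (h : IsKleinPair s t) :
    ∃ c : PGL(2, k), MulAut.conj c s = diag (-1) ∧ MulAut.conj c t = inversion := by
  have hs : orderOf s = 2 := orderOf_eq_prime (by rw [sq, h.left_mul_self]) h.left_ne_one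
  obtain ⟨c, a, hc, ha⟩ := exists_conj_eq_diag_of_orderOf two_pos hs
  have sq_units (b : kˣ) (hb : b ^ 2 = 1) : b = 1 ∨ b = -1 := by
    have : ((b : k) - 1) * (b + 1) = 0 := by
      have hb' : (b : k) ^ 2 = 1 := by rw [← Units.val_pow_eq_pow_val, hb]; rfl
      linear_combination hb'
    rcases mul_eq_zero.mp this with h | h
    · exact Or.inl (Units.ext (sub_eq_zero.mp h))
    · exact Or.inr (Units.ext (eq_neg_of_add_eq_zero_left h))
  have ha1 : a = -1 := by
    refine (sq_units a (ha ▸ pow_orderOf_eq_one a)).resolve_left ?_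
    rintro rfl
    rw [orderOf_one] at ha
    omega
  subst ha1
  have hk := h.map (MulAut.conj c).toMonoidHom (MulAut.conj c).injective
  change IsKleinPair (MulAut.conj c s) (MulAut.conj c t) at hk
  rw [hc] at hk
  rcases diag_or_antidiag neg_one_ne_one_units hk.comm.symm with ⟨x, hx⟩ | ⟨q, r, hqr, hx⟩
  · exfalso
    have h1 := hk.right_mul_self
    rw [hx, ← map_mul, ← sq, ← map_one diag] at h1
    rcases sq_units x (diag_injective h1) with rfl | rfl
    · exact hk.right_ne_one (hx.trans (map_one _))
    · exact hk.ne hx.symm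
  · obtain ⟨d, hd⟩ := exists_conj_antidiag_eq_inversion hqr
    refine ⟨diag d * c, ?_, ?_⟩
    · rw [map_mul, MulAut.mul_apply, hc, MulAut.conj_apply, ← map_mul, mul_comm, map_mul,
        mul_inv_cancel_right]
    · rw [map_mul, MulAut.mul_apply, hx, hd]

/-- In standard position this is the identity `(p + s)² - (p - s)² - (q + r)² + (r - q)² = 4 (p s -
q r)`. -/
theorem sum_tau_eq_four [IsAlgClosed k] {s t : PGL(2, k)} (h : IsKleinPair s t) (x : PGL(2, k)) :
    tau x + tau (x * s) + tau (x * t) + tau (x * (s * t)) = 4 := by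
  obtain ⟨c, hs, ht⟩ := h.exists_conj
  rw [← tau_conj c, ← tau_conj c (x * s), ← tau_conj c (x * t), ← tau_conj c (x * (s * t))]
  simp only [map_mul, hs, ht]
  obtain ⟨p, q, r, s, hd, hx⟩ := exists_eq_mat (MulAut.conj c x)
  rw [hx, tau_mat, tau_mat_mul_diag_neg_one, tau_mat_mul_inversion, tau_mat_mul_diag_mul_inversion,
    ← add_div, ← add_div, ← add_div, div_eq_iff hd]
  ring

theorem conj_diag_neg_one_mat {p q r s : k} (h : p * s - q * r ≠ 0) :
    MulAut.conj (diag (-1)) (mat p q r s h) = mat p (-q) (-r) s (by rwa [neg_mul_neg]) := by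
  rw [MulAut.conj_apply, diag_neg_one, mat_inv, mat_mul, mat_mul, mat_eq_mat_iff]
  exact ⟨-1, by simp, by ring, by ring, by ring, by ring⟩

theorem conj_inversion_mat {p q r s : k} (h : p * s - q * r ≠ 0) :
    MulAut.conj inversion (mat p q r s h) = mat s r q p (by convert h using 1; ring) := by
  rw [MulAut.conj_apply, inversion, mat_inv, mat_mul, mat_mul, mat_eq_mat_iff]
  exact ⟨-1, by simp, by ring, by ring, by ring, by ring⟩

/-- In the coordinates `p + s`, `p - s`, `q + r`, `r - q`, conjugation by a nontrivial element of
the standard Klein group changes two of the last three signs, and passing to the inverse changes all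
three. Together they realize all eight sign patterns. -/
theorem exists_conj_of_entries {p q r s p' q' r' s' : k} (hx : p * s - q * r ≠ 0)
    (hy : p' * s' - q' * r' ≠ 0) (h1 : p' + s' = p + s) (h2 : (p' - s') ^ 2 = (p - s) ^ 2)
    (h3 : (q' + r') ^ 2 = (q + r) ^ 2) (h4 : (r' - q') ^ 2 = (r - q) ^ 2) :
    ∃ c : PGL(2, k), MulAut.conj c (diag (-1)) = diag (-1) ∧
      MulAut.conj c inversion = inversion ∧
      (MulAut.conj c (mat p q r s hx) = mat p' q' r' s' hy ∨
        MulAut.conj c (mat p q r s hx)⁻¹ = mat p' q' r' s' hy) := by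
  have hk := isKleinPair_diag_inversion (k := k)
  have self (g : PGL(2, k)) : MulAut.conj g g = g := by simp
  have hds : MulAut.conj (diag (-1 : kˣ)) inversion = inversion := by
    rw [MulAut.conj_apply, hk.comm, mul_inv_cancel_right]
  have hsd : MulAut.conj inversion (diag (-1 : kˣ)) = diag (-1) := by
    rw [MulAut.conj_apply, ← hk.comm, mul_inv_cancel_right]
  rcases sq_eq_sq_iff_eq_or_eq_neg.mp h2 with h2 | h2 <;>
  rcases sq_eq_sq_iff_eq_or_eq_neg.mp h3 with h3 | h3 <;>
  rcases sq_eq_sq_iff_eq_or_eq_neg.mp h4 with h4 | h4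
  · refine ⟨1, by simp, by simp, Or.inl ?_⟩
    rw [map_one, MulAut.one_apply]
    exact mat_congr (by linear_combination (h1 + h2) / 2) (by linear_combination (h3 - h4) / 2)
      (by linear_combination (h3 + h4) / 2) (by linear_combination (h1 - h2) / 2)
  · refine ⟨diag (-1) * inversion, by rw [map_mul, MulAut.mul_apply, hsd, self],
      by rw [map_mul, MulAut.mul_apply, self, hds], Or.inr ?_⟩
    rw [map_mul, MulAut.mul_apply, mat_inv, conj_inversion_mat, conj_diag_neg_one_mat]
    exact mat_congr (by linear_combination (h1 + h2) / 2) (by linear_combination (h3 - h4) / 2)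
      (by linear_combination (h3 + h4) / 2) (by linear_combination (h1 - h2) / 2)
  · refine ⟨inversion, hsd, self _, Or.inr ?_⟩
    rw [mat_inv, conj_inversion_mat]
    exact mat_congr (by linear_combination (h1 + h2) / 2) (by linear_combination (h3 - h4) / 2)
      (by linear_combination (h3 + h4) / 2) (by linear_combination (h1 - h2) / 2)
  · refine ⟨diag (-1), self _, hds, Or.inl ?_⟩
    rw [conj_diag_neg_one_mat]
    exact mat_congr (by linear_combination (h1 + h2) / 2) (by linear_combination (h3 - h4) / 2)
      (by linear_combination (h3 + h4) / 2) (by linear_combination (h1 - h2) / 2)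
  · refine ⟨diag (-1), self _, hds, Or.inr ?_⟩
    rw [mat_inv, conj_diag_neg_one_mat]
    exact mat_congr (by linear_combination (h1 + h2) / 2) (by linear_combination (h3 - h4) / 2)
      (by linear_combination (h3 + h4) / 2) (by linear_combination (h1 - h2) / 2)
  · refine ⟨inversion, hsd, self _, Or.inl ?_⟩
    rw [conj_inversion_mat]
    exact mat_congr (by linear_combination (h1 + h2) / 2) (by linear_combination (h3 - h4) / 2)
      (by linear_combination (h3 + h4) / 2) (by linear_combination (h1 - h2) / 2)
  · refine ⟨diag (-1) * inversion, by rw [map_mul, MulAut.mul_apply, hsd, self],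
      by rw [map_mul, MulAut.mul_apply, self, hds], Or.inl ?_⟩
    rw [map_mul, MulAut.mul_apply, conj_inversion_mat, conj_diag_neg_one_mat]
    exact mat_congr (by linear_combination (h1 + h2) / 2) (by linear_combination (h3 - h4) / 2)
      (by linear_combination (h3 + h4) / 2) (by linear_combination (h1 - h2) / 2)
  · refine ⟨1, by simp, by simp, Or.inr ?_⟩
    rw [map_one, MulAut.one_apply, mat_inv]
    exact mat_congr (by linear_combination (h1 + h2) / 2) (by linear_combination (h3 - h4) / 2)
      (by linear_combination (h3 + h4) / 2) (by linear_combination (h1 - h2) / 2)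

/-- An element of the projective linear group is determined, up to inversion and conjugation by an
element centralizing the standard Klein four-group, by its invariants on the coset. -/
theorem exists_conj_of_tau_eq [IsAlgClosed k] {x y : PGL(2, k)} (h0 : tau x = tau y)
    (hs : tau (x * diag (-1)) = tau (y * diag (-1)))
    (ht : tau (x * inversion) = tau (y * inversion)) :
    ∃ c : PGL(2, k), MulAut.conj c (diag (-1)) = diag (-1) ∧
      MulAut.conj c inversion = inversion ∧ (MulAut.conj c x = y ∨ MulAut.conj c x⁻¹ = y) := by
  have hst : tau (x * (diag (-1) * inversion)) = tau (y * (diag (-1) * inversion)) := by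
    have h1 := sum_tau_eq_four isKleinPair_diag_inversion x
    have h2 := sum_tau_eq_four isKleinPair_diag_inversion y
    rw [h0, hs, ht] at h1
    linear_combination h1 - h2
  obtain ⟨p, q, r, s, hx, rfl⟩ := exists_eq_mat x
  obtain ⟨p', q', r', s', hy, rfl⟩ := exists_eq_mat y
  -- Scaling the second matrix by `l` equates the determinants, so equal invariants become equal
  -- squares of entries. The sign of `l` is adjusted below, giving `e`, so that the traces agree
  -- exactly.
  obtain ⟨l, hl⟩ := IsAlgClosed.exists_pow_nat_eq ((p * s - q * r) / (p' * s' - q' * r'))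
    (n := 2) (by norm_num)
  have hl0 : l ≠ 0 := by
    rintro rfl
    exact div_ne_zero hx hy (by rw [← hl]; simp)
  rw [eq_div_iff hy] at hl
  have key {a b : k} (h : a / (p * s - q * r) = b / (p' * s' - q' * r')) : l ^ 2 * b = a := by
    rw [div_eq_div_iff hx hy] at h
    exact mul_right_cancel₀ hy (by linear_combination b * hl - h)
  rw [tau_mat, tau_mat] at h0
  rw [tau_mat_mul_diag_neg_one, tau_mat_mul_diag_neg_one] at hs
  rw [tau_mat_mul_inversion, tau_mat_mul_inversion] at ht
  rw [tau_mat_mul_diag_mul_inversion, tau_mat_mul_diag_mul_inversion] at hst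
  replace h0 := key h0
  replace hs := key hs
  replace ht := key ht
  replace hst := key hst
  obtain ⟨e, he0, he⟩ : ∃ e : k, e ^ 2 = l ^ 2 ∧ e * (p' + s') = p + s := by
    have : (l * (p' + s')) ^ 2 = (p + s) ^ 2 := by linear_combination h0
    rcases sq_eq_sq_iff_eq_or_eq_neg.mp this with h | h
    · exact ⟨l, rfl, h⟩
    · exact ⟨-l, by ring, by linear_combination -h⟩
  have hene : e ≠ 0 := by
    rintro rfl
    exact pow_ne_zero 2 hl0 (by rw [← he0]; simp)
  rw [mat_smul hy hene]
  exact exists_conj_of_entries hx _ (by linear_combination he)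
    (by linear_combination (p' - s') ^ 2 * he0 - hs) (by linear_combination (q' + r') ^ 2 * he0 - ht)
    (by linear_combination (r' - q') ^ 2 * he0 + hst)

/-- Two finite subgroups of the same order, one of which is generated by a Klein four-group and an
element, are conjugate if they contain elements with the same invariants. -/
theorem exists_map_conj_eq_of_tau_eq [IsAlgClosed k] {H₁ H₂ : Subgroup PGL(2, k)} [Finite H₁]
    (hcard : Nat.card H₁ = Nat.card H₂) {s₁ t₁ x₁ s₂ t₂ x₂ : PGL(2, k)}
    (h₁ : IsKleinPair s₁ t₁) (h₂ : IsKleinPair s₂ t₂) (hs₁ : s₁ ∈ H₁) (ht₁ : t₁ ∈ H₁)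
    (hx₁ : x₁ ∈ H₁) (hs₂ : s₂ ∈ H₂) (ht₂ : t₂ ∈ H₂) (hx₂ : x₂ ∈ H₂) (h0 : tau x₁ = tau x₂)
    (hs : tau (x₁ * s₁) = tau (x₂ * s₂)) (ht : tau (x₁ * t₁) = tau (x₂ * t₂))
    (hgen : ∀ K ≤ H₂, s₂ ∈ K → t₂ ∈ K → x₂ ∈ K → K = H₂) :
    ∃ c : PGL(2, k), H₂ = H₁.map (MulAut.conj c).toMonoidHom := by
  obtain ⟨c₁, hcs₁, hct₁⟩ := h₁.exists_conj
  obtain ⟨c₂, hcs₂, hct₂⟩ := h₂.exists_conj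
  obtain ⟨d, hds, hdt, hdx⟩ := exists_conj_of_tau_eq (x := MulAut.conj c₁ x₁)
    (y := MulAut.conj c₂ x₂) (by rw [tau_conj, tau_conj, h0])
    (by rw [← hcs₁, ← map_mul, tau_conj, hcs₁, ← hcs₂, ← map_mul, tau_conj, hs])
    (by rw [← hct₁, ← map_mul, tau_conj, hct₁, ← hct₂, ← map_mul, tau_conj, ht])
  have hc (g : PGL(2, k)) : MulAut.conj (c₂⁻¹ * d * c₁) g =
      MulAut.conj c₂⁻¹ (MulAut.conj d (MulAut.conj c₁ g)) := by
    rw [map_mul, map_mul, MulAut.mul_apply, MulAut.mul_apply]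
  have hinv (g : PGL(2, k)) : MulAut.conj c₂⁻¹ (MulAut.conj c₂ g) = g := by
    rw [map_inv, MulAut.inv_apply_self]
  refine ⟨c₂⁻¹ * d * c₁, ?_⟩
  -- The intersection contains the Klein pair and `x₂`, whether `x₁` or its inverse is carried to
  -- `x₂`; being generated by them, `H₂` lies in the conjugate of `H₁`, and the orders agree.
  have hle : H₂ ⊓ H₁.map (MulAut.conj (c₂⁻¹ * d * c₁)).toMonoidHom = H₂ := by
    refine hgen _ inf_le_left ⟨hs₂, s₁, hs₁, ?_⟩ ⟨ht₂, t₁, ht₁, ?_⟩ ⟨hx₂, ?_⟩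
    · refine (hc s₁).trans ?_
      rw [hcs₁, hds, ← hcs₂, hinv]
    · refine (hc t₁).trans ?_
      rw [hct₁, hdt, ← hct₂, hinv]
    · rcases hdx with hdx | hdx
      · refine ⟨x₁, hx₁, (hc x₁).trans ?_⟩
        rw [hdx, hinv]
      · refine ⟨x₁⁻¹, inv_mem hx₁, (hc _).trans ?_⟩
        rw [map_inv (MulAut.conj c₁), hdx, hinv]
  exact Subgroup.eq_of_le_of_card_ge (inf_eq_left.mp hle)
    (by rw [Subgroup.card_map_conj, hcard])

end Matrix.ProjGenLinGroup

/-! ### The groups of order 12, 24 and 60 -/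

namespace Matrix.ProjGenLinGroup

variable {k : Type u} [Field k]

/-- The subgroup contains a Klein four-group and an element with the given invariants on its
coset. -/
def HasPattern (H : Subgroup PGL(2, k)) (a b c : k) : Prop :=
  ∃ s ∈ H, ∃ t ∈ H, ∃ x ∈ H, IsKleinPair s t ∧ tau x = a ∧ tau (x * s) = b ∧ tau (x * t) = c

theorem HasPattern.of_map {H : Subgroup PGL(2, k)} {a b c : k} {d : PGL(2, k)}
    (h : HasPattern (H.map (MulAut.conj d).toMonoidHom) a b c) : HasPattern H a b c := by
  obtain ⟨-, ⟨s, hs, rfl⟩, -, ⟨t, ht, rfl⟩, -, ⟨x, hx, rfl⟩, hk, h0, h1, h2⟩ := h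
  rw [← map_mul] at h1 h2
  refine ⟨s, hs, t, ht, x, hx, ?_, (tau_conj d x).symm.trans h0, (tau_conj d _).symm.trans h1,
    (tau_conj d _).symm.trans h2⟩
  have := hk.map (MulAut.conj d).symm.toMonoidHom (MulAut.conj d).symm.injective
  simpa only [MulEquiv.coe_toMonoidHom, MulEquiv.symm_apply_apply] using this

/-- The pattern may be read off any three distinct elements of the coset in any order: take `x v₀`
as the new element and quotients inside the Klein group as the new pair. -/
theorem HasPattern.of_coset {H : Subgroup PGL(2, k)} {s t x v₀ v₁ v₂ : PGL(2, k)}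
    (h : IsKleinPair s t) (hs : s ∈ H) (ht : t ∈ H) (hx : x ∈ H) (h₀ : v₀ ∈ h.group)
    (h₁ : v₁ ∈ h.group) (h₂ : v₂ ∈ h.group) (h01 : v₀ ≠ v₁) (h02 : v₀ ≠ v₂) (h12 : v₁ ≠ v₂) :
    HasPattern H (tau (x * v₀)) (tau (x * v₁)) (tau (x * v₂)) := by
  have hle := h.group_le hs ht
  have m (v) (hv : v ∈ h.group) : x * v ∈ H := mul_mem hx (hle hv)
  refine ⟨_, mul_mem (inv_mem (m _ h₀)) (m _ h₁), _, mul_mem (inv_mem (m _ h₀)) (m _ h₂), _, m _ h₀,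
    h.of_coset h₀ h₁ h₂ h01 h02 h12, rfl, ?_, ?_⟩
  · rw [mul_inv_cancel_left]
  · rw [mul_inv_cancel_left]

theorem _root_.IsKleinPair.mul_ne_one_of_mul_self_ne {P : Type*} [Group P] {s t x v : P}
    (h : IsKleinPair s t) (hx : x * x ≠ 1) (hv : v ∈ h.group) : x * v ≠ 1 := fun e => by
  rw [eq_inv_of_mul_eq_one_left e] at hx
  exact hx (h.mul_self (inv_mem hv))

theorem mul_self_ne_one_of_orderOf {P : Type*} [Group P] {x : P} (hx : 2 < orderOf x) :
    x * x ≠ 1 := fun e => by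
  rw [← sq] at e
  exact absurd (orderOf_le_of_pow_eq_one two_pos e) (by omega)

theorem exists_mem_orderOf_eq {P : Type*} [Group P] (H : Subgroup P) [Finite H] {p : ℕ}
    (hp : p.Prime) (h : p ∣ Nat.card H) : ∃ x ∈ H, orderOf x = p := by
  have : Fact p.Prime := ⟨hp⟩
  obtain ⟨x, hx⟩ := exists_prime_orderOf_dvd_card' (G := H) p h
  exact ⟨x.1, x.2, by rw [Subgroup.orderOf_coe, hx]⟩

theorem mul_self_eq_one_of_pow_four {P : Type*} [Group P] {g : P} (h : g ^ 4 = 1)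
    (hg : orderOf g ≠ 4) : g * g = 1 := by
  have h1 := orderOf_dvd_of_pow_eq_one h
  have h2 := Nat.le_of_dvd (by norm_num) h1
  have h3 : orderOf g ∣ 2 := by interval_cases orderOf g <;> omega
  rw [← sq]
  exact orderOf_dvd_iff_pow_eq_one.mp h3

theorem dvd_card_of_orderOf {P : Type*} [Group P] {K : Subgroup P} {x : P} (hx : x ∈ K) {n : ℕ}
    (h : orderOf x = n) : n ∣ Nat.card K := by
  rw [← h, ← Nat.card_zpowers]
  exact Subgroup.card_dvd_of_le (Subgroup.zpowers_le.mpr hx)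

theorem eq_of_card_dvd {P : Type*} [Group P] {K H : Subgroup P} [Finite H] (hle : K ≤ H)
    (h : Nat.card H ∣ Nat.card K) : K = H := by
  have : Finite K := Finite.of_injective _ (Subgroup.inclusion_injective hle)
  exact Subgroup.eq_of_le_of_card_ge hle (Nat.le_of_dvd Nat.card_pos h)

/-- Completing the square gives `(2m + 3n)² = 5n²`, and `√5` is irrational. Relations among the
values of `tau` can thus be compared coefficient by coefficient over the integers. -/
theorem eq_zero_of_golden [CharZero k] {ρ : k} (hρ : ρ ^ 2 - 3 * ρ + 1 = 0) {m n : ℤ}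
    (h : (m : k) + n * ρ = 0) : m = 0 ∧ n = 0 := by
  have h1 : (((2 * m + 3 * n) ^ 2 : ℤ) : k) = ((5 * n ^ 2 : ℤ) : k) := by
    push_cast
    linear_combination 4 * (m + 3 * n - n * ρ) * h + 4 * (n : k) ^ 2 * hρ
  have h2 : (2 * m + 3 * n) ^ 2 = 5 * n ^ 2 := Int.cast_injective h1
  have hn : n = 0 := by
    by_contra hn
    have h3 : ((2 * m + 3 * n : ℤ) / n : ℝ) ^ 2 = 5 := by
      have : (n : ℝ) ≠ 0 := Int.cast_ne_zero.mpr hn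
      rw [div_pow, div_eq_iff (pow_ne_zero 2 this)]
      exact_mod_cast h2
    have h4 : √(5 : ℝ) = |((2 * m + 3 * n : ℤ) : ℝ) / (n : ℝ)| := by rw [← h3, Real.sqrt_sq_eq_abs]
    refine (Nat.prime_five.irrational_sqrt) ⟨|((2 * m + 3 * n : ℤ) : ℚ) / n|, ?_⟩
    push_cast at h4 ⊢
    exact h4.symm
  subst hn
  exact ⟨by simpa using h2, rfl⟩

variable [IsAlgClosed k] [CharZero k]

/-- On the coset of an element of order three the values are 0 or 1 and add up to 4, so all of them
are 1. -/
theorem tetrahedral_hasPattern {H : Subgroup PGL(2, k)} [Finite H] (hcard : Nat.card H = 12)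
    (hH : ∀ g ∈ H, g ≠ 1 → orderOf g = 2 ∨ orderOf g = 3) : HasPattern H 1 1 1 := by
  obtain ⟨s, hs, t, ht, h⟩ := H.exists_isKleinPair (by rw [hcard]; norm_num) fun g hg h4 => by
    by_cases h1 : g = 1
    · rw [h1, one_mul]
    · exact mul_self_eq_one_of_pow_four h4 (by have := hH g hg h1; omega)
  obtain ⟨x, hx, hx3⟩ := exists_mem_orderOf_eq H Nat.prime_three (by rw [hcard]; norm_num)
  have hxx := mul_self_ne_one_of_orderOf (x := x) (by omega)
  have hval (v) (hv : v ∈ h.group) : tau (x * v) = 0 ∨ tau (x * v) = 1 :=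
    (hH _ (mul_mem hx (h.group_le hs ht hv)) (h.mul_ne_one_of_mul_self_ne hxx hv)).imp
      tau_of_orderOf_two tau_of_orderOf_three
  have hsum := sum_tau_eq_four h x
  have h0 := tau_of_orderOf_three hx3
  rw [h0] at hsum
  refine ⟨s, hs, t, ht, x, hx, h, h0, ?_⟩
  rcases hval s (Or.inr (Or.inl rfl)) with e1 | e1 <;>
  rcases hval t (Or.inr (Or.inr (Or.inl rfl))) with e2 | e2 <;>
  rcases hval (s * t) (Or.inr (Or.inr (Or.inr rfl))) with e3 | e3 <;>
  rw [e1, e2, e3] at hsum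
  all_goals first
    | exact ⟨e1, e2⟩
    | (norm_num at hsum)

theorem tetrahedral_generation {H : Subgroup PGL(2, k)} [Finite H] (hcard : Nat.card H = 12)
    (hH : ∀ g ∈ H, g ≠ 1 → orderOf g = 2 ∨ orderOf g = 3)
    {K : Subgroup PGL(2, k)} (hK : K ≤ H) {s t x : PGL(2, k)}
    (h : IsKleinPair s t) (hs : s ∈ K) (ht : t ∈ K) (hx : x ∈ K) (h0 : tau x = 1) : K = H := by
  refine eq_of_card_dvd hK ?_
  have h3 : orderOf x = 3 := by
    refine (hH x (hK hx) ?_).resolve_left fun h2 => ?_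
    · rintro rfl
      rw [tau_one] at h0
      norm_num at h0
    · rw [tau_of_orderOf_two h2] at h0
      norm_num at h0
  rw [hcard]
  exact Nat.Coprime.mul_dvd_of_dvd_of_dvd (by norm_num) (h.four_dvd_card hs ht)
    (dvd_card_of_orderOf hx h3)

/-- One value is 1 and the other three, taken from 0, 1, 2, add up to 3. They are either all 1 or a
permutation of 0, 1, 2, and the latter contains the pattern sought. -/
theorem octahedral_coset {H : Subgroup PGL(2, k)}
    (hH : ∀ g ∈ H, g ≠ 1 → orderOf g = 2 ∨ orderOf g = 3 ∨ orderOf g = 4)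
    {s t x : PGL(2, k)} (h : IsKleinPair s t) (hs : s ∈ H) (ht : t ∈ H)
    (hx : x ∈ H) (hx3 : orderOf x = 3) :
    (tau (x * s) = 1 ∧ tau (x * t) = 1) ∨ HasPattern H 2 1 1 := by
  have hxx := mul_self_ne_one_of_orderOf (x := x) (by omega)
  have hval (v) (hv : v ∈ h.group) : tau (x * v) = 0 ∨ tau (x * v) = 1 ∨ tau (x * v) = 2 :=
    (hH _ (mul_mem hx (h.group_le hs ht hv)) (h.mul_ne_one_of_mul_self_ne hxx hv)).imp
      tau_of_orderOf_two (Or.imp tau_of_orderOf_three tau_of_orderOf_four)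
  have hsum := sum_tau_eq_four h x
  have h0 := tau_of_orderOf_three hx3
  rw [h0] at hsum
  have hpat {v w} (hv : v ∈ h.group) (hw : w ∈ h.group) (hv1 : tau (x * v) = 1)
      (hw2 : tau (x * w) = 2) (hne : v ≠ 1) : HasPattern H 2 1 1 := by
    have h1 : tau (x * 1) = 1 := by rw [mul_one, h0]
    have := HasPattern.of_coset h hs ht hx hw (one_mem _) hv
      (by rintro rfl; rw [h1] at hw2; norm_num at hw2)
      (by rintro rfl; rw [hv1] at hw2; norm_num at hw2) hne.symm
    rwa [hw2, h1, hv1] at this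
  have ms : s ∈ h.group := Or.inr (Or.inl rfl)
  have mt : t ∈ h.group := Or.inr (Or.inr (Or.inl rfl))
  have mst : s * t ∈ h.group := Or.inr (Or.inr (Or.inr rfl))
  rcases hval s ms with e1 | e1 | e1 <;> rcases hval t mt with e2 | e2 | e2 <;>
  rcases hval (s * t) mst with e3 | e3 | e3 <;> rw [e1, e2, e3] at hsum
  all_goals first
    | exact Or.inl ⟨e1, e2⟩
    | exact Or.inr (hpat ms mt e1 e2 h.left_ne_one)
    | exact Or.inr (hpat ms mst e1 e3 h.left_ne_one)
    | exact Or.inr (hpat mt ms e2 e1 h.right_ne_one)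
    | exact Or.inr (hpat mt mst e2 e3 h.right_ne_one)
    | exact Or.inr (hpat mst ms e3 e1 h.mul_ne_one)
    | exact Or.inr (hpat mst mt e3 e2 h.mul_ne_one)
    | (norm_num at hsum)

theorem octahedral_generation {H : Subgroup PGL(2, k)} [Finite H]
    (hH : ∀ g ∈ H, g ≠ 1 → orderOf g = 2 ∨ orderOf g = 3 ∨ orderOf g = 4)
    (hcard : Nat.card H = 24) {K : Subgroup PGL(2, k)} (hK : K ≤ H)
    {s t x : PGL(2, k)} (h : IsKleinPair s t) (hs : s ∈ K) (ht : t ∈ K) (hx : x ∈ K)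
    (h0 : tau x = 2) (h1 : tau (x * s) = 1) : K = H := by
  have hord {g} (hg : g ∈ K) (h4 : tau g ≠ 4) (h0 : tau g ≠ 0) : orderOf g = 3 ∨ orderOf g = 4 :=
    (hH g (hK hg) fun h => h4 (h ▸ tau_one)).resolve_left fun h => h0 (tau_of_orderOf_two h)
  have hx4 : orderOf x = 4 := by
    refine (hord hx ?_ ?_).resolve_left fun h3 => ?_
    · rw [h0]; norm_num
    · rw [h0]; norm_num
    · rw [tau_of_orderOf_three h3] at h0
      norm_num at h0
  have h3 : orderOf (x * s) = 3 := by
    refine (hord (mul_mem hx hs) ?_ ?_).resolve_right fun h4 => ?_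
    · rw [h1]; norm_num
    · rw [h1]; norm_num
    · rw [tau_of_orderOf_four h4] at h1
      norm_num at h1
  have : Finite K := Finite.of_injective _ (Subgroup.inclusion_injective hK)
  have hle4 (g) (hg : g ∈ K) : orderOf g ≤ 4 := by
    by_cases hg1 : g = 1
    · rw [hg1, orderOf_one]; norm_num
    · have := hH g (hK hg) hg1
      omega
  have h12 : 12 ∣ Nat.card K := Nat.Coprime.mul_dvd_of_dvd_of_dvd (m := 4) (n := 3) (by norm_num)
    (h.four_dvd_card hs ht) (dvd_card_of_orderOf (mul_mem hx hs) h3)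
  -- By the classification a subgroup of order 12 has an element of order 12 or 6, or only
  -- nontrivial elements of order 2 or 3; the element `x` of order 4 and the bound on orders exclude
  -- every case.
  have hne12 : Nat.card K ≠ 12 := by
    intro hc
    rcases finite_subgroup_classification K with hcyc | ⟨g, hg, hg2⟩ | ⟨-, h'⟩ | ⟨h', -⟩ | ⟨h', -⟩
    · obtain ⟨g, hg⟩ := IsCyclic.exists_ofOrder_eq_natCard (α := K)
      have := hle4 g g.2
      rw [Subgroup.orderOf_coe] at this
      omega
    · have := hle4 g hg
      omega
    · have := h' x hx fun h => by rw [h, orderOf_one] at hx4; omega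
      omega
    · omega
    · omega
  refine Subgroup.eq_of_le_of_card_ge hK ?_
  have := Nat.card_pos (α := K)
  omega

/-- A subgroup of order 8 is dihedral and contains two Klein four-groups sharing `diag (-1)`. The
cosets of one element of order three by these two groups cannot both have all values equal to 1. -/
theorem octahedral_hasPattern {H : Subgroup PGL(2, k)} [Finite H]
    (hH : ∀ g ∈ H, g ≠ 1 → orderOf g = 2 ∨ orderOf g = 3 ∨ orderOf g = 4)
    (hcard : Nat.card H = 24) : HasPattern H 2 1 1 := by
  have hne8 (g) (hg : g ∈ H) : orderOf g ≤ 4 := by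
    by_cases hg1 : g = 1
    · rw [hg1, orderOf_one]; norm_num
    · have := hH g hg hg1
      omega
  obtain ⟨K, hKH, hK8⟩ : ∃ K ≤ H, Nat.card K = 8 := by
    have : Fact (Nat.Prime 2) := ⟨Nat.prime_two⟩
    obtain ⟨K, hK⟩ := Sylow.exists_subgroup_card_pow_prime (G := H) 2 (n := 3)
      (by rw [hcard]; norm_num)
    refine ⟨K.map H.subtype, Subgroup.map_subtype_le K, ?_⟩
    rw [← Nat.card_congr (K.equivMapOfInjective H.subtype H.subtype_injective).toEquiv, hK]
    norm_num
  have : Finite K := Finite.of_injective _ (Subgroup.inclusion_injective hKH)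
  have hcyc : ¬ IsCyclic K := fun hcyc => by
    obtain ⟨g, hg⟩ := IsCyclic.exists_ofOrder_eq_natCard (α := K)
    have := hne8 g (hKH g.2)
    rw [Subgroup.orderOf_coe] at this
    omega
  have h4 : ∃ g ∈ K, orderOf g = 4 := by
    rcases finite_subgroup_classification K with h | ⟨g, hg, hg2⟩ | ⟨h', -⟩ | ⟨h', -⟩ | ⟨h', -⟩
    · exact absurd h hcyc
    · exact ⟨g, hg, by omega⟩
    all_goals omega
  obtain ⟨c, hc⟩ := isConjTo_dihedral K hcyc (m := 4) (by omega) h4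
  apply HasPattern.of_map (d := c)
  have hmem {g : PGL(2, k)}
      (hg : ∃ a : kˣ, a ^ 4 = 1 ∧ (g = diag a ∨ g = diag a * inversion)) :
      g ∈ H.map (MulAut.conj c).toMonoidHom := by
    have : g ∈ (K.map (MulAut.conj c).toMonoidHom : Set PGL(2, k)) := hc ▸ hg
    exact Subgroup.map_mono hKH this
  have hH' : ∀ g ∈ H.map (MulAut.conj c).toMonoidHom, g ≠ 1 →
      orderOf g = 2 ∨ orderOf g = 3 ∨ orderOf g = 4 := by
    rintro - ⟨g, hg, rfl⟩ hne
    rw [orderOf_injective _ (MulAut.conj c).injective g]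
    exact hH g hg fun h => hne (by rw [h, map_one])
  have hcard' := H.card_map_conj c
  rw [hcard] at hcard'
  have hfin := H.finite_map_conj c
  clear hc hne8 hKH hcard hH
  generalize H.map (MulAut.conj c).toMonoidHom = H at *
  obtain ⟨i, hi⟩ := IsAlgClosed.exists_pow_nat_eq (-1 : k) (n := 2) (by norm_num)
  have hi0 : i ≠ 0 := by
    rintro rfl
    norm_num at hi
  obtain ⟨x, hx, hx3⟩ := exists_mem_orderOf_eq H Nat.prime_three (by rw [hcard']; norm_num)
  have hs : diag (-1 : kˣ) ∈ H := hmem ⟨-1, by norm_num, Or.inl rfl⟩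
  have ht : inversion ∈ H := hmem ⟨1, one_pow _, Or.inr (by rw [map_one, one_mul])⟩
  have ht' : diag (Units.mk0 i hi0) * inversion ∈ H :=
    hmem ⟨_, Units.ext (by
      rw [Units.val_pow_eq_pow_val, Units.val_mk0, Units.val_one]
      linear_combination (i ^ 2 - 1) * hi), Or.inr rfl⟩
  rcases octahedral_coset hH' isKleinPair_diag_inversion hs ht hx hx3 with ⟨h1, h2⟩ | h
  swap
  · exact h
  rcases octahedral_coset hH' isKleinPair_diag_mul_inversion hs ht' hx hx3 with ⟨-, h3⟩ | h
  swap
  · exact h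
  exfalso
  have h0 := tau_of_orderOf_three hx3
  obtain ⟨p, q, r, s, hd, rfl⟩ := exists_eq_mat x
  rw [tau_mat, div_eq_one_iff_eq hd] at h0
  rw [tau_mat_mul_diag_neg_one, div_eq_one_iff_eq hd] at h1
  rw [tau_mat_mul_inversion, div_eq_one_iff_eq hd] at h2
  have hd' : q * (r * i) - p * i * s ≠ 0 := by
    convert mul_ne_zero (neg_ne_zero.mpr hi0) hd using 1
    ring
  rw [diag_apply, inversion, mat_mul, mat_mul, tau_mat] at h3
  simp only [Units.val_mk0, mul_zero, mul_one, zero_add, add_zero] at h3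
  rw [div_eq_one_iff_eq hd'] at h3
  -- The first Klein group gives `2 q r = -det` and `q² + r² = 0`; the second adds `q² = r²`. Hence
  -- `r = 0` and the determinant vanishes.
  have hqr : q * r = -(p * s - q * r) / 2 := by linear_combination (h0 + h1) / 4
  have hsq : q ^ 2 + r ^ 2 = 0 := by linear_combination -h2 - 2 * hqr
  have hr : r ^ 2 = 0 := by
    linear_combination (-1 / 2 : k) * h3 + i * hqr + hsq / 2 + r ^ 2 / 2 * hi
  have hr0 : r = 0 := pow_eq_zero_iff two_ne_zero |>.mp hr
  rw [hr0] at hqr hd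
  exact hd (by linear_combination 2 * hqr)

/-- The two possible values at order five are `ρ` and its conjugate `3 - ρ`. Integer coordinates
reduce the later case analysis to linear arithmetic. -/
theorem icosahedral_tau {H : Subgroup PGL(2, k)}
    (hH : ∀ g ∈ H, g ≠ 1 → orderOf g = 2 ∨ orderOf g = 3 ∨ orderOf g = 5)
    {ρ : k} (hρ : ρ ^ 2 - 3 * ρ + 1 = 0) {g : PGL(2, k)} (hg : g ∈ H)
    (hne : g ≠ 1) : ∃ i j : ℤ, tau g = i + j * ρ ∧
      ((i = 0 ∧ j = 0 ∧ orderOf g = 2) ∨ (i = 1 ∧ j = 0 ∧ orderOf g = 3) ∨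
        (i = 0 ∧ j = 1 ∧ orderOf g = 5) ∨ (i = 3 ∧ j = -1 ∧ orderOf g = 5)) := by
  rcases hH g hg hne with h | h | h
  · exact ⟨0, 0, by rw [tau_of_orderOf_two h]; simp, by simp [h]⟩
  · exact ⟨1, 0, by rw [tau_of_orderOf_three h]; simp, by simp [h]⟩
  · have h1 := tau_of_orderOf_five h
    have h2 : (tau g - ρ) * (tau g - (3 - ρ)) = 0 := by linear_combination h1 - hρ
    rcases mul_eq_zero.mp h2 with h2 | h2
    · exact ⟨0, 1, by push_cast; linear_combination h2, by simp [h]⟩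
    · exact ⟨3, -1, by push_cast; linear_combination h2, by simp [h]⟩

theorem icosahedral_orderOf {H : Subgroup PGL(2, k)}
    (hH : ∀ g ∈ H, g ≠ 1 → orderOf g = 2 ∨ orderOf g = 3 ∨ orderOf g = 5)
    {ρ : k} (hρ : ρ ^ 2 - 3 * ρ + 1 = 0) {g : PGL(2, k)} (hg : g ∈ H) :
    (tau g = 1 → orderOf g = 3) ∧ (tau g = ρ → orderOf g = 5) := by
  have hne (h4 : tau g ≠ 4) : g ≠ 1 := fun h => h4 (h ▸ tau_one)
  constructor
  · intro h1
    obtain ⟨i, j, hij, h⟩ := icosahedral_tau hH hρ hg (hne (by rw [h1]; norm_num))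
    obtain ⟨h2, h3⟩ := eq_zero_of_golden hρ (m := i - 1) (n := j)
      (by push_cast; linear_combination h1 - hij)
    omega
  · intro h1
    obtain ⟨i, j, hij, h⟩ := icosahedral_tau hH hρ hg (hne (fun h4 => by
      have := (eq_zero_of_golden hρ (m := -4) (n := 1)
        (by push_cast; linear_combination h4 - h1)).2
      omega))
    obtain ⟨h2, h3⟩ := eq_zero_of_golden hρ (m := i) (n := j - 1)
      (by push_cast; linear_combination h1 - hij)
    omega

/-- Starting from an element of order five, irrationality forces `ρ` and `3 - ρ` to occur equally
often on the coset. The sum 4 allows one of each, leaving 0 and 1. As both conjugates occur, it does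
not matter which root `ρ` is. -/
theorem icosahedral_hasPattern {H : Subgroup PGL(2, k)} [Finite H] (hcard : Nat.card H = 60)
    (hH : ∀ g ∈ H, g ≠ 1 → orderOf g = 2 ∨ orderOf g = 3 ∨ orderOf g = 5)
    {ρ : k} (hρ : ρ ^ 2 - 3 * ρ + 1 = 0) : HasPattern H 0 1 ρ := by
  obtain ⟨s, hs, t, ht, h⟩ := H.exists_isKleinPair (by rw [hcard]; norm_num) fun g hg h4 => by
    by_cases h1 : g = 1
    · rw [h1, one_mul]
    · exact mul_self_eq_one_of_pow_four h4 (by have := hH g hg h1; omega)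
  obtain ⟨x, hx, hx5⟩ := exists_mem_orderOf_eq H Nat.prime_five (by rw [hcard]; norm_num)
  have hxx := mul_self_ne_one_of_orderOf (x := x) (by omega)
  have hval (v) (hv : v ∈ h.group) := icosahedral_tau hH hρ
    (mul_mem hx (h.group_le hs ht hv)) (h.mul_ne_one_of_mul_self_ne hxx hv)
  have m1 : (1 : PGL(2, k)) ∈ h.group := one_mem _
  have ms : s ∈ h.group := Or.inr (Or.inl rfl)
  have mt : t ∈ h.group := Or.inr (Or.inr (Or.inl rfl))
  have mst : s * t ∈ h.group := Or.inr (Or.inr (Or.inr rfl))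
  obtain ⟨i₀, j₀, e₀, c₀⟩ := hval 1 m1
  obtain ⟨i₁, j₁, e₁, c₁⟩ := hval s ms
  obtain ⟨i₂, j₂, e₂, c₂⟩ := hval t mt
  obtain ⟨i₃, j₃, e₃, c₃⟩ := hval (s * t) mst
  rw [mul_one, hx5] at c₀
  have hsum := sum_tau_eq_four h x
  have hz := eq_zero_of_golden hρ (m := i₀ + i₁ + i₂ + i₃ - 4) (n := j₀ + j₁ + j₂ + j₃) (by
    rw [mul_one] at e₀
    push_cast
    linear_combination hsum - e₀ - e₁ - e₂ - e₃)
  have find (a b : ℤ) (hab : (i₀ = a ∧ j₀ = b) ∨ (i₁ = a ∧ j₁ = b) ∨ (i₂ = a ∧ j₂ = b) ∨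
      (i₃ = a ∧ j₃ = b)) : ∃ v ∈ h.group, tau (x * v) = a + b * ρ := by
    rcases hab with ⟨rfl, rfl⟩ | ⟨rfl, rfl⟩ | ⟨rfl, rfl⟩ | ⟨rfl, rfl⟩
    exacts [⟨_, m1, e₀⟩, ⟨_, ms, e₁⟩, ⟨_, mt, e₂⟩, ⟨_, mst, e₃⟩]
  obtain ⟨v₀, hv₀, hτ₀⟩ := find 0 0 (by omega)
  obtain ⟨v₁, hv₁, hτ₁⟩ := find 1 0 (by omega)
  obtain ⟨v₂, hv₂, hτ₂⟩ := find 0 1 (by omega)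
  replace hτ₀ : tau (x * v₀) = 0 := by simpa using hτ₀
  replace hτ₁ : tau (x * v₁) = 1 := by simpa using hτ₁
  replace hτ₂ : tau (x * v₂) = ρ := by simpa using hτ₂
  have hρ0 : ρ ≠ 0 := by
    rintro rfl
    norm_num at hρ
  have hρ1 : ρ ≠ 1 := by
    rintro rfl
    norm_num at hρ
  have := HasPattern.of_coset h hs ht hx hv₀ hv₁ hv₂
    (by rintro rfl; exact zero_ne_one (hτ₀.symm.trans hτ₁))
    (by rintro rfl; exact hρ0 (hτ₂.symm.trans hτ₀))
    (by rintro rfl; exact hρ1 (hτ₂.symm.trans hτ₁))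
  rwa [hτ₀, hτ₁, hτ₂] at this

theorem icosahedral_generation {H : Subgroup PGL(2, k)} [Finite H] (hcard : Nat.card H = 60)
    (hH : ∀ g ∈ H, g ≠ 1 → orderOf g = 2 ∨ orderOf g = 3 ∨ orderOf g = 5)
    {ρ : k} (hρ : ρ ^ 2 - 3 * ρ + 1 = 0) {K : Subgroup PGL(2, k)}
    (hK : K ≤ H) {s t x : PGL(2, k)} (h : IsKleinPair s t) (hs : s ∈ K) (ht : t ∈ K) (hx : x ∈ K)
    (h1 : tau (x * s) = 1) (h2 : tau (x * t) = ρ) : K = H := by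
  refine eq_of_card_dvd hK ?_
  have h3 := dvd_card_of_orderOf (mul_mem hx hs)
    ((icosahedral_orderOf hH hρ (hK (mul_mem hx hs))).1 h1)
  have h5 := dvd_card_of_orderOf (mul_mem hx ht)
    ((icosahedral_orderOf hH hρ (hK (mul_mem hx ht))).2 h2)
  rw [hcard]
  exact Nat.Coprime.mul_dvd_of_dvd_of_dvd (m := 12) (n := 5) (by norm_num)
    (Nat.Coprime.mul_dvd_of_dvd_of_dvd (m := 4) (n := 3) (by norm_num) (h.four_dvd_card hs ht) h3) h5

end Matrix.ProjGenLinGroup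

/-! ### Conjugacy of isomorphic finite subgroups, and the theorem -/

namespace Matrix.ProjGenLinGroup

variable {k : Type u} [Field k] [IsAlgClosed k] [CharZero k]

theorem HasPattern.exists_map_conj_eq {H₁ H₂ : Subgroup PGL(2, k)} [Finite H₁]
    (hcard : Nat.card H₁ = Nat.card H₂) {a b c : k} (h₁ : HasPattern H₁ a b c)
    (h₂ : HasPattern H₂ a b c)
    (hgen : ∀ K ≤ H₂, ∀ s t x, IsKleinPair s t → s ∈ K → t ∈ K → x ∈ K → tau x = a →
      tau (x * s) = b → tau (x * t) = c → K = H₂) :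
    ∃ c : PGL(2, k), H₂ = H₁.map (MulAut.conj c).toMonoidHom := by
  obtain ⟨s₁, hs₁, t₁, ht₁, x₁, hx₁, hk₁, ha₁, hb₁, hc₁⟩ := h₁
  obtain ⟨s₂, hs₂, t₂, ht₂, x₂, hx₂, hk₂, ha₂, hb₂, hc₂⟩ := h₂
  exact exists_map_conj_eq_of_tau_eq hcard hk₁ hk₂ hs₁ ht₁ hx₁ hs₂ ht₂ hx₂ (ha₁.trans ha₂.symm)
    (hb₁.trans hb₂.symm) (hc₁.trans hc₂.symm) fun K hK hs ht hx =>
      hgen K hK s₂ t₂ x₂ hk₂ hs ht hx ha₂ hb₂ hc₂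

/-- Isomorphic finite subgroups of the projective general linear group of degree two are
conjugate. -/
theorem exists_map_conj_eq (H₁ H₂ : Subgroup PGL(2, k)) [Finite H₁] (e : H₁ ≃* H₂) :
    ∃ c : PGL(2, k), H₂ = H₁.map (MulAut.conj c).toMonoidHom := by
  have : Finite H₂ := Finite.of_equiv _ e.toEquiv
  have hcard : Nat.card H₁ = Nat.card H₂ := Nat.card_congr e.toEquiv
  have hord {p : ℕ → Prop} (h : ∀ g ∈ H₁, g ≠ 1 → p (orderOf g)) : ∀ g ∈ H₂, g ≠ 1 → p (orderOf g) := by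
    intro g hg hne
    have h1 : orderOf (e.symm ⟨g, hg⟩).1 = orderOf g := by
      rw [Subgroup.orderOf_coe, MulEquiv.orderOf_eq,
        Subgroup.orderOf_mk]
    rw [← h1]
    refine h _ (e.symm ⟨g, hg⟩).2 fun h2 => hne ?_
    rw [← orderOf_eq_one_iff, ← h1, h2, orderOf_one]
  rcases finite_subgroup_classification H₁ with h | ⟨g, hg, hm⟩ | ⟨hN, h⟩ | ⟨hN, h⟩ | ⟨hN, h⟩
  · have h₂ := isConjTo_of_isCyclic H₂ (e.isCyclic.mp h)
    rw [← hcard] at h₂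
    exact (isConjTo_of_isCyclic H₁ h).exists_conj h₂
  -- An element of half the group order can also occur in a cyclic group, which must be separated
  -- before the dihedral normal form is used.
  · by_cases hc : IsCyclic H₁
    · have h₂ := isConjTo_of_isCyclic H₂ (e.isCyclic.mp hc)
      rw [← hcard] at h₂
      exact (isConjTo_of_isCyclic H₁ hc).exists_conj h₂
    · refine (isConjTo_dihedral H₁ hc hm ⟨g, hg, rfl⟩).exists_conj
        (isConjTo_dihedral H₂ (fun h => hc (e.isCyclic.mpr h)) (hm.trans hcard)
          ⟨(e ⟨g, hg⟩).1, (e ⟨g, hg⟩).2, ?_⟩)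
      rw [Subgroup.orderOf_coe, MulEquiv.orderOf_eq,
        Subgroup.orderOf_mk]
  · have h₂ := hord (p := fun n => n = 2 ∨ n = 3) h
    have hN₂ := hcard ▸ hN
    exact (tetrahedral_hasPattern hN h).exists_map_conj_eq hcard (tetrahedral_hasPattern hN₂ h₂)
      fun K hK s t x hk hs ht hx h0 _ _ => tetrahedral_generation hN₂ h₂ hK hk hs ht hx h0
  · have h₂ := hord (p := fun n => n = 2 ∨ n = 3 ∨ n = 4) h
    have hN₂ := hcard ▸ hN
    exact (octahedral_hasPattern h hN).exists_map_conj_eq hcard (octahedral_hasPattern h₂ hN₂)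
      fun K hK s t x hk hs ht hx h0 h1 _ => octahedral_generation h₂ hN₂ hK hk hs ht hx h0 h1
  · have h₂ := hord (p := fun n => n = 2 ∨ n = 3 ∨ n = 5) h
    have hN₂ := hcard ▸ hN
    -- The root `ρ = (3 + √5) / 2` is fixed once for both groups, so that their patterns coincide.
    obtain ⟨z, hz⟩ := IsAlgClosed.exists_pow_nat_eq (5 : k) (n := 2) (by norm_num)
    have hρ : ((3 + z) / 2) ^ 2 - 3 * ((3 + z) / 2) + 1 = 0 := by linear_combination hz / 4
    exact (icosahedral_hasPattern hN h hρ).exists_map_conj_eq hcard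
      (icosahedral_hasPattern hN₂ h₂ hρ)
      fun K hK s t x hk hs ht hx _ h1 h2 => icosahedral_generation hN₂ h₂ hρ hK hk hs ht hx h1 h2

end Matrix.ProjGenLinGroup

theorem Subgroup.exists_map_conj_eq_of_mulEquiv {P Q : Type*} [Group P] [Group Q] (f : P ≃* Q)
    (h : ∀ (H₁ H₂ : Subgroup P) [Finite H₁], (H₁ ≃* H₂) →
      ∃ c : P, H₂ = H₁.map (MulAut.conj c).toMonoidHom)
    (H₁ H₂ : Subgroup Q) [Finite H₁] (e : H₁ ≃* H₂) :
    ∃ c : Q, H₂ = H₁.map (MulAut.conj c).toMonoidHom := by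
  have e₁ := f.symm.subgroupMap H₁
  have e₂ := f.symm.subgroupMap H₂
  have := Finite.of_equiv _ e₁.toEquiv
  obtain ⟨c, hc⟩ := h _ _ ((e₁.symm.trans e).trans e₂)
  refine ⟨f c, ?_⟩
  have := congrArg (Subgroup.map f.toMonoidHom) hc
  simp only [Subgroup.map_map] at this
  have hid : f.toMonoidHom.comp f.symm.toMonoidHom = MonoidHom.id Q := by ext; simp
  refine Eq.trans ?_ (this.trans ?_)
  · exact ((congrArg (H₂.map ·) hid).trans (Subgroup.map_id H₂)).symm
  · congr 1
    ext; simp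

theorem mainTheorem2 (k : Type u) [Field k] [IsAlgClosed k] [CharZero k] :
    -- (i)
    (∀ H : Subgroup (Cremona₁ k), Finite H → Variety.IsNontriviallySelfCompressible H) ∧
    -- (ii)
    (∀ (H₁ : Subgroup (Cremona₁ k)), Finite H₁ →
      ∀ (X : Variety k) (H₂ : Subgroup X.Bir) (φ : projectiveLine k ⟶ X),
        Variety.IsGroupCompression H₁ H₂ φ →
        (Nontrivial H₁ ∨ 0 < X.dim) →
        Nonempty (X ≅ projectiveLine k) ∧
        ∀ β : X ≅ projectiveLine k,
          (∃ f : (projectiveLine k).scheme ⟶ (projectiveLine k).scheme,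
            f.IsOver (Spec (.of k)) ∧ f.toRationalMap = (φ ≫ β.hom).map) ∧
          Variety.IsGroupCompression H₁ (H₂.map β.conjAut.toMonoidHom) (φ ≫ β.hom) ∧
          ∃ c : Cremona₁ k, H₂.map β.conjAut.toMonoidHom = H₁.map (MulAut.conj c).toMonoidHom) := by
  refine ⟨fun H _ => isNontriviallySelfCompressible_of_finite H, fun H₁ _ X H₂ φ hφ hX =>
    ⟨nonempty_iso_projectiveLine_of_isGroupCompression hφ hX, fun β =>
      ⟨exists_hom_toRationalMap_eq k _, hφ.comp_iso β, ?_⟩⟩⟩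
  exact Subgroup.exists_map_conj_eq_of_mulEquiv (pglEquivCremona k)
    (fun H₁ H₂ _ e => Matrix.ProjGenLinGroup.exists_map_conj_eq H₁ H₂ e) _ _
    (hφ.comp_iso β).nonempty_mulEquiv.some
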